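/- Let $n_1,n_2\ge 0$ be integers and $n=n_1+n_2+1$. Let $\mathbb{S}^{2m+1}$ be the unit sphere of $\mathbb{C}^{m+1}$, let $\Pi:\mathbb{S}^{2n+1}\to\mathbb{C}\mathbb{P}^n$, $\Pi(z)=[z]$, be the Hopf fibration, and endow $\mathbb{C}\mathbb{P}^n$ with the Fubini-Study metric of holomorphic sectional curvature $4$. For an immersion, $H$ is the mean curvature vector (in the sphere, respectively in $\mathbb{C}\mathbb{P}^n$), $J$ is the complex structure, $\mathrm{div}$ is the divergence of the induced metric, and the immersion is minimal if $H=0$. A Legendrian immersion $\psi:N^{m}\to\mathbb{S}^{2m+1}$ (that is, $\langle \psi_*v,J\psi\rangle=0$ for all tangent vectors $v$) is called C-minimal if $\mathrm{div}\,JH=0$; a Lagrangian immersion $\Phi:M^n\to\mathbb{C}\mathbb{P}^n$ (that is, $\langle J\Phi_*v,\Phi_*w\rangle=0$ for all tangent vectors $v,w$) is called H-minimal if $\mathrm{div}\,JH=0$. For every $\theta\in(0,\pi/2)$ there is exactly one curve $\gamma_\theta=(\gamma_1,\gamma_2):\mathbb{R}\to\mathbb{S}^3\subset\mathbb{C}^2$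 with \[ \gamma_j'\,\overline{\gamma_j}=(-1)^{j-1}\,i\,\overline{\gamma_1}^{\,n_1+1}\,\overline{\gamma_2}^{\,n_2+1},\quad j=1,2,\qquad \gamma_\theta(0)=(\cos\theta,\sin\theta). \] Let $\Gamma$ be the set of those $\theta\in(0,\pi/2)$ for which \[ \frac{\cos^{n_1+1}\theta\,\sin^{n_2+1}\theta}{2\pi}\int_0^{T}\frac{dt}{|\gamma_1(t)|^2\,|\gamma_2(t)|^2}\in\mathbb{Q} \] for some common period $T>0$ of $|\gamma_1|$ and $|\gamma_2|$. Let $\theta\in\Gamma$. Then there is $A_0>0$, depending only on $n_1,n_2,\theta$, such that for all non-empty smooth manifolds $N_1,N_2$ of dimensions $n_1,n_2$ and all C-minimal Legendrian immersions $\psi_i:N_i\to\mathbb{S}^{2n_i+1}$, $i=1,2$, the map \[ \Pi\circ\phi_\theta:\mathbb{R}\times N_1\times N_2\to\mathbb{C}\mathbb{P}^n,\qquad \phi_\theta(t,p,q)=(\gamma_1(t)\psi_1(p),\gamma_2(t)\psi_2(q)), \] is $A_0$-periodic in $t$. Moreover, whenever $A>0$ is a period of $\Pi\circ\phi_\theta$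 in $t$, the induced map \[ \Phi_\theta:\mathbb{S}^1\times N_1\times N_2\to\mathbb{C}\mathbb{P}^n,\qquad \Phi_\theta(e^{2\pi i t/A},p,q)=[\phi_\theta(t,p,q)], \] is a well-defined H-minimal Lagrangian immersion, and $\Phi_\theta$ is minimal if and only if both $\psi_1$ and $\psi_2$ are minimal. -/

import Mathlib

open scoped Manifold ContDiff LinearAlgebra.Projectivization ComplexConjugate

noncomputable section

namespace HMinimal

/-! Local extrinsic geometry of a parametrized submanifold `u : E → F` of a Euclidean space `F`,
lying in a submanifold `Q` of `F` whose tangent space at the point `y` is `T y`. -/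

section LocalGeometry

variable {E F V : Type*} [NormedAddCommGroup E] [NormedSpace ℝ E]
  [FiniteDimensional ℝ E] [NormedAddCommGroup F] [InnerProductSpace ℝ F] [AddCommGroup V] [Module ℝ V]

/-- The matrix `g_{ij} = ⟨∂_i u, ∂_j u⟩` of the induced metric, in a fixed basis of `E`. -/
def metricMatrix (u : E → F) (x : E) :
    Matrix (Fin (Module.finrank ℝ E)) (Fin (Module.finrank ℝ E)) ℝ :=
  Matrix.of fun i j =>
    inner ℝ (fderiv ℝ u x (Module.finBasis ℝ E i)) (fderiv ℝ u x (Module.finBasis ℝ E j))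

/-- The trace `∑ g^{ij} B(∂_i, ∂_j)` of a bilinear `B` with respect to the induced metric
(for bilinear `B` it does not depend on the basis). -/
def metricTrace (u : E → F) (x : E) (B : E → E → V) : V :=
  ∑ i, ∑ j, (metricMatrix u x)⁻¹ i j • B (Module.finBasis ℝ E i) (Module.finBasis ℝ E j)

variable [FiniteDimensional ℝ F]

/-- The mean curvature vector `H = (1/n) tr_g σ` of `u` in `Q`. The second fundamental form `σ` of
`u` in `Q` is the component of the flat second derivative `D²u` in the normal space
`T_{u x} Q ∩ (du(T_x))ᗮ` (Gauss formula). -/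
def meanCurvature (T : F → Submodule ℝ F) (u : E → F) (x : E) : F :=
  (T (u x) ⊓ (LinearMap.range (fderiv ℝ u x).toLinearMap)ᗮ).starProjection
    ((Module.finrank ℝ E : ℝ)⁻¹ • metricTrace u x fun v w => fderiv ℝ (fderiv ℝ u) x v w)

/-- The divergence `∑ g^{ij} ⟨∂_i X, ∂_j u⟩` of an `F`-valued field `X` along `u`. If `X` is
tangent to `u`, the covariant derivative of `X` for the induced metric is the tangential part of
its flat derivative, so this is then the usual Riemannian divergence of `X`. -/
def divergence (u X : E → F) (x : E) : ℝ :=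
  metricTrace u x fun v w => inner ℝ (fderiv ℝ X x v) (fderiv ℝ u x w)

/-- `div JH`, where `J y` is the complex structure at the point `y`. -/
def divJH (T : F → Submodule ℝ F) (J : F → F → F) (u : E → F) (x : E) : ℝ :=
  divergence u (fun y => J (u y) (meanCurvature T u y)) x

end LocalGeometry

section Immersions

variable {E H M F : Type*} [NormedAddCommGroup E] [NormedSpace ℝ E] [TopologicalSpace H]
  (I : ModelWithCorners ℝ E H) [TopologicalSpace M] [ChartedSpace H M]
  [NormedAddCommGroup F] [InnerProductSpace ℝ F]

/-- The differential of `f : M → F` at `p`. -/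
def differential (f : M → F) (p : M) : TangentSpace I p →L[ℝ] F := mfderiv I 𝓘(ℝ, F) f p

/-- Smooth immersions of a manifold in a Euclidean space. -/
def IsImmersion (f : M → F) : Prop :=
  ContMDiff I 𝓘(ℝ, F) ∞ f ∧ ∀ p, Function.Injective (differential I f p)

/-- The expression of `f` in the preferred chart at `p`. -/
def localRep (f : M → F) (p : M) : E → F := f ∘ (extChartAt I p).symm

end Immersions

/-! The unit sphere `S^{2m+1}` of `ℂ^{m+1} = ℂ^ι`, `|ι| = m + 1`. -/

section Sphere

/-- The unit sphere of `ℂ^ι`. -/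
abbrev Sph (ι : Type*) [Fintype ι] : Type _ := Metric.sphere (0 : EuclideanSpace ℂ ι) 1

variable {ι : Type*} [Fintype ι]

/-- The tangent space of the unit sphere at `z`. -/
def sphTangent (z : EuclideanSpace ℂ ι) : Submodule ℝ (EuclideanSpace ℂ ι) :=
  (Submodule.span ℝ {z})ᗮ

/-- The complex structure of `ℂ^ι`. -/
def sphJ (_z v : EuclideanSpace ℂ ι) : EuclideanSpace ℂ ι := Complex.I • v

variable {E H M : Type*} [NormedAddCommGroup E] [NormedSpace ℝ E] [FiniteDimensional ℝ E]
  [TopologicalSpace H]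
  (I : ModelWithCorners ℝ E H) [TopologicalSpace M] [ChartedSpace H M]

/-- The map `ψ` into the sphere, seen as a map into `ℂ^ι`. -/
def sphCoe (ψ : M → Sph ι) : M → EuclideanSpace ℂ ι := fun p => (ψ p : EuclideanSpace ℂ ι)

/-- Legendrian immersions `ψ : M^m → S^{2m+1}`: the Liouville form `Λ_z(v) = ⟨v, Jz⟩` pulls back
to zero. -/
def IsLegendrian (ψ : M → Sph ι) : Prop :=
  Module.finrank ℝ E + 1 = Fintype.card ι ∧
  IsImmersion I (sphCoe ψ) ∧
  ∀ (p : M) (v : TangentSpace I p),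
    inner ℝ (differential I (sphCoe ψ) p v) (Complex.I • sphCoe ψ p) = 0

/-- Minimal immersions in the sphere: `H = 0`. -/
def IsMinimalSph (ψ : M → Sph ι) : Prop :=
  ∀ p : M, meanCurvature sphTangent (localRep I (sphCoe ψ) p) (extChartAt I p p) = 0

/-- C-minimal Legendrian immersions: `div JH = 0`. -/
def IsCMinimalLegendrian (ψ : M → Sph ι) : Prop :=
  IsLegendrian I ψ ∧
  ∀ p : M, divJH sphTangent sphJ (localRep I (sphCoe ψ) p) (extChartAt I p p) = 0

end Sphere

/-! The complex projective space `ℂP^n`, the set of lines of `ℂ^ι`, `|ι| = n + 1`. A line is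
identified with the orthogonal projection `P` onto it; this embeds `ℂP^n` in the Hermitian matrices,
and the Fubini-Study metric of holomorphic sectional curvature 4 is the metric induced by the inner
product `(1/2) Re tr(X Yᴴ)`. The factor `1/2` is realized by using `(1/√2) P`. -/

section Projective

/-- The complex projective space of lines in `ℂ^ι`. -/
abbrev CP (ι : Type*) [Fintype ι] : Type _ := ℙ ℂ (EuclideanSpace ℂ ι)

/-- Square complex matrices, with the Euclidean inner product of their entries. -/
abbrev MatSpace (ι : Type*) [Fintype ι] : Type _ := EuclideanSpace ℂ (ι × ι)

variable {ι : Type*} [Fintype ι]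

/-- The Hopf fibration `z ↦ [z]`. -/
def hopf (z : Sph ι) : CP ι :=
  Projectivization.mk ℂ (z : EuclideanSpace ℂ ι) (ne_zero_of_mem_unit_sphere z)

/-- The isometric embedding `[z] ↦ (1/√2) P`, `P = z zᴴ / |z|²`. -/
def cpEmb (ℓ : CP ι) : MatSpace ι :=
  WithLp.toLp 2 fun a => ((√2)⁻¹ : ℂ) * (ℓ.rep a.1 * conj (ℓ.rep a.2) / (‖ℓ.rep‖ : ℂ) ^ 2)

/-- An element of `MatSpace ι` as a matrix. -/
def toMat (X : MatSpace ι) : Matrix ι ι ℂ := Matrix.of fun i j => X (i, j)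

/-- The projection `P` for which `A = (1/√2) P`. -/
def projMat (A : MatSpace ι) : Matrix ι ι ℂ := (√2 : ℂ) • toMat A

/-- The tangent space of `ℂP^n` at `A = (1/√2) P`: the Hermitian matrices `X` with
`P X + X P = X`. -/
def cpTangent (A : MatSpace ι) : Submodule ℝ (MatSpace ι) where
  carrier := {X | (toMat X).IsHermitian ∧ projMat A * toMat X + toMat X * projMat A = toMat X}
  add_mem' := by
    rintro X Y ⟨hX, hX'⟩ ⟨hY, hY'⟩
    have h : toMat (X + Y) = toMat X + toMat Y := rfl
    refine ⟨?_, ?_⟩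
    · rw [h]; exact hX.add hY
    · rw [h, mul_add, add_mul]
      nth_rewrite 3 [← hX']
      nth_rewrite 3 [← hY']
      abel
  zero_mem' := by
    have h : toMat (0 : MatSpace ι) = 0 := rfl
    simp [h]
  smul_mem' := by
    rintro c X ⟨hX, hX'⟩
    have h : toMat (c • X) = c • toMat X := rfl
    refine ⟨?_, ?_⟩
    · rw [h]
      change (c • toMat X).conjTranspose = c • toMat X
      rw [Matrix.conjTranspose_smul, hX.eq, star_trivial]
    · rw [h, Matrix.mul_smul, Matrix.smul_mul, ← smul_add, hX']

/-- The complex structure of `ℂP^n` at `A = (1/√2) P`: `X ↦ i (X P - P X)`, which takes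
`v zᴴ + z vᴴ` to `(i v) zᴴ + z (i v)ᴴ` if `P = z zᴴ` and `v` is orthogonal to `z`. -/
def cpJ (A X : MatSpace ι) : MatSpace ι :=
  WithLp.toLp 2 fun a =>
    (Complex.I • (toMat X * projMat A - projMat A * toMat X)) a.1 a.2

variable {E H M : Type*} [NormedAddCommGroup E] [NormedSpace ℝ E] [FiniteDimensional ℝ E]
  [TopologicalSpace H]
  (I : ModelWithCorners ℝ E H) [TopologicalSpace M] [ChartedSpace H M]

/-- Lagrangian immersions `Φ : M^n → ℂP^n`: the Kähler form `ω(X, Y) = ⟨JX, Y⟩` pulls back to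
zero. -/
def IsLagrangian (Φ : M → CP ι) : Prop :=
  Module.finrank ℝ E + 1 = Fintype.card ι ∧
  IsImmersion I (cpEmb ∘ Φ) ∧
  ∀ (p : M) (v w : TangentSpace I p),
    inner ℝ (cpJ (cpEmb (Φ p)) (differential I (cpEmb ∘ Φ) p v))
      (differential I (cpEmb ∘ Φ) p w) = 0

/-- Minimal immersions in `ℂP^n`: `H = 0`. -/
def IsMinimalCP (Φ : M → CP ι) : Prop :=
  ∀ p : M, meanCurvature cpTangent (localRep I (cpEmb ∘ Φ) p) (extChartAt I p p) = 0

/-- H-minimal (Hamiltonian minimal) Lagrangian immersions: `div JH = 0`. -/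
def IsHMinimalLagrangian (Φ : M → CP ι) : Prop :=
  IsLagrangian I Φ ∧
  ∀ p : M, divJH cpTangent cpJ (localRep I (cpEmb ∘ Φ) p) (extChartAt I p p) = 0

end Projective

/-! The curves `γ_θ`, the set `Γ` and the immersions `φ_θ`. -/

/-- The component `γ_j` of a curve in `S^3`. -/
def comp (γ : ℝ → Sph (Fin 2)) (j : Fin 2) : ℝ → ℂ := fun t => (γ t : EuclideanSpace ℂ (Fin 2)) j

/-- `γ : ℝ → S^3` solves `γ_j' γ̄_j = (-1)^{j-1} i γ̄_1^{n₁+1} γ̄_2^{n₂+1}`, `j = 1, 2`, with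
`γ(0) = (cos θ, sin θ)`. The indices `1, 2` are here `0, 1`. -/
def IsGammaCurve (n₁ n₂ : ℕ) (θ : ℝ) (γ : ℝ → Sph (Fin 2)) : Prop :=
  (∀ j : Fin 2, Differentiable ℝ (comp γ j) ∧ ∀ t : ℝ,
    deriv (comp γ j) t * conj (comp γ j t) =
      (-1) ^ (j : ℕ) * Complex.I * conj (comp γ 0 t) ^ (n₁ + 1) * conj (comp γ 1 t) ^ (n₂ + 1)) ∧
  comp γ 0 0 = Real.cos θ ∧ comp γ 1 0 = Real.sin θ

/-- The set `Γ ⊂ (0, π/2)`; `T > 0` is a common period of `|γ_1|` and `|γ_2|`. -/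
def GammaSet (n₁ n₂ : ℕ) : Set ℝ :=
  {θ | θ ∈ Set.Ioo 0 (Real.pi / 2) ∧ ∃ γ : ℝ → Sph (Fin 2), IsGammaCurve n₁ n₂ θ γ ∧
    ∃ T : ℝ, 0 < T ∧ (∀ j : Fin 2, Function.Periodic (fun t => ‖comp γ j t‖) T) ∧
      ∃ r : ℚ, Real.cos θ ^ (n₁ + 1) * Real.sin θ ^ (n₂ + 1) / (2 * Real.pi) *
        (∫ t in (0 : ℝ)..T, 1 / (‖comp γ 0 t‖ ^ 2 * ‖comp γ 1 t‖ ^ 2)) = (r : ℝ)}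

/-- The point `(w_1 x, w_2 y)` of the unit sphere of `ℂ^{m₁} × ℂ^{m₂}`. -/
def join {ι₁ ι₂ : Type*} [Fintype ι₁] [Fintype ι₂] (w : Sph (Fin 2)) (x : Sph ι₁) (y : Sph ι₂) :
    Sph (ι₁ ⊕ ι₂) :=
  ⟨WithLp.toLp 2 (Sum.elim
      (fun i => (w : EuclideanSpace ℂ (Fin 2)) 0 * (x : EuclideanSpace ℂ ι₁) i)
      (fun i => (w : EuclideanSpace ℂ (Fin 2)) 1 * (y : EuclideanSpace ℂ ι₂) i)), by
    have hw := w.2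
    have hx := x.2
    have hy := y.2
    rw [mem_sphere_zero_iff_norm, EuclideanSpace.norm_eq, Real.sqrt_eq_one] at hw hx hy ⊢
    simp only [Fintype.sum_sum_type, Sum.elim_inl, Sum.elim_inr, norm_mul, mul_pow,
      ← Finset.mul_sum, hx, hy, mul_one]
    simpa [Fin.sum_univ_two] using hw⟩

/-- `φ_θ(t, p, q) = (γ_1(t) ψ₁(p), γ_2(t) ψ₂(q))`, with values in the unit sphere of
`ℂ^{n₁+1} × ℂ^{n₂+1} = ℂ^{n+1}`, `n = n₁ + n₂ + 1`. -/
def phi {n₁ n₂ : ℕ} {N₁ N₂ : Type*} (γ : ℝ → Sph (Fin 2))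
    (ψ₁ : N₁ → Sph (Fin (n₁ + 1))) (ψ₂ : N₂ → Sph (Fin (n₂ + 1)))
    (t : ℝ) (p : N₁) (q : N₂) : Sph (Fin (n₁ + 1) ⊕ Fin (n₂ + 1)) :=
  join (γ t) (ψ₁ p) (ψ₂ q)

end HMinimal

end

/-! All the geometry is done on the Legendrian lift. The Hopf fibration is a Riemannian submersion,
and a Legendrian immersion is horizontal with horizontal mean curvature vector H. Hence its
projection is Lagrangian, has the projection of H as mean curvature vector, and has the same div JH
(`IsLegendrianOn.meanCurvature_veronese`, `IsLegendrianOn.divJH_veronese`). In the model of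
projective space by projection matrices, `symProd z v` is the image of the horizontal vector v at z.

It remains to study the join φ. Its tangent space splits orthogonally into the direction of the
curve and those of the two factors, whose metrics are scaled by |γ_j|². Tracing in an adapted
orthonormal frame gives n H = (n₁|γ₁|⁻² γ₁ H₁, n₂|γ₂|⁻² γ₂ H₂) (`meanCurvature_warp`). The component
along J of the curve direction vanishes because γ is critical for the length weighted by
|γ₁|^{n₁}|γ₂|^{n₂} (`IsGammaFlow.inner_deriv_deriv`). So H = 0 exactly when H₁ = H₂ = 0, and n div
JH = n₁|γ₁|⁻² div JH₁ + n₂|γ₂|⁻² div JH₂ (`divJH_warp`).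

For the period, put G = γ₁^{n₁+1} γ₂^{n₂+1}. Its real part is conserved and equals c = cos^{n₁+1}θ
sin^{n₂+1}θ > 0, so neither component vanishes. The logarithmic derivative of γ₁/γ₂ is i
conj(G)/(|γ₁|²|γ₂|²), with imaginary part c/(|γ₁|²|γ₂|²). Over a common period T of the moduli the
quotient therefore turns by 2πr with r rational, and closes up after r.den periods
(`IsGammaFlow.exists_period`). -/

noncomputable section

namespace HMinimal

/-! ### Global integral curves of the field defining γ_θ -/

/-- A compactly supported `C^1` vector field has global integral curves. -/
theorem exists_integralCurve_of_hasCompactSupport {G : Type*} [NormedAddCommGroup G]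
    [NormedSpace ℝ G] [CompleteSpace G] {f : G → G} (hf : ContDiff ℝ 1 f)
    (hc : HasCompactSupport f) (x : G) :
    ∃ γ : ℝ → G, γ 0 = x ∧ ∀ t, HasDerivAt γ (f (γ t)) t := by
  obtain ⟨K, hK⟩ := ContDiff.lipschitzWith_of_hasCompactSupport hc hf one_ne_zero
  obtain ⟨C, hC⟩ := hc.exists_bound_of_continuous hf.continuous
  have hC0 : 0 ≤ C := (norm_nonneg _).trans (hC 0)
  have hloc : ∀ a : ℝ, ∃ γ : ℝ → G, γ 0 = x ∧
      IsMIntegralCurveOn (I := 𝓘(ℝ, G)) γ f (Set.Ioo (-a) a) := by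
    intro a
    have hT : (0 : ℝ) ≤ |a| + 1 := by positivity
    -- A solution of a field bounded by C moves at most C(|a| + 1) in this time. With a ball of that
    -- radius the Picard-Lindelöf condition holds on the whole interval.
    have hpl : IsPicardLindelof (fun _ => f) (tmin := -(|a| + 1)) (tmax := |a| + 1)
        ⟨0, neg_nonpos.2 hT, hT⟩ x (⟨C, hC0⟩ * ⟨|a| + 1, hT⟩) 0 ⟨C, hC0⟩ K := by
      refine .of_time_independent (fun y _ => hC y) (hK.lipschitzOnWith) ?_
      simp only [sub_zero, zero_sub, neg_neg, max_self, NNReal.coe_zero]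
      exact le_rfl
    obtain ⟨α, h0, hα⟩ := hpl.exists_eq_forall_mem_Icc_hasDerivWithinAt₀
    refine ⟨α, h0, fun t ht => ?_⟩
    have h1 := neg_abs_le a
    have h2 := le_abs_self a
    have ht' : t ∈ Set.Ioo (-(|a| + 1)) (|a| + 1) := by
      constructor
      · have := ht.1
        have := neg_le_abs a
        linarith
      · have := ht.2
        linarith
    have hd : HasDerivAt α (f (α t)) t :=
      (hα t (Set.Ioo_subset_Icc_self ht')).hasDerivAt (Icc_mem_nhds ht'.1 ht'.2)
    exact hd.hasFDerivAt.hasFDerivWithinAt.hasMFDerivWithinAt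
  obtain ⟨γ, h0, hγ⟩ := (exists_isMIntegralCurve_iff_exists_isMIntegralCurveOn_Ioo
    (contMDiff_vectorSpace_iff_contDiff.2 hf) x).2 hloc
  refine ⟨γ, h0, fun t => ?_⟩
  have h : HasFDerivAt γ ((1 : ℝ →L[ℝ] ℝ).smulRight (f (γ t))) t := (hγ t).hasFDerivAt
  simpa using h.hasDerivAt

/-- The vector field on `ℂ²` whose integral curves are the curves `γ_θ`. -/
def gammaField (n₁ n₂ : ℕ) (w : EuclideanSpace ℂ (Fin 2)) : EuclideanSpace ℂ (Fin 2) :=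
  !₂[Complex.I * conj (w 0) ^ n₁ * conj (w 1) ^ (n₂ + 1),
    -Complex.I * conj (w 0) ^ (n₁ + 1) * conj (w 1) ^ n₂]

theorem contDiff_gammaField (n₁ n₂ : ℕ) {m : ℕ∞ω} : ContDiff ℝ m (gammaField n₁ n₂) := by
  have h : ∀ j : Fin 2, ContDiff ℝ m fun w : EuclideanSpace ℂ (Fin 2) => conj (w j) := fun j =>
    Complex.conjCLE.contDiff.comp ((EuclideanSpace.proj (𝕜 := ℂ) j).restrictScalars ℝ).contDiff
  rw [contDiff_piLp]
  intro j
  fin_cases j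
  · exact (contDiff_const.mul ((h 0).pow n₁)).mul ((h 1).pow (n₂ + 1))
  · exact (contDiff_const.mul ((h 0).pow (n₁ + 1))).mul ((h 1).pow n₂)

/-- The two components contribute the same product with opposite signs. So the field is tangent to
all spheres about the origin. -/
theorem inner_gammaField (n₁ n₂ : ℕ) (w : EuclideanSpace ℂ (Fin 2)) :
    inner ℝ w (gammaField n₁ n₂ w) = 0 := by
  simp only [PiLp.inner_apply, Fin.sum_univ_two, gammaField, Complex.inner]
  simp only [Matrix.cons_val_zero, Matrix.cons_val_one]
  rw [← Complex.add_re]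
  convert Complex.zero_re using 2
  ring

theorem exists_integralCurve_gammaField (n₁ n₂ : ℕ) (x : EuclideanSpace ℂ (Fin 2)) (hx : ‖x‖ = 1) :
    ∃ γ : ℝ → EuclideanSpace ℂ (Fin 2), γ 0 = x ∧ (∀ t, ‖γ t‖ = 1) ∧
      ∀ t, HasDerivAt γ (gammaField n₁ n₂ (γ t)) t := by
  -- The cutoff makes the field compactly supported. It equals 1 on the closed unit ball, which the
  -- solution never leaves, so it disappears at the end.
  let χ : ContDiffBump (0 : EuclideanSpace ℂ (Fin 2)) := ⟨1, 2, one_pos, one_lt_two⟩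
  obtain ⟨γ, h0, hγ⟩ := exists_integralCurve_of_hasCompactSupport
    (f := fun w => χ w • gammaField n₁ n₂ w) (χ.contDiff.smul (contDiff_gammaField n₁ n₂))
    (χ.hasCompactSupport.smul_right) x
  have hn : ∀ t, ‖γ t‖ ^ 2 = 1 := by
    intro t
    have hd : ∀ t, HasDerivAt (fun t => ‖γ t‖ ^ 2) 0 t := by
      intro t
      have := (hγ t).norm_sq
      rwa [inner_smul_right, inner_gammaField, mul_zero, mul_zero] at this
    have := is_const_of_deriv_eq_zero (fun t => (hd t).differentiableAt) (fun t => (hd t).deriv) t 0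
    simpa [h0, hx] using this
  have hn' : ∀ t, ‖γ t‖ = 1 := fun t => by
    have := hn t
    rwa [pow_eq_one_iff_of_nonneg (norm_nonneg _) two_ne_zero] at this
  refine ⟨γ, h0, hn', fun t => ?_⟩
  have := hγ t
  rwa [χ.one_of_mem_closedBall (by simp [χ, hn' t]), one_smul] at this

/-! ### The conserved quantity, nonvanishing, smoothness and uniqueness of γ_θ -/

theorem comp_norm_sq_add (γ : ℝ → Sph (Fin 2)) (t : ℝ) :
    ‖comp γ 0 t‖ ^ 2 + ‖comp γ 1 t‖ ^ 2 = 1 := by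
  have h := (γ t).2
  rw [mem_sphere_zero_iff_norm, EuclideanSpace.norm_eq, Real.sqrt_eq_one, Fin.sum_univ_two] at h
  exact h

theorem hasDerivAt_conj_comp {g : ℝ → ℂ} {g' : ℂ} {t : ℝ} (h : HasDerivAt g g' t) :
    HasDerivAt (fun t => conj (g t)) (conj g') t :=
  Complex.conjCLE.hasFDerivAt.comp_hasDerivAt t h

theorem mul_conj_pow (z : ℂ) (n : ℕ) : z ^ n * conj z ^ n = ((‖z‖ ^ 2) ^ n : ℝ) := by
  rw [← mul_pow, Complex.mul_conj, Complex.normSq_eq_norm_sq, ← Complex.ofReal_pow]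

/-- The system solved by the nonvanishing curves `γ_θ`. -/
structure IsGammaFlow (n₁ n₂ : ℕ) (g₀ g₁ : ℝ → ℂ) : Prop where
  hasDerivAt_fst (t : ℝ) :
    HasDerivAt g₀ (Complex.I * conj (g₀ t) ^ n₁ * conj (g₁ t) ^ (n₂ + 1)) t
  hasDerivAt_snd (t : ℝ) :
    HasDerivAt g₁ (-Complex.I * conj (g₀ t) ^ (n₁ + 1) * conj (g₁ t) ^ n₂) t
  fst_ne_zero (t : ℝ) : g₀ t ≠ 0
  snd_ne_zero (t : ℝ) : g₁ t ≠ 0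
  norm_sq_add (t : ℝ) : ‖g₀ t‖ ^ 2 + ‖g₁ t‖ ^ 2 = 1

/-- The derivative of g₀^{n₁+1} g₁^{n₂+1} is i times a real number, because each g_j' is ±i times a
product of conjugates. -/
theorem hasDerivAt_hamiltonian {n₁ n₂ : ℕ} {g₀ g₁ : ℝ → ℂ} {t : ℝ}
    (h₀ : HasDerivAt g₀ (Complex.I * conj (g₀ t) ^ n₁ * conj (g₁ t) ^ (n₂ + 1)) t)
    (h₁ : HasDerivAt g₁ (-Complex.I * conj (g₀ t) ^ (n₁ + 1) * conj (g₁ t) ^ n₂) t) :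
    HasDerivAt (fun t => (g₀ t ^ (n₁ + 1) * g₁ t ^ (n₂ + 1)).re) 0 t := by
  have h := (h₀.pow (n₁ + 1)).mul (h₁.pow (n₂ + 1))
  have h' := Complex.reCLM.hasFDerivAt.comp_hasDerivAt t h
  refine h'.congr_deriv ?_
  simp only [Complex.reCLM_apply, Nat.add_sub_cancel, Pi.pow_apply]
  have : (((n₁ + 1 : ℕ) : ℂ) * g₀ t ^ n₁ * (Complex.I * conj (g₀ t) ^ n₁ * conj (g₁ t) ^ (n₂ + 1))
        * g₁ t ^ (n₂ + 1) + g₀ t ^ (n₁ + 1) *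
        (((n₂ + 1 : ℕ) : ℂ) * g₁ t ^ n₂ * (-Complex.I * conj (g₀ t) ^ (n₁ + 1) * conj (g₁ t) ^ n₂)))
      = Complex.I * (((n₁ + 1 : ℕ) * ((‖g₀ t‖ ^ 2) ^ n₁ * (‖g₁ t‖ ^ 2) ^ (n₂ + 1)) -
        (n₂ + 1 : ℕ) * ((‖g₀ t‖ ^ 2) ^ (n₁ + 1) * (‖g₁ t‖ ^ 2) ^ n₂) : ℝ) : ℂ) := by
    push_cast only [Complex.ofReal_sub, Complex.ofReal_mul, ← mul_conj_pow]
    simp only [Complex.ofReal_natCast]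
    ring
  rw [this, Complex.I_mul_re, Complex.ofReal_im, neg_zero]

/-- The defining equation is multiplied by conj γ_j, so it determines γ_j' only where γ_j ≠ 0. -/
theorem IsGammaCurve.hasDerivAt {n₁ n₂ : ℕ} {θ : ℝ} {γ : ℝ → Sph (Fin 2)}
    (h : IsGammaCurve n₁ n₂ θ γ) {t : ℝ} (h₀ : comp γ 0 t ≠ 0) (h₁ : comp γ 1 t ≠ 0) :
    HasDerivAt (comp γ 0)
      (Complex.I * conj (comp γ 0 t) ^ n₁ * conj (comp γ 1 t) ^ (n₂ + 1)) t ∧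
    HasDerivAt (comp γ 1)
      (-Complex.I * conj (comp γ 0 t) ^ (n₁ + 1) * conj (comp γ 1 t) ^ n₂) t := by
  have h₀' : conj (comp γ 0 t) ≠ 0 := by simpa using h₀
  have h₁' : conj (comp γ 1 t) ≠ 0 := by simpa using h₁
  constructor
  · refine ((h.1 0).1 t).hasDerivAt.congr_deriv (mul_right_cancel₀ h₀' ?_)
    rw [(h.1 0).2 t]
    simp only [Fin.val_zero]
    ring
  · refine ((h.1 1).1 t).hasDerivAt.congr_deriv (mul_right_cancel₀ h₁' ?_)
    rw [(h.1 1).2 t]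
    simp only [Fin.val_one]
    ring

theorem cos_pow_mul_sin_pow_pos (n₁ n₂ : ℕ) {θ : ℝ} (hθ : θ ∈ Set.Ioo 0 (Real.pi / 2)) :
    0 < Real.cos θ ^ (n₁ + 1) * Real.sin θ ^ (n₂ + 1) :=
  mul_pos (pow_pos (Real.cos_pos_of_mem_Ioo ⟨by linarith [hθ.1, Real.pi_pos], hθ.2⟩) _)
    (pow_pos (Real.sin_pos_of_mem_Ioo ⟨hθ.1, by linarith [hθ.2, Real.pi_pos]⟩) _)

/-- Conservation needs nonvanishing components, and nonvanishing is only known where the quantity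
equals c > 0. Connectedness of the line breaks the circle: the set where the value is c is closed,
nonempty, and open because the components stay nonzero near each of its points. -/
theorem IsGammaCurve.hamiltonian_eq {n₁ n₂ : ℕ} {θ : ℝ} (hθ : θ ∈ Set.Ioo 0 (Real.pi / 2))
    {γ : ℝ → Sph (Fin 2)} (h : IsGammaCurve n₁ n₂ θ γ) (t : ℝ) :
    (comp γ 0 t ^ (n₁ + 1) * comp γ 1 t ^ (n₂ + 1)).re =
      Real.cos θ ^ (n₁ + 1) * Real.sin θ ^ (n₂ + 1) := by
  have hpos := cos_pow_mul_sin_pow_pos n₁ n₂ hθ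
  set c := Real.cos θ ^ (n₁ + 1) * Real.sin θ ^ (n₂ + 1) with hc
  have c₀ : Continuous (comp γ 0) := (h.1 0).1.continuous
  have c₁ : Continuous (comp γ 1) := (h.1 1).1.continuous
  have hcont : Continuous fun t => (comp γ 0 t ^ (n₁ + 1) * comp γ 1 t ^ (n₂ + 1)).re := by
    fun_prop
  have hne : ∀ t, (comp γ 0 t ^ (n₁ + 1) * comp γ 1 t ^ (n₂ + 1)).re = c →
      comp γ 0 t ≠ 0 ∧ comp γ 1 t ≠ 0 := by
    intro t ht
    constructor <;> intro h0 <;> simp [h0] at ht <;> exact hpos.ne ht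
  have hclopen : IsClopen {t | (comp γ 0 t ^ (n₁ + 1) * comp γ 1 t ^ (n₂ + 1)).re = c} := by
    refine ⟨isClosed_eq hcont continuous_const, isOpen_iff_mem_nhds.2 fun t ht => ?_⟩
    have hev : ∀ᶠ s in nhds t, comp γ 0 s ≠ 0 ∧ comp γ 1 s ≠ 0 :=
      (c₀.continuousAt.eventually_ne (hne t ht).1).and (c₁.continuousAt.eventually_ne (hne t ht).2)
    obtain ⟨ε, hε, hball⟩ := Metric.eventually_nhds_iff_ball.1 hev
    refine Filter.mem_of_superset (Metric.ball_mem_nhds t hε) fun s hs => ?_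
    have hd : ∀ x ∈ Metric.ball t ε, HasDerivAt
        (fun t => (comp γ 0 t ^ (n₁ + 1) * comp γ 1 t ^ (n₂ + 1)).re) 0 x := fun x hx =>
      hasDerivAt_hamiltonian (h.hasDerivAt (hball x hx).1 (hball x hx).2).1
        (h.hasDerivAt (hball x hx).1 (hball x hx).2).2
    have := Metric.isOpen_ball.is_const_of_deriv_eq_zero (convex_ball t ε).isPreconnected
      (fun x hx => (hd x hx).differentiableAt.differentiableWithinAt) (fun x hx => (hd x hx).deriv)
      hs (Metric.mem_ball_self hε)
    exact this.trans ht
  have huniv := hclopen.eq_univ ⟨0, by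
    simp only [Set.mem_ofPred_eq, h.2.1, h.2.2, ← Complex.ofReal_pow, ← Complex.ofReal_mul,
      Complex.ofReal_re, hc]⟩
  exact huniv.ge (Set.mem_univ t)

theorem IsGammaCurve.isGammaFlow {n₁ n₂ : ℕ} {θ : ℝ} (hθ : θ ∈ Set.Ioo 0 (Real.pi / 2))
    {γ : ℝ → Sph (Fin 2)} (h : IsGammaCurve n₁ n₂ θ γ) :
    IsGammaFlow n₁ n₂ (comp γ 0) (comp γ 1) := by
  have hpos := cos_pow_mul_sin_pow_pos n₁ n₂ hθ
  have hne : ∀ t, comp γ 0 t ≠ 0 ∧ comp γ 1 t ≠ 0 := by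
    intro t
    have ht := h.hamiltonian_eq hθ t
    constructor <;> intro h0 <;> simp [h0] at ht <;> exact hpos.ne (by simpa using ht)
  exact ⟨fun t => (h.hasDerivAt (hne t).1 (hne t).2).1, fun t => (h.hasDerivAt (hne t).1 (hne t).2).2,
    fun t => (hne t).1, fun t => (hne t).2, comp_norm_sq_add γ⟩

theorem IsGammaFlow.contDiff {n₁ n₂ : ℕ} {g₀ g₁ : ℝ → ℂ} (h : IsGammaFlow n₁ n₂ g₀ g₁) :
    ContDiff ℝ ∞ g₀ ∧ ContDiff ℝ ∞ g₁ := by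
  -- Bootstrapping: the derivatives are polynomials in the conjugates of g₀ and g₁.
  have key : ∀ m : ℕ, ContDiff ℝ m g₀ ∧ ContDiff ℝ m g₁ := by
    intro m
    induction m with
    | zero =>
      exact ⟨contDiff_zero.2 (continuous_iff_continuousAt.2 fun t => (h.hasDerivAt_fst t).continuousAt),
        contDiff_zero.2 (continuous_iff_continuousAt.2 fun t => (h.hasDerivAt_snd t).continuousAt)⟩
    | succ m ih =>
      have c₀ : ContDiff ℝ m fun t => conj (g₀ t) := Complex.conjCLE.contDiff.comp ih.1
      have c₁ : ContDiff ℝ m fun t => conj (g₁ t) := Complex.conjCLE.contDiff.comp ih.2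
      rw [show ((m + 1 : ℕ) : ℕ∞ω) = (m : ℕ∞ω) + 1 by norm_cast, contDiff_succ_iff_deriv,
        contDiff_succ_iff_deriv]
      refine ⟨⟨fun t => (h.hasDerivAt_fst t).differentiableAt, by simp, ?_⟩,
        ⟨fun t => (h.hasDerivAt_snd t).differentiableAt, by simp, ?_⟩⟩
      · rw [funext fun t => (h.hasDerivAt_fst t).deriv]
        exact (contDiff_const.mul (c₀.pow n₁)).mul (c₁.pow (n₂ + 1))
      · rw [funext fun t => (h.hasDerivAt_snd t).deriv]
        exact (contDiff_const.mul (c₀.pow (n₁ + 1))).mul (c₁.pow n₂)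
  exact ⟨contDiff_infty.2 fun m => (key m).1, contDiff_infty.2 fun m => (key m).2⟩

theorem IsGammaFlow.hasDerivAt_toLp {n₁ n₂ : ℕ} {g₀ g₁ : ℝ → ℂ} (h : IsGammaFlow n₁ n₂ g₀ g₁)
    (t : ℝ) : HasDerivAt (fun t => (!₂[g₀ t, g₁ t] : EuclideanSpace ℂ (Fin 2)))
      (gammaField n₁ n₂ !₂[g₀ t, g₁ t]) t := by
  refine (PiLp.continuousLinearEquiv 2 ℝ
    (fun _ : Fin 2 => ℂ)).symm.hasFDerivAt.comp_hasDerivAt t (hasDerivAt_pi.2 fun j => ?_)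
  fin_cases j
  · exact h.hasDerivAt_fst t
  · exact h.hasDerivAt_snd t

theorem toLp_comp (γ : ℝ → Sph (Fin 2)) (t : ℝ) :
    (!₂[comp γ 0 t, comp γ 1 t] : EuclideanSpace ℂ (Fin 2)) = γ t := by
  ext j
  fin_cases j <;> rfl

/-- For every `θ` in `(0, π/2)` there is exactly one curve `γ_θ`. -/
theorem existsUnique_isGammaCurve (n₁ n₂ : ℕ) {θ : ℝ} (hθ : θ ∈ Set.Ioo 0 (Real.pi / 2)) :
    ∃! γ : ℝ → Sph (Fin 2), IsGammaCurve n₁ n₂ θ γ := by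
  refine existsUnique_of_exists_of_unique ?_ ?_
  · obtain ⟨γ, h0, hn, hd⟩ := exists_integralCurve_gammaField n₁ n₂
      !₂[(Real.cos θ : ℂ), (Real.sin θ : ℂ)] (by
        rw [EuclideanSpace.norm_eq, Real.sqrt_eq_one, Fin.sum_univ_two]
        simp [-Complex.ofReal_cos, -Complex.ofReal_sin])
    have hj : ∀ j t, HasDerivAt (fun t => γ t j) (gammaField n₁ n₂ (γ t) j) t := fun j t =>
      ((EuclideanSpace.proj (𝕜 := ℂ) j).restrictScalars ℝ).hasFDerivAt.comp_hasDerivAt t (hd t)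
    refine ⟨fun t => ⟨γ t, by simp [hn t]⟩, ?_, ?_, ?_⟩
    · intro j
      refine ⟨fun t => (hj j t).differentiableAt, fun t => ?_⟩
      change deriv (fun t => γ t j) t * conj (γ t j) = _
      rw [(hj j t).deriv]
      fin_cases j
      · simp only [comp, gammaField]
        simp
        ring
      · simp only [comp, gammaField]
        simp
        ring
    · simp [comp, h0]
    · simp [comp, h0]
  · intro γ γ' h h'
    -- The field is only locally Lipschitz, but all the curves lie in the compact convex unit ball.
    obtain ⟨K, hK⟩ := ContDiffOn.exists_lipschitzOnWith
      (contDiff_gammaField n₁ n₂ (m := 1)).contDiffOn one_ne_zero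
      (convex_closedBall (0 : EuclideanSpace ℂ (Fin 2)) 1) (isCompact_closedBall _ _)
    have hs : ∀ (γ : ℝ → Sph (Fin 2)), IsGammaCurve n₁ n₂ θ γ → ∀ t,
        HasDerivAt (fun t => (γ t : EuclideanSpace ℂ (Fin 2))) (gammaField n₁ n₂ (γ t)) t ∧
        (γ t : EuclideanSpace ℂ (Fin 2)) ∈ Metric.closedBall (0 : EuclideanSpace ℂ (Fin 2)) 1 := by
      intro γ h t
      have := (h.isGammaFlow hθ).hasDerivAt_toLp t
      simp only [toLp_comp] at this
      exact ⟨this, Metric.sphere_subset_closedBall (γ t).2⟩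
    have := ODE_solution_unique_univ (v := fun _ => gammaField n₁ n₂) (s := fun _ =>
      Metric.closedBall (0 : EuclideanSpace ℂ (Fin 2)) 1) (t₀ := 0) (fun _ => hK) (hs γ h) (hs γ' h')
      (by rw [← toLp_comp γ, ← toLp_comp γ', h.2.1, h.2.2, h'.2.1, h'.2.2])
    funext t
    exact Subtype.ext (congrFun this t)

/-! ### Identities along γ_θ and the period of γ₁/γ₂ -/

section Flow

variable {n₁ n₂ : ℕ} {g₀ g₁ : ℝ → ℂ}

theorem IsGammaFlow.norm_sq_deriv (h : IsGammaFlow n₁ n₂ g₀ g₁) (t : ℝ) :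
    ‖deriv g₀ t‖ ^ 2 = (‖g₀ t‖ ^ 2) ^ n₁ * (‖g₁ t‖ ^ 2) ^ (n₂ + 1) ∧
    ‖deriv g₁ t‖ ^ 2 = (‖g₀ t‖ ^ 2) ^ (n₁ + 1) * (‖g₁ t‖ ^ 2) ^ n₂ := by
  rw [(h.hasDerivAt_fst t).deriv, (h.hasDerivAt_snd t).deriv]
  simp only [norm_mul, norm_neg, Complex.norm_I, norm_pow, RCLike.norm_conj]
  constructor <;> ring

theorem IsGammaFlow.deriv_fst_ne_zero (h : IsGammaFlow n₁ n₂ g₀ g₁) (t : ℝ) :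
    deriv g₀ t ≠ 0 := by
  rw [(h.hasDerivAt_fst t).deriv]
  have h₀ : conj (g₀ t) ≠ 0 := by simpa using h.fst_ne_zero t
  have h₁ : conj (g₁ t) ≠ 0 := by simpa using h.snd_ne_zero t
  exact mul_ne_zero (mul_ne_zero Complex.I_ne_zero (pow_ne_zero _ h₀)) (pow_ne_zero _ h₁)

/-- The curves are Legendrian, and their tangents have opposite angular momenta. -/
theorem IsGammaFlow.inner_I_mul_deriv (h : IsGammaFlow n₁ n₂ g₀ g₁) (t : ℝ) :
    inner ℝ (g₀ t) (Complex.I * deriv g₀ t) = -(g₀ t ^ (n₁ + 1) * g₁ t ^ (n₂ + 1)).re ∧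
    inner ℝ (g₁ t) (Complex.I * deriv g₁ t) = (g₀ t ^ (n₁ + 1) * g₁ t ^ (n₂ + 1)).re := by
  rw [(h.hasDerivAt_fst t).deriv, (h.hasDerivAt_snd t).deriv, Complex.inner, Complex.inner]
  have : (g₀ t ^ (n₁ + 1) * g₁ t ^ (n₂ + 1)).re =
      (conj (g₀ t) ^ (n₁ + 1) * conj (g₁ t) ^ (n₂ + 1)).re := by
    rw [← map_pow, ← map_pow, ← map_mul, Complex.conj_re]
  rw [this, ← Complex.neg_re]
  constructor
  · congr 1
    linear_combination conj (g₀ t) ^ (n₁ + 1) * conj (g₁ t) ^ (n₂ + 1) * Complex.I_sq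
  · congr 1
    linear_combination -conj (g₀ t) ^ (n₁ + 1) * conj (g₁ t) ^ (n₂ + 1) * Complex.I_sq

/-- Each component's acceleration is a real multiple of that component. So the pairings of γ'' with
iγ' reduce to the angular momenta of `inner_I_mul_deriv`. -/
theorem IsGammaFlow.deriv_deriv (h : IsGammaFlow n₁ n₂ g₀ g₁) (t : ℝ) :
    deriv (deriv g₀) t = (((‖g₀ t‖ ^ 2) ^ n₁ * (‖g₁ t‖ ^ 2) ^ n₂ *
      (n₁ * ‖g₁ t‖ ^ 2 / ‖g₀ t‖ ^ 2 - (n₂ + 1)) : ℝ) : ℂ) * g₀ t ∧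
    deriv (deriv g₁) t = (((‖g₀ t‖ ^ 2) ^ n₁ * (‖g₁ t‖ ^ 2) ^ n₂ *
      (n₂ * ‖g₀ t‖ ^ 2 / ‖g₁ t‖ ^ 2 - (n₁ + 1)) : ℝ) : ℂ) * g₁ t := by
  have hg₀ := h.fst_ne_zero t
  have hg₁ := h.snd_ne_zero t
  have hc₀ : conj (g₀ t) ≠ 0 := by simpa using hg₀
  have hc₁ : conj (g₁ t) ≠ 0 := by simpa using hg₁
  have d₀ := hasDerivAt_conj_comp (h.hasDerivAt_fst t)
  have d₁ := hasDerivAt_conj_comp (h.hasDerivAt_snd t)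
  have e₀ : ((‖g₀ t‖ : ℂ)) ^ 2 = g₀ t * conj (g₀ t) := by
    rw [Complex.mul_conj, Complex.normSq_eq_norm_sq, Complex.ofReal_pow]
  have e₁ : ((‖g₁ t‖ : ℂ)) ^ 2 = g₁ t * conj (g₁ t) := by
    rw [Complex.mul_conj, Complex.normSq_eq_norm_sq, Complex.ofReal_pow]
  constructor
  · rw [funext fun t => (h.hasDerivAt_fst t).deriv]
    have := ((d₀.pow n₁).const_mul Complex.I).mul (d₁.pow (n₂ + 1))
    refine (this.deriv : _).trans ?_
    push_cast
    rw [e₀, e₁]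
    simp only [map_mul, map_neg, map_pow, Complex.conj_conj, Complex.conj_I, Pi.pow_apply]
    -- Differentiating the power produces the truncated exponent n₁ - 1. For n₁ = 0 that term has
    -- coefficient zero.
    rcases n₁ with _ | m
    · field_simp
      simp
      ring_nf
    · simp only [Nat.add_sub_cancel]
      field_simp
      push_cast
      ring_nf
      simp only [Complex.I_sq]
      ring
  · rw [funext fun t => (h.hasDerivAt_snd t).deriv]
    have := ((d₀.pow (n₁ + 1)).const_mul (-Complex.I)).mul (d₁.pow n₂)
    refine (this.deriv : _).trans ?_
    push_cast
    rw [e₀, e₁]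
    simp only [map_mul, map_neg, map_pow, Complex.conj_conj, Complex.conj_I, Pi.pow_apply]
    rcases n₂ with _ | m
    · field_simp
      simp
      ring_nf
    · simp only [Nat.add_sub_cancel]
      field_simp
      push_cast
      ring_nf
      simp only [Complex.I_sq]
      ring

/-- The curve is critical for the length weighted by `|γ₁|^{n₁} |γ₂|^{n₂}`. -/
theorem IsGammaFlow.inner_deriv_deriv (h : IsGammaFlow n₁ n₂ g₀ g₁) (t : ℝ) :
    inner ℝ (deriv (deriv g₀) t) (Complex.I * deriv g₀ t) +
      inner ℝ (deriv (deriv g₁) t) (Complex.I * deriv g₁ t) =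
    (‖deriv g₀ t‖ ^ 2 + ‖deriv g₁ t‖ ^ 2) *
      (n₁ / ‖g₀ t‖ ^ 2 * inner ℝ (g₀ t) (Complex.I * deriv g₀ t) +
        n₂ / ‖g₁ t‖ ^ 2 * inner ℝ (g₁ t) (Complex.I * deriv g₁ t)) := by
  rw [(h.deriv_deriv t).1, (h.deriv_deriv t).2, ← Complex.real_smul, ← Complex.real_smul,
    real_inner_smul_left, real_inner_smul_left, (h.inner_I_mul_deriv t).1,
    (h.inner_I_mul_deriv t).2, (h.norm_sq_deriv t).1, (h.norm_sq_deriv t).2]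
  have h₀ : ‖g₀ t‖ ^ 2 ≠ 0 := by simpa using h.fst_ne_zero t
  have h₁ : ‖g₁ t‖ ^ 2 ≠ 0 := by simpa using h.snd_ne_zero t
  have hs := h.norm_sq_add t
  generalize ‖g₀ t‖ ^ 2 = s at *
  generalize ‖g₁ t‖ ^ 2 = s' at *
  obtain rfl : s' = 1 - s := by linarith
  field_simp
  ring

/-- `γ₁ / γ₂` has the period `r.den * T`. -/
theorem IsGammaFlow.exists_period (h : IsGammaFlow n₁ n₂ g₀ g₁) {c : ℝ}
    (hc : ∀ t, (g₀ t ^ (n₁ + 1) * g₁ t ^ (n₂ + 1)).re = c) {T : ℝ} (hT : 0 < T)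
    (p₀ : Function.Periodic (fun t => ‖g₀ t‖) T) (p₁ : Function.Periodic (fun t => ‖g₁ t‖) T)
    {r : ℚ} (hr : c / (2 * Real.pi) *
      (∫ t in (0 : ℝ)..T, 1 / (‖g₀ t‖ ^ 2 * ‖g₁ t‖ ^ 2)) = (r : ℝ)) :
    ∃ A : ℝ, 0 < A ∧ ∀ t, g₀ (t + A) * g₁ t = g₀ t * g₁ (t + A) := by
  have k₀ : Continuous g₀ := h.contDiff.1.continuous
  have k₁ : Continuous g₁ := h.contDiff.2.continuous
  have hne : ∀ t, ‖g₀ t‖ ^ 2 * ‖g₁ t‖ ^ 2 ≠ 0 := fun t => by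
    simpa using ⟨h.fst_ne_zero t, h.snd_ne_zero t⟩
  let m : ℝ → ℝ := fun t => 1 / (‖g₀ t‖ ^ 2 * ‖g₁ t‖ ^ 2)
  have km : Continuous m := by
    refine continuous_const.div (by fun_prop) hne
  -- The logarithmic derivative of g₀/g₁; |g₀|² + |g₁|² = 1 merges 1/|g₀|² + 1/|g₁|² into m.
  let q : ℝ → ℂ := fun t =>
    Complex.I * conj (g₀ t ^ (n₁ + 1) * g₁ t ^ (n₂ + 1)) * (m t : ℂ)
  have kq : Continuous q := by
    have := Complex.continuous_conj
    have := Complex.continuous_ofReal.comp km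
    fun_prop
  let R : ℝ → ℂ := fun t => ∫ s in (0 : ℝ)..t, q s
  have dR : ∀ t, HasDerivAt R (q t) t := fun t =>
    intervalIntegral.integral_hasDerivAt_right (kq.intervalIntegrable _ _)
      (kq.stronglyMeasurableAtFilter _ _) kq.continuousAt
  have hf : ∀ t, g₀ t / g₁ t = g₀ 0 / g₁ 0 * Complex.exp (R t) := by
    have hd : ∀ t, HasDerivAt (fun t => g₀ t / g₁ t * Complex.exp (-R t)) 0 t := by
      intro t
      refine (((h.hasDerivAt_fst t).div (h.hasDerivAt_snd t) (h.snd_ne_zero t)).mul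
        (dR t).neg.cexp).congr_deriv ?_
      have hg₀ := h.fst_ne_zero t
      have hg₁ := h.snd_ne_zero t
      have hc₀ : conj (g₀ t) ≠ 0 := by simpa using hg₀
      have hc₁ : conj (g₁ t) ≠ 0 := by simpa using hg₁
      have e₀ : ((‖g₀ t‖ : ℂ)) ^ 2 = g₀ t * conj (g₀ t) := by
        rw [Complex.mul_conj, Complex.normSq_eq_norm_sq, Complex.ofReal_pow]
      have e₁ : ((‖g₁ t‖ : ℂ)) ^ 2 = g₁ t * conj (g₁ t) := by
        rw [Complex.mul_conj, Complex.normSq_eq_norm_sq, Complex.ofReal_pow]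
      have e₂ : g₀ t * conj (g₀ t) + g₁ t * conj (g₁ t) = 1 := by
        rw [← e₀, ← e₁]
        exact_mod_cast h.norm_sq_add t
      simp only [q, m, Complex.ofReal_div, Complex.ofReal_one, Complex.ofReal_mul,
        Complex.ofReal_pow, e₀, e₁, map_mul, map_pow,
        Pi.div_apply, Pi.neg_apply]
      field_simp
      linear_combination Complex.I * Complex.exp (-R t) * conj (g₀ t) ^ (n₁ + 1) *
        conj (g₁ t) ^ (n₂ + 1) * e₂
    intro t
    have := is_const_of_deriv_eq_zero (fun t => (hd t).differentiableAt) (fun t => (hd t).deriv) t 0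
    simp only [R, intervalIntegral.integral_same, neg_zero, Complex.exp_zero, mul_one] at this
    rw [← this, mul_assoc, ← Complex.exp_add, neg_add_cancel, Complex.exp_zero, mul_one]
  have hIm : ∀ a b, (∫ s in a..b, q s).im = c * ∫ s in a..b, m s := by
    intro a b
    have := Complex.imCLM.intervalIntegral_comp_comm
      (kq.intervalIntegrable (μ := MeasureTheory.volume) a b)
    simp only [Complex.imCLM_apply] at this
    rw [← this, ← intervalIntegral.integral_const_mul]
    refine intervalIntegral.integral_congr fun s _ => ?_
    simp only [q]
    rw [Complex.im_mul_ofReal, Complex.I_mul_im, Complex.conj_re, hc]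
  have pm : Function.Periodic m T := fun t => by
    have a := p₀ t
    have b := p₁ t
    simp only at a b
    simp only [m, a, b]
  -- One period T turns the quotient by 2πr. After r.den of them the angle is 2π r.num, and the
  -- modulus has returned too.
  refine ⟨r.den * T, mul_pos (Nat.cast_pos.2 r.den_pos) hT, fun t => ?_⟩
  have hmod : ‖g₀ (t + r.den * T) / g₁ (t + r.den * T)‖ = ‖g₀ t / g₁ t‖ := by
    rw [norm_div, norm_div]
    congr 1
    · exact (p₀.nat_mul r.den) t
    · exact (p₁.nat_mul r.den) t
  have hquot : g₀ (t + r.den * T) / g₁ (t + r.den * T) =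
      g₀ t / g₁ t * Complex.exp (∫ s in t..(t + r.den * T), q s) := by
    rw [hf, hf t, mul_assoc, ← Complex.exp_add]
    congr 2
    exact (intervalIntegral.integral_add_adjacent_intervals (kq.intervalIntegrable _ _)
      (kq.intervalIntegrable _ _)).symm
  have hz : g₀ t / g₁ t ≠ 0 := div_ne_zero (h.fst_ne_zero t) (h.snd_ne_zero t)
  have hre : (∫ s in t..(t + r.den * T), q s).re = 0 := by
    rw [hquot, norm_mul, mul_eq_left₀ (norm_ne_zero_iff.2 hz), Complex.norm_exp] at hmod
    exact (Real.exp_eq_one_iff _).1 hmod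
  have him : (∫ s in t..(t + r.den * T), q s).im = r.num * (2 * Real.pi) := by
    have h1 := (pm.intervalIntegral_add_zsmul_eq r.den t fun a b => km.intervalIntegrable a b)
    simp only [zsmul_eq_mul, Int.cast_natCast] at h1
    have hr' : c * ∫ s in (0 : ℝ)..T, m s = r * (2 * Real.pi) := by
      rw [← hr]
      have := Real.pi_ne_zero
      simp only [m]
      field_simp
    have h2 := pm.intervalIntegral_add_eq t 0
    rw [zero_add] at h2
    rw [hIm, h1, h2, mul_left_comm, hr', ← mul_assoc]
    congr 1
    exact_mod_cast (mul_comm _ _).trans (Rat.mul_den_eq_num r)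
  have hexp : Complex.exp (∫ s in t..(t + r.den * T), q s) = 1 := by
    rw [Complex.exp_eq_one_iff]
    refine ⟨r.num, Complex.ext ?_ ?_⟩
    · simp [hre]
    · simp [him]
  rw [hexp, mul_one, div_eq_div_iff (h.snd_ne_zero _) (h.snd_ne_zero _)] at hquot
  exact hquot

end Flow

/-! ### Metric traces in orthonormal frames -/

theorem linearIndependent_of_orthonormal_map {E F κ : Type*} [NormedAddCommGroup E]
    [NormedSpace ℝ E] [NormedAddCommGroup F] [InnerProductSpace ℝ F] {D : E →L[ℝ] F} {e : κ → E}
    (he : Orthonormal ℝ fun k => D (e k)) : LinearIndependent ℝ e :=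
  LinearIndependent.of_comp D.toLinearMap he.linearIndependent

section Trace

variable {E F V : Type*} [NormedAddCommGroup E] [NormedSpace ℝ E] [FiniteDimensional ℝ E]
  [NormedAddCommGroup F] [InnerProductSpace ℝ F] [AddCommGroup V] [Module ℝ V]

/-- An injective linear map has a frame that it maps to an orthonormal family. -/
theorem exists_orthonormal_frame {D : E →L[ℝ] F} (hD : Function.Injective D) :
    ∃ e : Fin (Module.finrank ℝ E) → E, Orthonormal ℝ fun k => D (e k) := by
  have hD' : Function.Injective D.toLinearMap := hD
  have hr : Module.finrank ℝ (LinearMap.range D.toLinearMap) = Module.finrank ℝ E :=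
    LinearMap.finrank_range_of_inj hD'
  let b := (stdOrthonormalBasis ℝ (LinearMap.range D.toLinearMap)).reindex (finCongr hr)
  choose e he using fun k => (b k).2
  refine ⟨e, ?_⟩
  have := b.orthonormal.comp_linearIsometry (LinearMap.range D.toLinearMap).subtypeₗᵢ
  convert this using 2 with k
  exact he k

variable {κ : Type*} [Fintype κ] {u : E → F} {x : E} {e : κ → E}

/-- The frame as a basis. -/
def frameBasis {D : E →L[ℝ] F} (he : Orthonormal ℝ fun k => D (e k))
    (hc : Fintype.card κ = Module.finrank ℝ E) : Module.Basis κ ℝ E :=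
  have := (linearIndependent_of_orthonormal_map he)
  Module.Basis.mk this (this.span_eq_top_of_card_eq_finrank' hc).ge

theorem coe_frameBasis {D : E →L[ℝ] F} (he : Orthonormal ℝ fun k => D (e k))
    (hc : Fintype.card κ = Module.finrank ℝ E) : ⇑(frameBasis he hc) = e :=
  Module.Basis.coe_mk _ ((linearIndependent_of_orthonormal_map he).span_eq_top_of_card_eq_finrank' hc).ge

theorem inner_map_eq_zero_of_frame {D : E →L[ℝ] F} (he : Orthonormal ℝ fun k => D (e k))
    (hc : Fintype.card κ = Module.finrank ℝ E) {m : F} (hm : ∀ k, inner ℝ (D (e k)) m = 0) (v : E) :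
    inner ℝ (D v) m = 0 := by
  rw [← (frameBasis he hc).sum_repr v, map_sum, sum_inner]
  refine Finset.sum_eq_zero fun k _ => ?_
  rw [map_smul, real_inner_smul_left, coe_frameBasis, hm, mul_zero]

open Matrix in
-- If P holds the coordinates of the frame and G is the metric matrix, orthonormality reads Pᵀ G P =
-- 1, so G⁻¹ = P Pᵀ. This turns sums against g^{ij} into sums over the frame.
theorem metricMatrix_mul_frame (he : Orthonormal ℝ fun k => fderiv ℝ u x (e k))
    (hc : Fintype.card κ = Module.finrank ℝ E) :
    metricMatrix u x * (((Module.finBasis ℝ E).toMatrix e) *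
      ((Module.finBasis ℝ E).toMatrix e)ᵀ) = 1 := by
  classical
  set b := Module.finBasis ℝ E
  set f := frameBasis he hc with hf
  have hG : metricMatrix u x = (f.toMatrix b)ᵀ * f.toMatrix b := by
    ext i j
    rw [metricMatrix, Matrix.of_apply, Matrix.mul_apply]
    change inner ℝ (fderiv ℝ u x (b i)) (fderiv ℝ u x (b j)) = _
    have h : ∀ i, fderiv ℝ u x (b i) = ∑ k, f.repr (b i) k • fderiv ℝ u x (e k) := fun i => by
      conv_lhs => rw [← f.sum_repr (b i), map_sum]
      simp only [map_smul, hf, coe_frameBasis]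
    rw [h i, h j, he.inner_sum]
    simp [Module.Basis.toMatrix_apply]
  have h1 : f.toMatrix b * b.toMatrix f = 1 := f.toMatrix_mul_toMatrix_flip b
  have h2 : b.toMatrix f * f.toMatrix b = 1 := b.toMatrix_mul_toMatrix_flip f
  rw [← coe_frameBasis he hc, hG]
  calc (f.toMatrix b)ᵀ * f.toMatrix b * (b.toMatrix f * (b.toMatrix f)ᵀ)
      = (f.toMatrix b)ᵀ * (f.toMatrix b * b.toMatrix f) * (b.toMatrix f)ᵀ := by
        simp only [Matrix.mul_assoc]
    _ = (b.toMatrix f * f.toMatrix b)ᵀ := by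
        rw [h1, Matrix.mul_one, Matrix.transpose_mul]
    _ = 1 := by rw [h2, Matrix.transpose_one]

theorem isUnit_det_metricMatrix (hu : Function.Injective (fderiv ℝ u x)) :
    IsUnit (metricMatrix u x).det := by
  obtain ⟨e, he⟩ := exists_orthonormal_frame hu
  exact Matrix.isUnit_det_of_right_inverse (metricMatrix_mul_frame he (Fintype.card_fin _))

/-- The trace with respect to the induced metric, in an orthonormal frame. -/
theorem metricTrace_eq_sum (he : Orthonormal ℝ fun k => fderiv ℝ u x (e k))
    (hc : Fintype.card κ = Module.finrank ℝ E) (B : E →ₗ[ℝ] E →ₗ[ℝ] V) :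
    metricTrace u x (fun v w => B v w) = ∑ k, B (e k) (e k) := by
  rw [metricTrace, Matrix.inv_eq_right_inv (metricMatrix_mul_frame he hc)]
  set b := Module.finBasis ℝ E
  have h : ∀ k, B (e k) (e k) = ∑ i, ∑ j, (b.repr (e k) i * b.repr (e k) j) • B (b i) (b j) := by
    intro k
    conv_lhs => rw [← b.sum_repr (e k)]
    simp only [map_sum, LinearMap.sum_apply, map_smul, LinearMap.smul_apply, Finset.smul_sum,
      smul_smul]
    rw [Finset.sum_comm]
    simp only [mul_comm]
  simp only [h, Matrix.mul_apply, Matrix.transpose_apply, Module.Basis.toMatrix_apply,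
    Finset.sum_smul]
  exact (Finset.sum_congr rfl fun i _ => Finset.sum_comm).trans Finset.sum_comm

end Trace

theorem mem_normalSpace {E F : Type*} [NormedAddCommGroup E] [NormedSpace ℝ E]
    [NormedAddCommGroup F] [InnerProductSpace ℝ F] {u : E → F} {x : E} {T : F → Submodule ℝ F} {m : F} :
    m ∈ T (u x) ⊓ (LinearMap.range (fderiv ℝ u x).toLinearMap)ᗮ ↔
      m ∈ T (u x) ∧ ∀ v, inner ℝ (fderiv ℝ u x v) m = 0 := by
  rw [Submodule.mem_inf, Submodule.mem_orthogonal]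
  simp

/-! ### The mean curvature vector through its pairings with normal vectors -/

section MeanCurvature

variable {E F : Type*} [NormedAddCommGroup E] [NormedSpace ℝ E] [FiniteDimensional ℝ E]
  [NormedAddCommGroup F] [InnerProductSpace ℝ F]

/-- The trace of the flat second derivative. -/
def traceHessian (u : E → F) (x : E) : F :=
  metricTrace u x fun v w => fderiv ℝ (fderiv ℝ u) x v w

variable {κ : Type*} [Fintype κ] {u : E → F} {x : E} {e : κ → E}

theorem traceHessian_eq_sum (he : Orthonormal ℝ fun k => fderiv ℝ u x (e k))
    (hc : Fintype.card κ = Module.finrank ℝ E) :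
    traceHessian u x = ∑ k, fderiv ℝ (fderiv ℝ u) x (e k) (e k) :=
  metricTrace_eq_sum he hc ((ContinuousLinearMap.coeLM ℝ).comp
    (fderiv ℝ (fderiv ℝ u) x).toLinearMap)

theorem divergence_eq_sum (he : Orthonormal ℝ fun k => fderiv ℝ u x (e k))
    (hc : Fintype.card κ = Module.finrank ℝ E) (X : E → F) :
    divergence u X x = ∑ k, inner ℝ (fderiv ℝ X x (e k)) (fderiv ℝ u x (e k)) :=
  metricTrace_eq_sum he hc ((innerₗ F).compl₁₂ (fderiv ℝ X x).toLinearMap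
    (fderiv ℝ u x).toLinearMap)

variable [FiniteDimensional ℝ F] {T : F → Submodule ℝ F}

theorem meanCurvature_mem_tangent : meanCurvature T u x ∈ T (u x) :=
  (mem_normalSpace.1 (Submodule.starProjection_apply_mem _ _)).1

theorem inner_fderiv_meanCurvature (v : E) :
    inner ℝ (fderiv ℝ u x v) (meanCurvature T u x) = 0 :=
  (mem_normalSpace.1 (Submodule.starProjection_apply_mem _ _)).2 v

theorem inner_meanCurvature {m : F} (h₁ : m ∈ T (u x)) (h₂ : ∀ v, inner ℝ (fderiv ℝ u x v) m = 0) :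
    inner ℝ (meanCurvature T u x) m =
      (Module.finrank ℝ E : ℝ)⁻¹ * inner ℝ (traceHessian u x) m := by
  rw [← real_inner_smul_left, ← sub_eq_zero, ← inner_sub_left, ← neg_sub, inner_neg_left, neg_eq_zero]
  exact Submodule.starProjection_inner_eq_zero _ m (mem_normalSpace.2 ⟨h₁, h₂⟩)

/-- The characterization of an orthogonal projection. It lets H be identified by testing a candidate
against normal vectors, with no projection to compute. -/
theorem meanCurvature_eq {h : F} (h₁ : h ∈ T (u x)) (h₂ : ∀ v, inner ℝ (fderiv ℝ u x v) h = 0)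
    (h₃ : ∀ m ∈ T (u x), (∀ v, inner ℝ (fderiv ℝ u x v) m = 0) →
      inner ℝ h m = (Module.finrank ℝ E : ℝ)⁻¹ * inner ℝ (traceHessian u x) m) :
    meanCurvature T u x = h := by
  refine Submodule.eq_starProjection_of_mem_of_inner_eq_zero (mem_normalSpace.2 ⟨h₁, h₂⟩)
    fun m hm => ?_
  obtain ⟨m₁, m₂⟩ := mem_normalSpace.1 hm
  rw [inner_sub_left, h₃ m m₁ m₂, real_inner_smul_left]
  exact sub_self _

end MeanCurvature

/-! ### Differentiable dependence of metric traces on the point -/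

section Differentiability

variable {E F : Type*} [NormedAddCommGroup E] [NormedSpace ℝ E]
  [NormedAddCommGroup F] [InnerProductSpace ℝ F]

theorem differentiableAt_det {n : Type*} [Fintype n] [DecidableEq n] {M : E → Matrix n n ℝ} {x : E}
    (h : ∀ i j, DifferentiableAt ℝ (fun y => M y i j) x) :
    DifferentiableAt ℝ (fun y => (M y).det) x := by
  simp only [Matrix.det_apply']
  exact DifferentiableAt.fun_sum fun σ _ =>
    (HasFDerivAt.finsetProd fun i _ => (h (σ i) i).hasFDerivAt).differentiableAt.const_mul _

/-- By Cramer's rule the entries of the inverse are quotients of determinants. -/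
theorem differentiableAt_matrix_inv {n : Type*} [Fintype n] [DecidableEq n] {M : E → Matrix n n ℝ}
    {x : E} (h : ∀ i j, DifferentiableAt ℝ (fun y => M y i j) x) (hx : IsUnit (M x).det) (i j : n) :
    DifferentiableAt ℝ (fun y => (M y)⁻¹ i j) x := by
  simp only [Matrix.inv_def, Matrix.smul_apply, smul_eq_mul, Ring.inverse_eq_inv',
    Matrix.adjugate_apply]
  refine ((differentiableAt_det h).inv hx.ne_zero).mul (differentiableAt_det fun k l => ?_)
  simp only [Matrix.updateRow_apply]
  split_ifs
  · exact differentiableAt_const _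
  · exact h k l

variable [FiniteDimensional ℝ E]

theorem differentiableAt_metricTrace {V : Type*} [NormedAddCommGroup V] [NormedSpace ℝ V]
    {u : E → F} {x : E} (hu : DifferentiableAt ℝ (fderiv ℝ u) x)
    (hi : Function.Injective (fderiv ℝ u x)) {B : E → E → E → V}
    (hB : ∀ v w, DifferentiableAt ℝ (fun y => B y v w) x) :
    DifferentiableAt ℝ (fun y => metricTrace u y (B y)) x := by
  have hD : ∀ v, DifferentiableAt ℝ (fun y => fderiv ℝ u y v) x := fun v =>
    hu.clm_apply (differentiableAt_const v)
  refine DifferentiableAt.fun_sum fun i _ => DifferentiableAt.fun_sum fun j _ =>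
    (differentiableAt_matrix_inv (fun k l => ?_) (isUnit_det_metricMatrix hi) i j).smul (hB _ _)
  exact (hD _).inner ℝ (hD _)

end Differentiability

/-! ### Real and Hermitian inner products; Lagrangian subspaces -/

section Hermitian

variable {ι : Type*} [Fintype ι]

theorem real_inner_eq_re (x y : EuclideanSpace ℂ ι) : inner ℝ x y = (inner ℂ x y : ℂ).re := by
  simp only [PiLp.inner_apply, Complex.re_sum]
  rfl

theorem inner_smul_smul (c d : ℂ) (x y : EuclideanSpace ℂ ι) :
    inner ℝ (c • x) (d • y) = (conj c * d * inner ℂ x y).re := by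
  rw [real_inner_eq_re, inner_smul_left, inner_smul_right, mul_assoc]

theorem inner_I_smul_left (x y : EuclideanSpace ℂ ι) :
    inner ℝ (Complex.I • x) y = -inner ℝ x (Complex.I • y) := by
  rw [real_inner_eq_re, real_inner_eq_re, inner_smul_left, inner_smul_right, ← Complex.neg_re]
  simp

theorem inner_I_smul_self (x : EuclideanSpace ℂ ι) : inner ℝ x (Complex.I • x) = 0 := by
  have h := inner_I_smul_left x x
  rw [real_inner_comm] at h
  linarith

theorem complex_inner_eq (x y : EuclideanSpace ℂ ι) :
    (inner ℂ x y : ℂ) = inner ℝ x y + Complex.I * (inner ℝ (Complex.I • x) y : ℝ) := by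
  apply Complex.ext
  · simp [real_inner_eq_re]
  · simp [real_inner_eq_re]

theorem complex_inner_eq_zero {x y : EuclideanSpace ℂ ι} (h₁ : inner ℝ x y = 0)
    (h₂ : inner ℝ (Complex.I • x) y = 0) : (inner ℂ x y : ℂ) = 0 := by
  rw [complex_inner_eq, h₁, h₂]
  simp

/-- The orthogonal complement of a Lagrangian subspace, given as the range of `L`. -/
theorem exists_eq_I_smul_of_isotropic {G : Type*} [AddCommGroup G] [Module ℝ G]
    [FiniteDimensional ℝ G] {L : G →ₗ[ℝ] EuclideanSpace ℂ ι} (hL : Function.Injective L)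
    (hiso : ∀ v w, inner ℝ (L v) (Complex.I • L w) = 0)
    (hdim : Module.finrank ℝ G = Fintype.card ι) {m : EuclideanSpace ℂ ι}
    (hm : ∀ v, inner ℝ (L v) m = 0) : ∃ v, m = Complex.I • L v := by
  let J : EuclideanSpace ℂ ι →ₗ[ℝ] EuclideanSpace ℂ ι :=
    (Complex.I • (LinearMap.id : EuclideanSpace ℂ ι →ₗ[ℂ] EuclideanSpace ℂ ι)).restrictScalars ℝ
  have hJ : ∀ z, J z = Complex.I • z := fun z => rfl
  have hinj : Function.Injective (J ∘ₗ L) := by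
    intro v w h
    exact hL (smul_right_injective _ Complex.I_ne_zero h)
  -- Isotropy puts i·range L inside the orthogonal complement of range L. Both have real dimension
  -- half that of the ambient space, so they coincide.
  have hle : LinearMap.range (J ∘ₗ L) ≤ (LinearMap.range L)ᗮ := by
    rintro _ ⟨w, rfl⟩
    rw [Submodule.mem_orthogonal]
    rintro _ ⟨v, rfl⟩
    exact hiso v w
  have hfin : Module.finrank ℝ (EuclideanSpace ℂ ι) = 2 * Fintype.card ι := by
    rw [← Module.finrank_mul_finrank ℝ ℂ, Complex.finrank_real_complex, finrank_euclideanSpace]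
  have hadd := Submodule.finrank_add_finrank_orthogonal (LinearMap.range L)
  have h₁ := LinearMap.finrank_range_of_inj hL
  have h₂ := LinearMap.finrank_range_of_inj hinj
  have heq := Submodule.eq_of_le_of_finrank_eq hle (by omega)
  have hmem : m ∈ (LinearMap.range L)ᗮ := by
    rw [Submodule.mem_orthogonal]
    rintro _ ⟨v, rfl⟩
    exact hm v
  rw [← heq] at hmem
  obtain ⟨v, rfl⟩ := hmem
  exact ⟨v, rfl⟩

end Hermitian

theorem mem_sphTangent {ι : Type*} [Fintype ι] {z v : EuclideanSpace ℂ ι} :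
    v ∈ sphTangent z ↔ inner ℝ z v = 0 :=
  Submodule.mem_orthogonal_singleton_iff_inner_right

/-! ### Legendrian immersions in charts -/

section Legendrian

variable {E : Type*} [NormedAddCommGroup E] [NormedSpace ℝ E]

theorem fderiv_fderiv_apply {F : Type*} [NormedAddCommGroup F] [NormedSpace ℝ F] {a : E → F} {x : E}
    (h : DifferentiableAt ℝ (fderiv ℝ a) x) (v w : E) :
    fderiv ℝ (fun y => fderiv ℝ a y w) x v = fderiv ℝ (fderiv ℝ a) x v w := by
  rw [fderiv_clm_apply h (differentiableAt_const w)]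
  simp

variable {ι : Type*} [Fintype ι]

/-- Legendrian immersions of an open subset of `E` in the unit sphere of `ℂ^ι`. -/
structure IsLegendrianOn (a : E → EuclideanSpace ℂ ι) (U : Set E) : Prop where
  isOpen : IsOpen U
  contDiffOn : ContDiffOn ℝ ∞ a U
  norm_eq : ∀ x ∈ U, ‖a x‖ = 1
  injective : ∀ x ∈ U, Function.Injective (fderiv ℝ a x)
  inner_I : ∀ x ∈ U, ∀ v, inner ℝ (fderiv ℝ a x v) (Complex.I • a x) = 0
  finrank_add_one : Module.finrank ℝ E + 1 = Fintype.card ι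

namespace IsLegendrianOn

variable {a : E → EuclideanSpace ℂ ι} {U : Set E} {x : E}

theorem contDiffAt (h : IsLegendrianOn a U) (hx : x ∈ U) : ContDiffAt ℝ ∞ a x := h.contDiffOn.contDiffAt (h.isOpen.mem_nhds hx)

theorem differentiableAt (h : IsLegendrianOn a U) (hx : x ∈ U) : DifferentiableAt ℝ a x := (h.contDiffAt hx).differentiableAt (by simp)

theorem contDiffAt_fderiv (h : IsLegendrianOn a U) (hx : x ∈ U) : ContDiffAt ℝ ∞ (fderiv ℝ a) x :=
  (h.contDiffAt hx).fderiv_right (by simp)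

theorem differentiableAt_fderiv (h : IsLegendrianOn a U) (hx : x ∈ U) : DifferentiableAt ℝ (fderiv ℝ a) x :=
  (h.contDiffAt_fderiv hx).differentiableAt (by simp)

theorem differentiableAt_fderiv_fderiv (h : IsLegendrianOn a U) (hx : x ∈ U) : DifferentiableAt ℝ (fderiv ℝ (fderiv ℝ a)) x :=
  ((h.contDiffAt_fderiv hx).fderiv_right (m := ∞) (by simp)).differentiableAt (by simp)

theorem inner_self (h : IsLegendrianOn a U) (hx : x ∈ U) : inner ℝ (a x) (a x) = 1 := by
  rw [real_inner_self_eq_norm_sq, h.norm_eq x hx, one_pow]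

theorem inner_fderiv (h : IsLegendrianOn a U) (hx : x ∈ U) (v : E) : inner ℝ (fderiv ℝ a x v) (a x) = 0 := by
  have hev : (fun y => inner ℝ (a y) (a y)) =ᶠ[nhds x] fun _ => (1 : ℝ) :=
    Filter.eventually_of_mem (h.isOpen.mem_nhds hx) fun y hy => h.inner_self hy
  have h0 := congrArg (fun L : E →L[ℝ] ℝ => L v) hev.fderiv_eq
  rw [fderiv_inner_apply ℝ (h.differentiableAt hx) (h.differentiableAt hx), real_inner_comm] at h0
  simp at h0
  linarith

theorem complex_inner_fderiv (h : IsLegendrianOn a U) (hx : x ∈ U) (v : E) : (inner ℂ (a x) (fderiv ℝ a x v) : ℂ) = 0 :=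
  complex_inner_eq_zero (by rw [real_inner_comm, h.inner_fderiv hx])
    (by rw [real_inner_comm, h.inner_I x hx])

/-- Differentiate ⟨da w, a⟩ = 0. The trace of this identity produces the term -m that enters the
join. -/
theorem inner_fderiv_fderiv (h : IsLegendrianOn a U) (hx : x ∈ U) (v w : E) : inner ℝ (fderiv ℝ (fderiv ℝ a) x v w) (a x) =
    -inner ℝ (fderiv ℝ a x v) (fderiv ℝ a x w) := by
  have hev : (fun y => inner ℝ (fderiv ℝ a y w) (a y)) =ᶠ[nhds x] fun _ => (0 : ℝ) :=
    Filter.eventually_of_mem (h.isOpen.mem_nhds hx) fun y hy => h.inner_fderiv hy w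
  have h0 := congrArg (fun L : E →L[ℝ] ℝ => L v) hev.fderiv_eq
  have hd := h.differentiableAt_fderiv hx
  rw [fderiv_inner_apply ℝ (hd.clm_apply (differentiableAt_const w)) (h.differentiableAt hx),
    fderiv_fderiv_apply hd] at h0
  simp only [fderiv_fun_const, Pi.zero_apply, zero_apply] at h0
  linarith [real_inner_comm (fderiv ℝ a x v) (fderiv ℝ a x w)]

theorem inner_fderiv_I_fderiv_add (h : IsLegendrianOn a U) (hx : x ∈ U) (v w : E) :
    inner ℝ (fderiv ℝ (fderiv ℝ a) x v w) (Complex.I • a x) +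
      inner ℝ (fderiv ℝ a x w) (Complex.I • fderiv ℝ a x v) = 0 := by
  have hev : (fun y => inner ℝ (fderiv ℝ a y w) (Complex.I • a y)) =ᶠ[nhds x] fun _ => (0 : ℝ) :=
    Filter.eventually_of_mem (h.isOpen.mem_nhds hx) fun y hy => h.inner_I y hy w
  have h0 := congrArg (fun L : E →L[ℝ] ℝ => L v) hev.fderiv_eq
  have hd := h.differentiableAt_fderiv hx
  rw [fderiv_inner_apply ℝ (hd.clm_apply (differentiableAt_const w))
    ((h.differentiableAt hx).fun_const_smul Complex.I), fderiv_fderiv_apply hd,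
    fderiv_fun_const_smul (h.differentiableAt hx)] at h0
  simp at h0
  linarith

/-- The image of the differential is isotropic. -/
theorem inner_fderiv_I_fderiv (h : IsLegendrianOn a U) (hx : x ∈ U) (v w : E) :
    inner ℝ (fderiv ℝ a x v) (Complex.I • fderiv ℝ a x w) = 0 := by
  have h1 := h.inner_fderiv_I_fderiv_add hx v w
  have h2 := h.inner_fderiv_I_fderiv_add hx w v
  -- By the previous identity D²a(v, w), paired with i a, is -⟨da w, i da v⟩. The first is symmetric
  -- in v and w, the second antisymmetric, so both vanish.
  have hs : fderiv ℝ (fderiv ℝ a) x v w = fderiv ℝ (fderiv ℝ a) x w v :=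
    ((h.contDiffAt hx).isSymmSndFDerivAt (by
      simpa using WithTop.coe_le_coe.2 (le_top : (2 : ℕ∞) ≤ ⊤))).eq v w
  have h3 := inner_I_smul_left (fderiv ℝ a x v) (fderiv ℝ a x w)
  rw [real_inner_comm] at h3
  rw [hs] at h1
  linarith

theorem inner_fderiv_fderiv_I (h : IsLegendrianOn a U) (hx : x ∈ U) (v w : E) :
    inner ℝ (fderiv ℝ (fderiv ℝ a) x v w) (Complex.I • a x) = 0 := by
  have h1 := h.inner_fderiv_I_fderiv_add hx v w
  rwa [h.inner_fderiv_I_fderiv hx, add_zero] at h1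

/-- The normal space in the sphere is spanned by `i a` and `i da`. -/
theorem exists_eq_of_normal (h : IsLegendrianOn a U) (hx : x ∈ U) [FiniteDimensional ℝ E] {m : EuclideanSpace ℂ ι}
    (h₁ : inner ℝ (a x) m = 0) (h₂ : ∀ v, inner ℝ (fderiv ℝ a x v) m = 0) :
    ∃ (c : ℝ) (v : E), m = c • (Complex.I • a x) + Complex.I • fderiv ℝ a x v := by
  -- ℝa ⊕ da(E) is a Lagrangian subspace of ℂ^ι, so its orthogonal complement is i times it.
  let L : ℝ × E →ₗ[ℝ] EuclideanSpace ℂ ι :=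
    (LinearMap.toSpanSingleton ℝ _ (a x)).coprod (fderiv ℝ a x).toLinearMap
  have hL : ∀ p, L p = p.1 • a x + fderiv ℝ a x p.2 := fun p => rfl
  have hinj : Function.Injective L := by
    rw [← LinearMap.ker_eq_bot, LinearMap.ker_eq_bot']
    rintro ⟨c, v⟩ h0
    rw [hL] at h0
    have hc : c = 0 := by
      have := congrArg (fun z => inner ℝ z (a x)) h0
      simp only [inner_add_left, real_inner_smul_left, h.inner_self hx, h.inner_fderiv hx,
        inner_zero_left] at this
      linarith
    subst hc
    rw [zero_smul, zero_add] at h0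
    obtain rfl : v = 0 := h.injective x hx (h0.trans (map_zero _).symm)
    rfl
  have hiso : ∀ v w, inner ℝ (L v) (Complex.I • L w) = 0 := by
    rintro ⟨c, v⟩ ⟨d, w⟩
    have h3 := inner_I_smul_left (a x) (fderiv ℝ a x w)
    rw [real_inner_comm, h.inner_I x hx, zero_eq_neg] at h3
    rw [hL, hL, smul_add, smul_comm Complex.I]
    simp only [inner_add_left, inner_add_right, real_inner_smul_left, real_inner_smul_right,
      inner_I_smul_self, h.inner_I x hx, h.inner_fderiv_I_fderiv hx, h3]
    ring
  obtain ⟨⟨c, v⟩, hv⟩ := exists_eq_I_smul_of_isotropic hinj hiso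
    (by rw [Module.finrank_prod, Module.finrank_self, add_comm]; exact h.finrank_add_one) (m := m)
    (by
      rintro ⟨c, v⟩
      rw [hL, inner_add_left, real_inner_smul_left, h₁, h₂, mul_zero, add_zero])
  exact ⟨c, v, by rw [hv, hL, smul_add, smul_comm Complex.I]⟩

variable [FiniteDimensional ℝ E]

theorem _root_.HMinimal.inner_meanCurvature_sphere : inner ℝ (a x) (meanCurvature sphTangent a x) = 0 :=
  mem_sphTangent.1 meanCurvature_mem_tangent

theorem inner_traceHessian_I (h : IsLegendrianOn a U) (hx : x ∈ U) : inner ℝ (traceHessian a x) (Complex.I • a x) = 0 := by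
  obtain ⟨e, he⟩ := exists_orthonormal_frame (h.injective x hx)
  rw [traceHessian_eq_sum he (Fintype.card_fin _), sum_inner]
  exact Finset.sum_eq_zero fun k _ => h.inner_fderiv_fderiv_I hx _ _

theorem inner_traceHessian_self (h : IsLegendrianOn a U) (hx : x ∈ U) :
    inner ℝ (traceHessian a x) (a x) = -(Module.finrank ℝ E : ℝ) := by
  obtain ⟨e, he⟩ := exists_orthonormal_frame (h.injective x hx)
  rw [traceHessian_eq_sum he (Fintype.card_fin _), sum_inner]
  simp only [h.inner_fderiv_fderiv hx, real_inner_self_eq_norm_sq, he.norm_eq_one]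
  simp

/-- H has no component along the Hopf fibre, because D²a is orthogonal to i a. Hence H is horizontal
and can be projected. -/
theorem inner_meanCurvature_I (h : IsLegendrianOn a U) (hx : x ∈ U) :
    inner ℝ (Complex.I • a x) (meanCurvature sphTangent a x) = 0 := by
  rw [real_inner_comm, inner_meanCurvature (T := sphTangent) (mem_sphTangent.2 (inner_I_smul_self _)) (h.inner_I x hx),
    h.inner_traceHessian_I hx, mul_zero]

theorem complex_inner_meanCurvature (h : IsLegendrianOn a U) (hx : x ∈ U) : (inner ℂ (a x) (meanCurvature sphTangent a x) : ℂ) = 0 :=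
  complex_inner_eq_zero (inner_meanCurvature_sphere) (h.inner_meanCurvature_I hx)

theorem inner_meanCurvature_I_fderiv (h : IsLegendrianOn a U) (hx : x ∈ U) (v : E) :
    inner ℝ (meanCurvature sphTangent a x) (Complex.I • fderiv ℝ a x v) =
      (Module.finrank ℝ E : ℝ)⁻¹ * inner ℝ (traceHessian a x) (Complex.I • fderiv ℝ a x v) := by
  refine inner_meanCurvature (mem_sphTangent.2 ?_) fun w => h.inner_fderiv_I_fderiv hx w v
  have h3 := inner_I_smul_left (a x) (fderiv ℝ a x v)
  rw [real_inner_comm, h.inner_I x hx, zero_eq_neg] at h3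
  exact h3

/-- The definition projects onto a subspace that varies with the point. This formula uses only
metric traces and inner products, so that H can be differentiated. -/
theorem meanCurvature_eq_formula (h : IsLegendrianOn a U) (hx : x ∈ U) : meanCurvature sphTangent a x =
    (Module.finrank ℝ E : ℝ)⁻¹ • (traceHessian a x - inner ℝ (traceHessian a x) (a x) • a x -
      metricTrace a x fun v w => inner ℝ (traceHessian a x) (fderiv ℝ a x v) • fderiv ℝ a x w) := by
  obtain ⟨e, he⟩ := exists_orthonormal_frame (h.injective x hx)
  have hc := Fintype.card_fin (Module.finrank ℝ E)
  have hm : (metricTrace a x fun v w =>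
      inner ℝ (traceHessian a x) (fderiv ℝ a x v) • fderiv ℝ a x w) =
      ∑ k, inner ℝ (traceHessian a x) (fderiv ℝ a x (e k)) • fderiv ℝ a x (e k) :=
    metricTrace_eq_sum he hc
      (LinearMap.mk₂ ℝ (fun v w => inner ℝ (traceHessian a x) (fderiv ℝ a x v) • fderiv ℝ a x w)
        (by intros; rw [map_add, inner_add_right, add_smul])
        (by intros; rw [map_smul, real_inner_smul_right, mul_smul])
        (by intros; rw [map_add, smul_add])
        (by intros; rw [map_smul, smul_comm]))
  rw [hm]
  have ha : ∀ v, inner ℝ (a x) (fderiv ℝ a x v) = 0 := fun v => by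
    rw [real_inner_comm, h.inner_fderiv hx]
  refine meanCurvature_eq (mem_sphTangent.2 ?_) (inner_map_eq_zero_of_frame he hc fun l => ?_)
    fun m hm₁ hm₂ => ?_
  · simp only [real_inner_smul_right, inner_sub_right, inner_sum, ha, h.inner_self hx, mul_zero,
      Finset.sum_const_zero, real_inner_comm (traceHessian a x) (a x)]
    ring
  · simp only [real_inner_smul_right, inner_sub_right, inner_sum, h.inner_fderiv hx,
      orthonormal_iff_ite.1 he, mul_ite, mul_one, mul_zero, Finset.sum_ite_eq, Finset.mem_univ,
      if_true, real_inner_comm (traceHessian a x)]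
    ring
  · simp only [real_inner_smul_left, inner_sub_left, sum_inner, mem_sphTangent.1 hm₁, hm₂, mul_zero,
      Finset.sum_const_zero, sub_zero]

theorem differentiableAt_meanCurvature (h : IsLegendrianOn a U) (hx : x ∈ U) : DifferentiableAt ℝ (meanCurvature sphTangent a) x := by
  have ht : DifferentiableAt ℝ (traceHessian a) x :=
    differentiableAt_metricTrace (h.differentiableAt_fderiv hx) (h.injective x hx) fun v w =>
      ((h.differentiableAt_fderiv_fderiv hx).clm_apply (differentiableAt_const v)).clm_apply
        (differentiableAt_const w)
  have hD : ∀ v, DifferentiableAt ℝ (fun y => fderiv ℝ a y v) x := fun v =>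
    (h.differentiableAt_fderiv hx).clm_apply (differentiableAt_const v)
  have hev : meanCurvature sphTangent a =ᶠ[nhds x] _ :=
    Filter.eventually_of_mem (h.isOpen.mem_nhds hx) fun y hy => h.meanCurvature_eq_formula hy
  refine DifferentiableAt.congr_of_eventuallyEq ?_ hev
  refine DifferentiableAt.fun_const_smul ((ht.sub ((ht.inner ℝ (h.differentiableAt hx)).smul
    (h.differentiableAt hx))).sub ?_) (Module.finrank ℝ E : ℝ)⁻¹
  exact differentiableAt_metricTrace (h.differentiableAt_fderiv hx) (h.injective x hx) fun v w =>
    (ht.inner ℝ (hD v)).smul (hD w)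

end IsLegendrianOn

end Legendrian

/-! ### Projective space as projection matrices: tangent vectors, metric, complex structure -/

section Veronese

variable {ι : Type*} [Fintype ι]

/-- Continuous bilinear maps. -/
abbrev Bilin (F G : Type*) [NormedAddCommGroup F] [NormedSpace ℝ F] [NormedAddCommGroup G]
    [NormedSpace ℝ G] : Type _ := F →L[ℝ] F →L[ℝ] G

/-- The bilinear map `(v, w) ↦ (v wᴴ + w vᴴ) / √2`. -/
def symProd : Bilin (EuclideanSpace ℂ ι) (MatSpace ι) :=
  LinearMap.toContinuousBilinearMap <| LinearMap.mk₂ ℝ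
    (fun v w => WithLp.toLp 2 fun a : ι × ι =>
      ((√2)⁻¹ : ℂ) * (v a.1 * conj (w a.2) + w a.1 * conj (v a.2)))
    (fun u v w => by ext a; simp; ring)
    (fun c v w => by ext a; simp; ring)
    (fun u v w => by ext a; simp; ring)
    (fun c v w => by ext a; simp; ring)

theorem symProd_apply (v w : EuclideanSpace ℂ ι) (a : ι × ι) : symProd v w a =
    ((√2)⁻¹ : ℂ) * (v a.1 * conj (w a.2) + w a.1 * conj (v a.2)) := rfl

theorem symProd_comm (v w : EuclideanSpace ℂ ι) : symProd v w = symProd w v := by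
  ext a
  rw [symProd_apply, symProd_apply, add_comm]

theorem complex_inner_apply (v w : EuclideanSpace ℂ ι) :
    (inner ℂ v w : ℂ) = ∑ i, conj (v i) * w i := by
  simp only [PiLp.inner_apply, RCLike.inner_apply, mul_comm]

theorem inv_sqrt_two_mul_self : ((√2)⁻¹ : ℂ) * ((√2)⁻¹ : ℂ) = 1 / 2 := by
  rw [← Complex.ofReal_inv, ← Complex.ofReal_mul, ← mul_inv, Real.mul_self_sqrt zero_le_two]
  simp

/-- The two factors 1/√2 give 1/2, and the sum over entries is a complex number plus its conjugate.
This normalization makes `symProd z` isometric on horizontal vectors. -/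
theorem inner_symProd (p q v w : EuclideanSpace ℂ ι) : inner ℝ (symProd p q) (symProd v w) =
    ((inner ℂ p v : ℂ) * conj (inner ℂ q w : ℂ) + (inner ℂ p w : ℂ) * conj (inner ℂ q v : ℂ)).re := by
  have key : (inner ℂ (symProd p q) (symProd v w) : ℂ) = 1 / 2 *
      (((inner ℂ p v : ℂ) * conj (inner ℂ q w : ℂ) + (inner ℂ p w : ℂ) * conj (inner ℂ q v : ℂ)) +
      conj ((inner ℂ p v : ℂ) * conj (inner ℂ q w : ℂ) +
        (inner ℂ p w : ℂ) * conj (inner ℂ q v : ℂ))) := by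
    rw [map_add, map_mul, map_mul, Complex.conj_conj, Complex.conj_conj,
      mul_comm (conj (inner ℂ p v : ℂ)), mul_comm (conj (inner ℂ p w : ℂ))]
    simp only [complex_inner_apply, map_add, map_mul, map_sum, Complex.conj_conj,
      Finset.sum_mul_sum, Fintype.sum_prod_type, symProd_apply, map_inv₀, Complex.conj_ofReal]
    simp only [← Finset.sum_add_distrib, Finset.mul_sum]
    refine Finset.sum_congr rfl fun i _ => Finset.sum_congr rfl fun j _ => ?_
    rw [← inv_sqrt_two_mul_self]
    ring
  rw [real_inner_eq_re, key, Complex.add_conj]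
  rw [← Complex.ofReal_ofNat, ← Complex.ofReal_one, ← Complex.ofReal_div, ← Complex.ofReal_mul,
    Complex.ofReal_re]
  ring

variable {z : EuclideanSpace ℂ ι}

theorem complex_inner_self (hz : ‖z‖ = 1) : (inner ℂ z z : ℂ) = 1 := by
  rw [inner_self_eq_norm_sq_to_K, hz]
  simp

theorem inner_symProd_left (hz : ‖z‖ = 1) (v : EuclideanSpace ℂ ι) {w : EuclideanSpace ℂ ι}
    (hw : (inner ℂ z w : ℂ) = 0) : inner ℝ (symProd z v) (symProd z w) = inner ℝ v w := by
  rw [inner_symProd, complex_inner_self hz, hw, real_inner_eq_re, zero_mul, add_zero, one_mul,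
    Complex.conj_re]

/-- For horizontal v and w the matrix `symProd v w` is normal to projective space when ‖z‖ = 1,
since the tangent vectors are the horizontal `symProd z m`. This discards the quadratic terms of
second derivatives. -/
theorem inner_symProd_right (v w : EuclideanSpace ℂ ι) {m : EuclideanSpace ℂ ι}
    (hv : (inner ℂ z v : ℂ) = 0) (hw : (inner ℂ z w : ℂ) = 0) :
    inner ℝ (symProd v w) (symProd z m) = 0 := by
  rw [← inner_conj_symm, map_eq_zero] at hv hw
  rw [inner_symProd, hv, hw]
  simp

/-- The embedding of the projective space, composed with the Hopf fibration. -/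
def veronese (z : EuclideanSpace ℂ ι) : MatSpace ι := (1 / 2 : ℝ) • symProd z z

theorem veronese_apply (z : EuclideanSpace ℂ ι) (a : ι × ι) :
    veronese z a = ((√2)⁻¹ : ℂ) * (z a.1 * conj (z a.2)) := by
  rw [veronese, PiLp.smul_apply, symProd_apply, Complex.real_smul]
  push_cast
  ring

theorem cpEmb_hopf (z : Sph ι) : cpEmb (hopf z) = veronese z := by
  ext a
  -- The chosen representative is an arbitrary nonzero multiple of z; the factor c conj(c) cancels
  -- against its squared norm.
  obtain ⟨c, hc⟩ := Projectivization.exists_smul_eq_mk_rep ℂ (z : EuclideanSpace ℂ ι)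
    (ne_zero_of_mem_unit_sphere z)
  have hz : ‖(z : EuclideanSpace ℂ ι)‖ = 1 := by simp
  have hc0 : (c : ℂ) ≠ 0 := c.ne_zero
  have hc1 : conj (c : ℂ) ≠ 0 := by simp
  rw [veronese_apply]
  change ((√2)⁻¹ : ℂ) * ((hopf z).rep a.1 * conj ((hopf z).rep a.2) / (‖(hopf z).rep‖ : ℂ) ^ 2) = _
  rw [hopf, ← hc]
  change ((√2)⁻¹ : ℂ) * (((c : ℂ) • (z : EuclideanSpace ℂ ι)) a.1 *
    conj (((c : ℂ) • (z : EuclideanSpace ℂ ι)) a.2) /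
    (‖(c : ℂ) • (z : EuclideanSpace ℂ ι)‖ : ℂ) ^ 2) = _
  have hn : ((‖(c : ℂ) • (z : EuclideanSpace ℂ ι)‖ : ℝ) : ℂ) ^ 2 = c * conj (c : ℂ) := by
    rw [norm_smul, hz, mul_one, Complex.mul_conj, Complex.normSq_eq_norm_sq, Complex.ofReal_pow]
  rw [hn]
  simp only [PiLp.smul_apply, smul_eq_mul, map_mul]
  field_simp

theorem projMat_veronese (z : EuclideanSpace ℂ ι) (i j : ι) :
    projMat (veronese z) i j = z i * conj (z j) := by
  have h2 : (√2 : ℂ) ≠ 0 := by simp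
  rw [projMat, Matrix.smul_apply, toMat, Matrix.of_apply, veronese_apply, smul_eq_mul,
    mul_inv_cancel_left₀ h2]

theorem projMat_mul (z : EuclideanSpace ℂ ι) (M : Matrix ι ι ℂ) (i j : ι) :
    (projMat (veronese z) * M) i j = z i * ∑ k, conj (z k) * M k j := by
  simp only [Matrix.mul_apply, projMat_veronese, Finset.mul_sum, mul_assoc]

theorem mul_projMat (z : EuclideanSpace ℂ ι) (M : Matrix ι ι ℂ) (i j : ι) :
    (M * projMat (veronese z)) i j = (∑ k, M i k * z k) * conj (z j) := by
  simp only [Matrix.mul_apply, projMat_veronese, Finset.sum_mul, mul_assoc]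

theorem toMat_symProd (v w : EuclideanSpace ℂ ι) (i j : ι) : toMat (symProd v w) i j =
    ((√2)⁻¹ : ℂ) * (v i * conj (w j) + w i * conj (v j)) := rfl

theorem sum_conj_mul_toMat_symProd (hz : ‖z‖ = 1) {v : EuclideanSpace ℂ ι}
    (hv : (inner ℂ z v : ℂ) = 0) (j : ι) :
    ∑ k, conj (z k) * toMat (symProd z v) k j = ((√2)⁻¹ : ℂ) * conj (v j) := by
  have h1 := complex_inner_self hz
  rw [complex_inner_apply] at h1 hv
  calc ∑ k, conj (z k) * toMat (symProd z v) k j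
      = ((√2)⁻¹ : ℂ) * ((∑ k, conj (z k) * z k) * conj (v j) +
        (∑ k, conj (z k) * v k) * conj (z j)) := by
        simp only [toMat_symProd, Finset.sum_mul, ← Finset.sum_add_distrib, Finset.mul_sum]
        refine Finset.sum_congr rfl fun k _ => ?_
        ring
    _ = _ := by rw [h1, hv]; ring

theorem sum_toMat_symProd_mul (hz : ‖z‖ = 1) {v : EuclideanSpace ℂ ι}
    (hv : (inner ℂ z v : ℂ) = 0) (i : ι) :
    ∑ k, toMat (symProd z v) i k * z k = ((√2)⁻¹ : ℂ) * v i := by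
  have h1 := complex_inner_self hz
  rw [← inner_conj_symm, map_eq_zero] at hv
  rw [complex_inner_apply] at h1 hv
  calc ∑ k, toMat (symProd z v) i k * z k
      = ((√2)⁻¹ : ℂ) * (z i * (∑ k, conj (v k) * z k) + v i * (∑ k, conj (z k) * z k)) := by
        simp only [toMat_symProd, Finset.mul_sum, ← Finset.sum_add_distrib]
        refine Finset.sum_congr rfl fun k _ => ?_
        ring
    _ = _ := by rw [h1, hv]; ring

/-- Horizontal vectors are tangent to the projective space. -/
theorem symProd_mem_cpTangent (hz : ‖z‖ = 1) {v : EuclideanSpace ℂ ι}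
    (hv : (inner ℂ z v : ℂ) = 0) : symProd z v ∈ cpTangent (veronese z) := by
  refine ⟨?_, ?_⟩
  · ext i j
    rw [Matrix.conjTranspose_apply, toMat_symProd, toMat_symProd]
    simp only [RCLike.star_def, map_mul, map_add, Complex.conj_conj, map_inv₀, Complex.conj_ofReal]
    ring
  · ext i j
    rw [Matrix.add_apply, projMat_mul, mul_projMat, sum_conj_mul_toMat_symProd hz hv,
      sum_toMat_symProd_mul hz hv, toMat_symProd]
    ring

/-- With y = Xz, the equation PX + XP = X reads X = z yᴴ + y zᴴ. Applying this to z gives y = (yᴴz)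
z + y, so y is orthogonal to z. The factor √2 undoes the normalization of `symProd`. -/
theorem exists_eq_symProd_of_mem_cpTangent (hz : ‖z‖ = 1) {X : MatSpace ι}
    (hX : X ∈ cpTangent (veronese z)) :
    ∃ v, (inner ℂ z v : ℂ) = 0 ∧ X = symProd z v := by
  obtain ⟨hH, hP⟩ := hX
  have h1 := complex_inner_self hz
  rw [complex_inner_apply] at h1
  have h2 : (√2 : ℂ) ≠ 0 := by simp
  let y : ι → ℂ := fun i => ∑ k, toMat X i k * z k
  have hy : ∀ j, ∑ k, conj (z k) * toMat X k j = conj (y j) := by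
    intro j
    simp only [y, map_sum, map_mul]
    refine Finset.sum_congr rfl fun k _ => ?_
    rw [← hH.apply j k, RCLike.star_def, Complex.conj_conj, mul_comm]
  have hent : ∀ i j, toMat X i j = z i * conj (y j) + y i * conj (z j) := by
    intro i j
    have := congrFun (congrFun hP i) j
    rw [Matrix.add_apply, projMat_mul, mul_projMat, hy] at this
    exact this.symm
  have hs : ∑ k, conj (y k) * z k = 0 := by
    have hz0 : ∀ i, z i * ∑ k, conj (y k) * z k = 0 := by
      intro i
      have : y i = z i * (∑ k, conj (y k) * z k) + y i * (∑ k, conj (z k) * z k) := by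
        conv_lhs => simp only [y]
        simp only [hent, Finset.mul_sum, ← Finset.sum_add_distrib]
        refine Finset.sum_congr rfl fun k _ => ?_
        ring
      rw [h1, mul_one] at this
      exact left_eq_add.1 (by rwa [add_comm] at this)
    calc ∑ k, conj (y k) * z k = (∑ i, conj (z i) * z i) * ∑ k, conj (y k) * z k := by
          rw [h1, one_mul]
      _ = 0 := by
          rw [Finset.sum_mul]
          exact Finset.sum_eq_zero fun i _ => by rw [mul_assoc, hz0, mul_zero]
  refine ⟨(√2 : ℂ) • WithLp.toLp 2 y, ?_, ?_⟩
  · rw [inner_smul_right, ← inner_conj_symm, complex_inner_apply, mul_eq_zero]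
    right
    exact (congrArg conj hs).trans (map_zero _)
  · ext ⟨i, j⟩
    refine (hent i j).trans ?_
    rw [symProd_apply]
    simp only [PiLp.smul_apply, smul_eq_mul, map_mul, Complex.conj_ofReal]
    field_simp

theorem cpJ_symProd (hz : ‖z‖ = 1) {v : EuclideanSpace ℂ ι} (hv : (inner ℂ z v : ℂ) = 0) :
    cpJ (veronese z) (symProd z v) = symProd z (Complex.I • v) := by
  ext ⟨i, j⟩
  change Complex.I * ((toMat (symProd z v) * projMat (veronese z)) i j -
    (projMat (veronese z) * toMat (symProd z v)) i j) = _
  rw [projMat_mul, mul_projMat, sum_conj_mul_toMat_symProd hz hv, sum_toMat_symProd_mul hz hv,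
    symProd_apply]
  simp only [PiLp.smul_apply, smul_eq_mul, map_mul, Complex.conj_I]
  ring

end Veronese

/-! ### From Legendrian immersions to their Lagrangian projections -/

section Projection

variable {E : Type*} [NormedAddCommGroup E] [NormedSpace ℝ E] {ι : Type*} [Fintype ι]
  {a : E → EuclideanSpace ℂ ι} {U : Set E} {x : E}

theorem fderiv_bilinear_comp {F G : Type*} [NormedAddCommGroup F] [NormedSpace ℝ F]
    [NormedAddCommGroup G] [NormedSpace ℝ G] (B : Bilin F G) {f g : E → F}
    (hf : DifferentiableAt ℝ f x) (hg : DifferentiableAt ℝ g x) (v : E) :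
    DifferentiableAt ℝ (fun y => B (f y) (g y)) x ∧
      fderiv ℝ (fun y => B (f y) (g y)) x v = B (f x) (fderiv ℝ g x v) + B (fderiv ℝ f x v) (g x) := by
  have h := B.hasFDerivAt_of_bilinear hf.hasFDerivAt hg.hasFDerivAt
  refine ⟨h.differentiableAt, ?_⟩
  rw [h.fderiv]
  rfl

theorem contDiff_bilinear_self {F G : Type*} [NormedAddCommGroup F] [NormedSpace ℝ F]
    [NormedAddCommGroup G] [NormedSpace ℝ G] (B : Bilin F G) {m : ℕ∞ω} :
    ContDiff ℝ m fun z => B z z :=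
  B.contDiff.clm_apply contDiff_id

theorem contDiff_veronese {m : ℕ∞ω} :
    ContDiff ℝ m (veronese : EuclideanSpace ℂ ι → MatSpace ι) :=
  ContDiff.const_smul (1 / 2 : ℝ) (contDiff_bilinear_self symProd)

theorem fderiv_symProd_comp {f g : E → EuclideanSpace ℂ ι} (hf : DifferentiableAt ℝ f x)
    (hg : DifferentiableAt ℝ g x) (v : E) :
    fderiv ℝ (fun y => symProd (f y) (g y)) x v =
      symProd (f x) (fderiv ℝ g x v) + symProd (fderiv ℝ f x v) (g x) :=
  (fderiv_bilinear_comp symProd hf hg v).2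

theorem fderiv_veronese_comp (ha : DifferentiableAt ℝ a x) (v : E) :
    fderiv ℝ (fun y => veronese (a y)) x v = symProd (a x) (fderiv ℝ a x v) := by
  have hd : DifferentiableAt ℝ (fun y => symProd (a y) (a y)) x :=
    (fderiv_bilinear_comp symProd ha ha v).1
  simp only [veronese]
  rw [fderiv_fun_const_smul hd, smul_apply, fderiv_symProd_comp ha ha,
    symProd_comm (fderiv ℝ a x v), ← two_smul ℝ, smul_smul]
  norm_num

namespace IsLegendrianOn

theorem fderiv_fderiv_veronese (h : IsLegendrianOn a U) (hx : x ∈ U) (v w : E) :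
    fderiv ℝ (fderiv ℝ fun y => veronese (a y)) x v w =
      symProd (a x) (fderiv ℝ (fderiv ℝ a) x v w) +
        symProd (fderiv ℝ a x v) (fderiv ℝ a x w) := by
  have hu : ContDiffAt ℝ ∞ (fun y => veronese (a y)) x :=
    contDiff_veronese.contDiffAt.comp x (h.contDiffAt hx)
  have hd : DifferentiableAt ℝ (fderiv ℝ fun y => veronese (a y)) x :=
    (hu.fderiv_right (m := ∞) (by simp)).differentiableAt (by simp)
  rw [← fderiv_fderiv_apply hd]
  have hev : (fun y => fderiv ℝ (fun y => veronese (a y)) y w) =ᶠ[nhds x]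
      fun y => symProd (a y) (fderiv ℝ a y w) :=
    Filter.eventually_of_mem (h.isOpen.mem_nhds hx) fun y hy =>
      fderiv_veronese_comp (h.differentiableAt hy) w
  have hda := h.differentiableAt_fderiv hx
  rw [hev.fderiv_eq, fderiv_symProd_comp (h.differentiableAt hx)
    (hda.clm_apply (differentiableAt_const w)), fderiv_fderiv_apply hda]

theorem orthonormal_veronese (h : IsLegendrianOn a U) (hx : x ∈ U) {κ : Type*} {e : κ → E}
    (he : Orthonormal ℝ fun k => fderiv ℝ a x (e k)) :
    Orthonormal ℝ fun k => fderiv ℝ (fun y => veronese (a y)) x (e k) := by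
  classical
  rw [orthonormal_iff_ite] at he ⊢
  intro i j
  rw [fderiv_veronese_comp (h.differentiableAt hx), fderiv_veronese_comp (h.differentiableAt hx),
    inner_symProd_left (h.norm_eq x hx) _ (h.complex_inner_fderiv hx _), he]

theorem injective_fderiv_veronese (h : IsLegendrianOn a U) (hx : x ∈ U) :
    Function.Injective (fderiv ℝ (fun y => veronese (a y)) x) := by
  refine (injective_iff_map_eq_zero _).2 fun v hv => ?_
  rw [fderiv_veronese_comp (h.differentiableAt hx)] at hv
  have := inner_symProd_left (h.norm_eq x hx) (fderiv ℝ a x v) (h.complex_inner_fderiv hx v)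
  rw [hv, inner_zero_left, eq_comm, inner_self_eq_zero] at this
  exact h.injective x hx (this.trans (map_zero _).symm)

theorem complex_inner_I_fderiv (h : IsLegendrianOn a U) (hx : x ∈ U) (v : E) :
    (inner ℂ (a x) (Complex.I • fderiv ℝ a x v) : ℂ) = 0 := by
  rw [inner_smul_right, h.complex_inner_fderiv hx, mul_zero]

/-- The projection of a Legendrian immersion is Lagrangian. -/
theorem inner_cpJ_fderiv_veronese (h : IsLegendrianOn a U) (hx : x ∈ U) (v w : E) :
    inner ℝ (cpJ (veronese (a x)) (fderiv ℝ (fun y => veronese (a y)) x v))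
      (fderiv ℝ (fun y => veronese (a y)) x w) = 0 := by
  rw [fderiv_veronese_comp (h.differentiableAt hx), fderiv_veronese_comp (h.differentiableAt hx),
    cpJ_symProd (h.norm_eq x hx) (h.complex_inner_fderiv hx v),
    inner_symProd_left (h.norm_eq x hx) _ (h.complex_inner_fderiv hx w), real_inner_comm,
    h.inner_fderiv_I_fderiv hx]

variable [FiniteDimensional ℝ E]

/-- The mean curvature vector of the projection is the projection of the mean curvature vector. -/
theorem meanCurvature_veronese (h : IsLegendrianOn a U) (hx : x ∈ U) :
    meanCurvature cpTangent (fun y => veronese (a y)) x =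
      symProd (a x) (meanCurvature sphTangent a x) := by
  have hz := h.norm_eq x hx
  obtain ⟨e, he⟩ := exists_orthonormal_frame (h.injective x hx)
  have hc := Fintype.card_fin (Module.finrank ℝ E)
  have hd : ∀ v, fderiv ℝ (fun y => veronese (a y)) x v = symProd (a x) (fderiv ℝ a x v) :=
    fderiv_veronese_comp (h.differentiableAt hx)
  refine meanCurvature_eq (symProd_mem_cpTangent hz (h.complex_inner_meanCurvature hx))
    (fun v => ?_) fun X hX hX' => ?_
  · rw [hd, inner_symProd_left hz _ (h.complex_inner_meanCurvature hx), inner_fderiv_meanCurvature]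
  -- A test vector is the image of a horizontal normal m. Against it D² of the projection reduces to
  -- D²a, as the term `symProd (da e) (da e)` is normal to projective space.
  · obtain ⟨m, hm, rfl⟩ := exists_eq_symProd_of_mem_cpTangent hz hX
    simp only [hd, inner_symProd_left hz _ hm] at hX'
    have hm' : inner ℝ (a x) m = 0 := by rw [real_inner_eq_re, hm, Complex.zero_re]
    rw [inner_symProd_left hz _ hm, inner_meanCurvature (T := sphTangent) (mem_sphTangent.2 hm') hX',
      traceHessian_eq_sum he hc, traceHessian_eq_sum (h.orthonormal_veronese hx he) hc, sum_inner,
      sum_inner]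
    congr 1
    refine Finset.sum_congr rfl fun k _ => ?_
    rw [h.fderiv_fderiv_veronese hx, inner_add_left, inner_symProd_left hz _ hm,
      inner_symProd_right _ _ (h.complex_inner_fderiv hx _) (h.complex_inner_fderiv hx _), add_zero]

/-- The field JH downstairs is the image of the horizontal field iH. Differentiating `symProd a
(iH)` adds only `symProd (da) (iH)`, which is normal, so the divergences agree term by term in a
common orthonormal frame. -/
theorem divJH_veronese (h : IsLegendrianOn a U) (hx : x ∈ U) :
    divJH cpTangent cpJ (fun y => veronese (a y)) x = divJH sphTangent sphJ a x := by
  have hz := h.norm_eq x hx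
  obtain ⟨e, he⟩ := exists_orthonormal_frame (h.injective x hx)
  have hc := Fintype.card_fin (Module.finrank ℝ E)
  have hev : (fun y => cpJ (veronese (a y)) (meanCurvature cpTangent (fun y => veronese (a y)) y))
      =ᶠ[nhds x] fun y => symProd (a y) (Complex.I • meanCurvature sphTangent a y) :=
    Filter.eventually_of_mem (h.isOpen.mem_nhds hx) fun y hy => by
      simp only
      rw [h.meanCurvature_veronese hy, cpJ_symProd (h.norm_eq y hy) (h.complex_inner_meanCurvature hy)]
  have hdiff : DifferentiableAt ℝ (fun y => Complex.I • meanCurvature sphTangent a y) x :=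
    (h.differentiableAt_meanCurvature hx).fun_const_smul Complex.I
  rw [divJH, divJH, divergence_eq_sum he hc, divergence_eq_sum (h.orthonormal_veronese hx he) hc,
    hev.fderiv_eq]
  refine Finset.sum_congr rfl fun k _ => ?_
  have hH : (inner ℂ (a x) (Complex.I • meanCurvature sphTangent a x) : ℂ) = 0 := by
    rw [inner_smul_right, h.complex_inner_meanCurvature hx, mul_zero]
  rw [fderiv_symProd_comp (h.differentiableAt hx) hdiff, fderiv_veronese_comp (h.differentiableAt hx),
    inner_add_left, inner_symProd_left hz _ (h.complex_inner_fderiv hx _),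
    inner_symProd_right _ _ (h.complex_inner_fderiv hx _) hH, add_zero]
  rfl

end IsLegendrianOn

end Projection

/-! ### Inner products of vectors adapted to a join -/

section Pair

variable {ι₁ ι₂ : Type*} [Fintype ι₁] [Fintype ι₂]

/-- The identification of `ℂ^ι₁ × ℂ^ι₂` with `ℂ^(ι₁ ⊕ ι₂)`. -/
def pairL : (EuclideanSpace ℂ ι₁ × EuclideanSpace ℂ ι₂) →L[ℝ] EuclideanSpace ℂ (ι₁ ⊕ ι₂) :=
  LinearMap.toContinuousLinearMap
    { toFun := fun p => WithLp.toLp 2 (Sum.elim (fun i => p.1 i) fun i => p.2 i)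
      map_add' := fun p q => by ext (i | i) <;> simp
      map_smul' := fun c p => by ext (i | i) <;> simp }

theorem pairL_inl (p : EuclideanSpace ℂ ι₁ × EuclideanSpace ℂ ι₂) (i : ι₁) :
    pairL p (Sum.inl i) = p.1 i := rfl

theorem pairL_inr (p : EuclideanSpace ℂ ι₁ × EuclideanSpace ℂ ι₂) (i : ι₂) :
    pairL p (Sum.inr i) = p.2 i := rfl

theorem smul_pairL (c : ℂ) (p : EuclideanSpace ℂ ι₁ × EuclideanSpace ℂ ι₂) :
    c • pairL p = pairL (c • p) := by
  ext (i | i) <;> rfl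

theorem inner_pairL (p q : EuclideanSpace ℂ ι₁ × EuclideanSpace ℂ ι₂) :
    inner ℝ (pairL p) (pairL q) = inner ℝ p.1 q.1 + inner ℝ p.2 q.2 := by
  simp only [PiLp.inner_apply, Fintype.sum_sum_type, pairL_inl, pairL_inr]

theorem join_eq_pairL (w : Sph (Fin 2)) (x : Sph ι₁) (y : Sph ι₂) :
    (join w x y : EuclideanSpace ℂ (ι₁ ⊕ ι₂)) =
      pairL ((w : EuclideanSpace ℂ (Fin 2)) 0 • (x : EuclideanSpace ℂ ι₁),
        (w : EuclideanSpace ℂ (Fin 2)) 1 • (y : EuclideanSpace ℂ ι₂)) := by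
  ext (i | i) <;> rfl

variable {ι : Type*} [Fintype ι]

/-- The vector t is either horizontal (s = 0) or a traced Hessian, whose Hermitian product with z is
the real number s = -m. -/
theorem inner_smul_add_smul {z t y : EuclideanSpace ℂ ι} (hz : ‖z‖ = 1) {s : ℝ}
    (ht : (inner ℂ z t : ℂ) = s) (hy : (inner ℂ z y : ℂ) = 0) (r : ℝ) (c d d' : ℂ) :
    inner ℝ ((r • c) • t + d • z) (c • y + d' • z) =
      r * ‖c‖ ^ 2 * inner ℝ t y + r * s * inner ℝ c d' + inner ℝ d d' := by
  have ht' : (inner ℂ t z : ℂ) = s := by rw [← inner_conj_symm, ht, Complex.conj_ofReal]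
  simp only [inner_add_left, inner_add_right, inner_smul_smul, ht', hy, complex_inner_self hz,
    mul_zero, Complex.zero_re, mul_one, Complex.real_smul, map_mul, Complex.conj_ofReal, add_zero,
    Complex.inner]
  have e1 : (r * conj c * c * (inner ℂ t y : ℂ)).re = r * ‖c‖ ^ 2 * inner ℝ t y := by
    rw [mul_assoc (r : ℂ), mul_comm (conj c), Complex.mul_conj, Complex.normSq_eq_norm_sq,
      ← Complex.ofReal_mul, Complex.re_ofReal_mul, real_inner_eq_re]
  have e2 : (r * conj c * d' * (s : ℂ)).re = r * s * (conj c * d').re := by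
    rw [mul_assoc (r : ℂ), mul_right_comm, ← Complex.ofReal_mul, Complex.re_ofReal_mul]
  rw [e1, e2, add_assoc, mul_comm d', mul_comm d']

theorem inner_smul_add_smul_self {z t y : EuclideanSpace ℂ ι} (hz : ‖z‖ = 1)
    (ht : (inner ℂ z t : ℂ) = 0) (hy : (inner ℂ z y : ℂ) = 0) (c d d' : ℂ) :
    inner ℝ (c • t + d • z) (c • y + d' • z) = ‖c‖ ^ 2 * inner ℝ t y + inner ℝ d d' := by
  have := inner_smul_add_smul hz (s := 0) (by rw [ht, Complex.ofReal_zero]) hy 1 c d d'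
  rw [one_smul] at this
  rw [this]
  ring

end Pair

/-! ### First and second derivatives of a join -/

section Warp

theorem eventually_differentiableAt {X Y : Type*} [NormedAddCommGroup X] [NormedSpace ℝ X]
    [NormedAddCommGroup Y] [NormedSpace ℝ Y] {f : X → Y} {x : X} (hf : ContDiffAt ℝ ∞ f x) :
    ∀ᶠ y in nhds x, DifferentiableAt ℝ f y :=
  ((hf.of_le (m := 1) (by exact_mod_cast le_top)).eventually (by simp)).mono
    fun _ hy => hy.differentiableAt (by simp)

theorem differentiableAt_fderiv_of_contDiffAt {X Y : Type*} [NormedAddCommGroup X]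
    [NormedSpace ℝ X] [NormedAddCommGroup Y] [NormedSpace ℝ Y] {f : X → Y} {x : X}
    (hf : ContDiffAt ℝ ∞ f x) : DifferentiableAt ℝ (fderiv ℝ f) x :=
  (hf.fderiv_right (m := ∞) (by simp)).differentiableAt (by simp)

variable {E₀ E₁ E₂ : Type*} [NormedAddCommGroup E₀] [NormedSpace ℝ E₀] [NormedAddCommGroup E₁]
  [NormedSpace ℝ E₁] [NormedAddCommGroup E₂] [NormedSpace ℝ E₂]
  {ι₁ ι₂ : Type*} [Fintype ι₁] [Fintype ι₂]

theorem differentiableAt_smul_comp {X F : Type*} [NormedAddCommGroup X] [NormedSpace ℝ X]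
    [NormedAddCommGroup F] [NormedSpace ℝ F] [NormedSpace ℂ F] [IsScalarTower ℝ ℂ F]
    {Γ : E₀ → ℂ} {a : E₁ → F} (π₀ : X →L[ℝ] E₀) (π₁ : X →L[ℝ] E₁) {p : X}
    (hΓ : DifferentiableAt ℝ Γ (π₀ p)) (ha : DifferentiableAt ℝ a (π₁ p)) :
    DifferentiableAt ℝ (fun q => Γ (π₀ q) • a (π₁ q)) p ∧ ∀ v,
    fderiv ℝ (fun q => Γ (π₀ q) • a (π₁ q)) p v =
      Γ (π₀ p) • fderiv ℝ a (π₁ p) (π₁ v) + fderiv ℝ Γ (π₀ p) (π₀ v) • a (π₁ p) := by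
  have h := (hΓ.hasFDerivAt.comp p π₀.hasFDerivAt).fun_smul (ha.hasFDerivAt.comp p π₁.hasFDerivAt)
  refine ⟨h.differentiableAt, fun v => ?_⟩
  rw [show (fun q => Γ (π₀ q) • a (π₁ q)) = fun q => (Γ ∘ π₀) q • (a ∘ π₁) q from rfl, h.fderiv]
  rfl

/-- The join of two maps along a curve in `ℂ²`. -/
def warp (Γ₀ Γ₁ : E₀ → ℂ) (a : E₁ → EuclideanSpace ℂ ι₁) (b : E₂ → EuclideanSpace ℂ ι₂)
    (q : E₀ × E₁ × E₂) : EuclideanSpace ℂ (ι₁ ⊕ ι₂) :=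
  pairL (Γ₀ q.1 • a q.2.1, Γ₁ q.1 • b q.2.2)

variable {Γ₀ Γ₁ : E₀ → ℂ} {a : E₁ → EuclideanSpace ℂ ι₁} {b : E₂ → EuclideanSpace ℂ ι₂}
  {p : E₀ × E₁ × E₂}

theorem differentiableAt_warp (h₀ : DifferentiableAt ℝ Γ₀ p.1) (h₁ : DifferentiableAt ℝ Γ₁ p.1)
    (ha : DifferentiableAt ℝ a p.2.1) (hb : DifferentiableAt ℝ b p.2.2) :
    DifferentiableAt ℝ (warp Γ₀ Γ₁ a b) p ∧ ∀ v, fderiv ℝ (warp Γ₀ Γ₁ a b) p v =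
      pairL (Γ₀ p.1 • fderiv ℝ a p.2.1 v.2.1 + fderiv ℝ Γ₀ p.1 v.1 • a p.2.1,
        Γ₁ p.1 • fderiv ℝ b p.2.2 v.2.2 + fderiv ℝ Γ₁ p.1 v.1 • b p.2.2) := by
  have d₁ := differentiableAt_smul_comp (ContinuousLinearMap.fst ℝ E₀ (E₁ × E₂))
    ((ContinuousLinearMap.fst ℝ E₁ E₂).comp (ContinuousLinearMap.snd ℝ E₀ (E₁ × E₂))) (p := p) h₀ ha
  have d₂ := differentiableAt_smul_comp (ContinuousLinearMap.fst ℝ E₀ (E₁ × E₂))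
    ((ContinuousLinearMap.snd ℝ E₁ E₂).comp (ContinuousLinearMap.snd ℝ E₀ (E₁ × E₂))) (p := p) h₁ hb
  have h := (pairL (ι₁ := ι₁) (ι₂ := ι₂)).hasFDerivAt.comp p
    (d₁.1.hasFDerivAt.prodMk d₂.1.hasFDerivAt)
  refine ⟨h.differentiableAt, fun v => ?_⟩
  have h' : HasFDerivAt (warp Γ₀ Γ₁ a b) _ p := h
  rw [h'.fderiv]
  change pairL (fderiv ℝ _ p v, fderiv ℝ _ p v) = _
  rw [d₁.2, d₂.2]
  rfl

theorem contDiffAt_warp {m : ℕ∞ω} (h₀ : ContDiffAt ℝ m Γ₀ p.1) (h₁ : ContDiffAt ℝ m Γ₁ p.1)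
    (ha : ContDiffAt ℝ m a p.2.1) (hb : ContDiffAt ℝ m b p.2.2) :
    ContDiffAt ℝ m (warp Γ₀ Γ₁ a b) p := by
  have c₀ := h₀.comp p contDiffAt_fst
  have c₁ := h₁.comp p contDiffAt_fst
  have ca := ha.comp p (contDiffAt_fst.comp p contDiffAt_snd)
  have cb := hb.comp p (contDiffAt_snd.comp p contDiffAt_snd)
  exact pairL.contDiff.contDiffAt.comp p ((c₀.smul ca).prodMk (c₁.smul cb))

/-- A directional derivative of a join is a sum of two joins, so the first-order formula can be
applied twice. -/
theorem fderiv_fderiv_warp (h₀ : ContDiffAt ℝ ∞ Γ₀ p.1) (h₁ : ContDiffAt ℝ ∞ Γ₁ p.1)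
    (ha : ContDiffAt ℝ ∞ a p.2.1) (hb : ContDiffAt ℝ ∞ b p.2.2) (v w : E₀ × E₁ × E₂) :
    fderiv ℝ (fderiv ℝ (warp Γ₀ Γ₁ a b)) p v w =
      pairL ((Γ₀ p.1 • fderiv ℝ (fderiv ℝ a) p.2.1 v.2.1 w.2.1 +
          fderiv ℝ Γ₀ p.1 v.1 • fderiv ℝ a p.2.1 w.2.1) +
        (fderiv ℝ Γ₀ p.1 w.1 • fderiv ℝ a p.2.1 v.2.1 +
          fderiv ℝ (fderiv ℝ Γ₀) p.1 v.1 w.1 • a p.2.1),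
        (Γ₁ p.1 • fderiv ℝ (fderiv ℝ b) p.2.2 v.2.2 w.2.2 +
          fderiv ℝ Γ₁ p.1 v.1 • fderiv ℝ b p.2.2 w.2.2) +
        (fderiv ℝ Γ₁ p.1 w.1 • fderiv ℝ b p.2.2 v.2.2 +
          fderiv ℝ (fderiv ℝ Γ₁) p.1 v.1 w.1 • b p.2.2)) := by
  have hd : DifferentiableAt ℝ (fderiv ℝ (warp Γ₀ Γ₁ a b)) p :=
    ((contDiffAt_warp h₀ h₁ ha hb).fderiv_right (m := ∞) (by simp)).differentiableAt (by simp)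
  have e₀ := continuousAt_fst.eventually (eventually_differentiableAt h₀)
  have e₁ := continuousAt_fst.eventually (eventually_differentiableAt h₁)
  have ea := (continuousAt_fst.comp continuousAt_snd).eventually (eventually_differentiableAt ha)
  have eb := (continuousAt_snd.comp continuousAt_snd).eventually (eventually_differentiableAt hb)
  have hev : (fun q => fderiv ℝ (warp Γ₀ Γ₁ a b) q w) =ᶠ[nhds p] fun q =>
      warp Γ₀ Γ₁ (fun y => fderiv ℝ a y w.2.1) (fun y => fderiv ℝ b y w.2.2) q +
      warp (fun y => fderiv ℝ Γ₀ y w.1) (fun y => fderiv ℝ Γ₁ y w.1) a b q := by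
    filter_upwards [e₀, e₁, ea, eb] with q q₀ q₁ qa qb
    rw [(differentiableAt_warp q₀ q₁ qa qb).2, warp, warp, ← map_add]
    rfl
  have d₀ := differentiableAt_fderiv_of_contDiffAt h₀
  have d₁ := differentiableAt_fderiv_of_contDiffAt h₁
  have da := differentiableAt_fderiv_of_contDiffAt ha
  have db := differentiableAt_fderiv_of_contDiffAt hb
  have w₁ := differentiableAt_warp (p := p) e₀.self_of_nhds e₁.self_of_nhds
    (da.clm_apply (differentiableAt_const w.2.1)) (db.clm_apply (differentiableAt_const w.2.2))
  have w₂ := differentiableAt_warp (p := p) (d₀.clm_apply (differentiableAt_const w.1))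
    (d₁.clm_apply (differentiableAt_const w.1)) ea.self_of_nhds eb.self_of_nhds
  rw [← fderiv_fderiv_apply hd, hev.fderiv_eq, fderiv_fun_add w₁.1 w₂.1, add_apply,
    w₁.2, w₂.2, ← map_add, fderiv_fderiv_apply d₀, fderiv_fderiv_apply d₁, fderiv_fderiv_apply da,
    fderiv_fderiv_apply db]
  rfl

end Warp

/-! ### Joins along a curve: Legendrian property, mean curvature, div JH -/

/-- Curves in `S^3`, parametrized by an open subset of a line, along which the joins of
Legendrian immersions of dimensions `n₁`, `n₂` are Legendrian, and minimal if the immersions are. -/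
structure IsWarpCurve {E₀ : Type*} [NormedAddCommGroup E₀] [NormedSpace ℝ E₀] (n₁ n₂ : ℕ)
    (Γ₀ Γ₁ : E₀ → ℂ) (U : Set E₀) : Prop where
  isOpen : IsOpen U
  contDiffAt_fst : ∀ x ∈ U, ContDiffAt ℝ ∞ Γ₀ x
  contDiffAt_snd : ∀ x ∈ U, ContDiffAt ℝ ∞ Γ₁ x
  fst_ne_zero : ∀ x ∈ U, Γ₀ x ≠ 0
  snd_ne_zero : ∀ x ∈ U, Γ₁ x ≠ 0
  norm_sq_add : ∀ x ∈ U, ‖Γ₀ x‖ ^ 2 + ‖Γ₁ x‖ ^ 2 = 1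
  legendrian : ∀ x ∈ U, ∀ v, inner ℝ (fderiv ℝ Γ₀ x v) (Complex.I * Γ₀ x) +
    inner ℝ (fderiv ℝ Γ₁ x v) (Complex.I * Γ₁ x) = 0
  eq_zero : ∀ x ∈ U, ∀ v, fderiv ℝ Γ₀ x v = 0 → v = 0
  -- On the left is the curve's contribution to the traced Hessian of the join, paired with i times
  -- a tangent vector. The right side is what the radial parts -n_j of the factors' traced Hessians
  -- must cancel.
  critical : ∀ x ∈ U, ∀ e, ‖fderiv ℝ Γ₀ x e‖ ^ 2 + ‖fderiv ℝ Γ₁ x e‖ ^ 2 = 1 → ∀ v,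
    inner ℝ (fderiv ℝ (fderiv ℝ Γ₀) x e e) (Complex.I * fderiv ℝ Γ₀ x v) +
      inner ℝ (fderiv ℝ (fderiv ℝ Γ₁) x e e) (Complex.I * fderiv ℝ Γ₁ x v) =
    n₁ / ‖Γ₀ x‖ ^ 2 * inner ℝ (Γ₀ x) (Complex.I * fderiv ℝ Γ₀ x v) +
      n₂ / ‖Γ₁ x‖ ^ 2 * inner ℝ (Γ₁ x) (Complex.I * fderiv ℝ Γ₁ x v)
  finrank_eq_one : Module.finrank ℝ E₀ = 1

section

variable {E : Type*} [NormedAddCommGroup E] [NormedSpace ℝ E] [FiniteDimensional ℝ E]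
  {ι : Type*} [Fintype ι]

theorem meanCurvature_eq_zero_of_finrank {F : Type*} [NormedAddCommGroup F] [InnerProductSpace ℝ F]
    [FiniteDimensional ℝ F] (T : F → Submodule ℝ F) (u : E → F) (x : E)
    (h : Module.finrank ℝ E = 0) : meanCurvature T u x = 0 := by
  rw [meanCurvature, h, Nat.cast_zero, inv_zero, zero_smul, map_zero]

theorem IsLegendrianOn.finrank_mul_inner_meanCurvature {a : E → EuclideanSpace ℂ ι} {U : Set E}
    {x : E} (h : IsLegendrianOn a U) (hx : x ∈ U) (v : E) :
    Module.finrank ℝ E * inner ℝ (meanCurvature sphTangent a x) (Complex.I • fderiv ℝ a x v) =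
      inner ℝ (traceHessian a x) (Complex.I • fderiv ℝ a x v) := by
  rw [h.inner_meanCurvature_I_fderiv hx]
  -- In dimension zero the factor (dim)⁻¹ is 0 by convention, but then v = 0 as well.
  by_cases hE : Module.finrank ℝ E = 0
  · have := Module.finrank_zero_iff.1 hE
    rw [Subsingleton.elim v 0]
    simp
  · rw [mul_inv_cancel_left₀ (Nat.cast_ne_zero.2 hE)]

theorem IsLegendrianOn.complex_inner_traceHessian {a : E → EuclideanSpace ℂ ι} {U : Set E}
    {x : E} (h : IsLegendrianOn a U) (hx : x ∈ U) :
    (inner ℂ (a x) (traceHessian a x) : ℂ) = (-(Module.finrank ℝ E : ℝ) : ℝ) := by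
  rw [complex_inner_eq, real_inner_comm, h.inner_traceHessian_self hx,
    real_inner_comm (traceHessian a x), h.inner_traceHessian_I hx]
  simp

end

theorem I_smul_warp {E₀ E₁ E₂ ι₁ ι₂ : Type*} [Fintype ι₁] [Fintype ι₂] {Γ₀ Γ₁ : E₀ → ℂ}
    {a : E₁ → EuclideanSpace ℂ ι₁} {b : E₂ → EuclideanSpace ℂ ι₂} (p : E₀ × E₁ × E₂) :
    Complex.I • warp Γ₀ Γ₁ a b p =
    pairL (Γ₀ p.1 • (0 : EuclideanSpace ℂ ι₁) + (Complex.I * Γ₀ p.1) • a p.2.1,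
      Γ₁ p.1 • (0 : EuclideanSpace ℂ ι₂) + (Complex.I * Γ₁ p.1) • b p.2.2) := by
  rw [warp, smul_pairL, Prod.smul_mk, smul_zero, smul_zero, zero_add, zero_add, mul_smul, mul_smul]

section Warp

variable {E₀ E₁ E₂ : Type*} [NormedAddCommGroup E₀] [NormedSpace ℝ E₀] [NormedAddCommGroup E₁]
  [NormedSpace ℝ E₁] [NormedAddCommGroup E₂] [NormedSpace ℝ E₂]
  {ι₁ ι₂ : Type*} [Fintype ι₁] [Fintype ι₂] {n₁ n₂ : ℕ}
  {Γ₀ Γ₁ : E₀ → ℂ} {a : E₁ → EuclideanSpace ℂ ι₁} {b : E₂ → EuclideanSpace ℂ ι₂}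
  {U₀ : Set E₀} {U₁ : Set E₁} {U₂ : Set E₂} {p : E₀ × E₁ × E₂}

theorem fderiv_warp (h : IsWarpCurve n₁ n₂ Γ₀ Γ₁ U₀) (ha : IsLegendrianOn a U₁)
    (hb : IsLegendrianOn b U₂) (hp : p ∈ U₀ ×ˢ U₁ ×ˢ U₂) (v : E₀ × E₁ × E₂) :
    fderiv ℝ (warp Γ₀ Γ₁ a b) p v =
      pairL (Γ₀ p.1 • fderiv ℝ a p.2.1 v.2.1 + fderiv ℝ Γ₀ p.1 v.1 • a p.2.1,
        Γ₁ p.1 • fderiv ℝ b p.2.2 v.2.2 + fderiv ℝ Γ₁ p.1 v.1 • b p.2.2) :=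
  (differentiableAt_warp ((h.contDiffAt_fst _ hp.1).differentiableAt (by simp))
    ((h.contDiffAt_snd _ hp.1).differentiableAt (by simp)) (ha.differentiableAt hp.2.1)
    (hb.differentiableAt hp.2.2)).2 v

theorem I_smul_fderiv_warp (h : IsWarpCurve n₁ n₂ Γ₀ Γ₁ U₀) (ha : IsLegendrianOn a U₁)
    (hb : IsLegendrianOn b U₂) (hp : p ∈ U₀ ×ˢ U₁ ×ˢ U₂) (v : E₀ × E₁ × E₂) :
    Complex.I • fderiv ℝ (warp Γ₀ Γ₁ a b) p v =
      pairL (Γ₀ p.1 • (Complex.I • fderiv ℝ a p.2.1 v.2.1) +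
          (Complex.I * fderiv ℝ Γ₀ p.1 v.1) • a p.2.1,
        Γ₁ p.1 • (Complex.I • fderiv ℝ b p.2.2 v.2.2) +
          (Complex.I * fderiv ℝ Γ₁ p.1 v.1) • b p.2.2) := by
  rw [fderiv_warp h ha hb hp, smul_pairL, Prod.smul_mk, smul_add, smul_add,
    smul_comm Complex.I (Γ₀ p.1), smul_comm Complex.I (Γ₁ p.1), mul_smul, mul_smul]

theorem inner_fderiv_warp (h : IsWarpCurve n₁ n₂ Γ₀ Γ₁ U₀) (ha : IsLegendrianOn a U₁)
    (hb : IsLegendrianOn b U₂) (hp : p ∈ U₀ ×ˢ U₁ ×ˢ U₂) (v w : E₀ × E₁ × E₂) :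
    inner ℝ (fderiv ℝ (warp Γ₀ Γ₁ a b) p v) (fderiv ℝ (warp Γ₀ Γ₁ a b) p w) =
      (‖Γ₀ p.1‖ ^ 2 * inner ℝ (fderiv ℝ a p.2.1 v.2.1) (fderiv ℝ a p.2.1 w.2.1) +
        inner ℝ (fderiv ℝ Γ₀ p.1 v.1) (fderiv ℝ Γ₀ p.1 w.1)) +
      (‖Γ₁ p.1‖ ^ 2 * inner ℝ (fderiv ℝ b p.2.2 v.2.2) (fderiv ℝ b p.2.2 w.2.2) +
        inner ℝ (fderiv ℝ Γ₁ p.1 v.1) (fderiv ℝ Γ₁ p.1 w.1)) := by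
  rw [fderiv_warp h ha hb hp, fderiv_warp h ha hb hp, inner_pairL,
    inner_smul_add_smul_self (ha.norm_eq _ hp.2.1) (ha.complex_inner_fderiv hp.2.1 _)
      (ha.complex_inner_fderiv hp.2.1 _),
    inner_smul_add_smul_self (hb.norm_eq _ hp.2.2) (hb.complex_inner_fderiv hp.2.2 _)
      (hb.complex_inner_fderiv hp.2.2 _)]

/-- The join of Legendrian immersions along a Legendrian curve is a Legendrian immersion. -/
theorem IsWarpCurve.isLegendrianOn_warp [FiniteDimensional ℝ E₀] [FiniteDimensional ℝ E₁]
    [FiniteDimensional ℝ E₂] (h : IsWarpCurve n₁ n₂ Γ₀ Γ₁ U₀)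
    (ha : IsLegendrianOn a U₁) (hb : IsLegendrianOn b U₂) :
    IsLegendrianOn (warp Γ₀ Γ₁ a b) (U₀ ×ˢ U₁ ×ˢ U₂) where
  isOpen := h.isOpen.prod (ha.isOpen.prod hb.isOpen)
  contDiffOn := fun p hp => (contDiffAt_warp (h.contDiffAt_fst _ hp.1) (h.contDiffAt_snd _ hp.1)
    (ha.contDiffAt hp.2.1) (hb.contDiffAt hp.2.2)).contDiffWithinAt
  norm_eq := fun p hp => by
    have : ‖warp Γ₀ Γ₁ a b p‖ ^ 2 = 1 := by
      rw [← real_inner_self_eq_norm_sq, warp, inner_pairL, real_inner_self_eq_norm_sq,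
        real_inner_self_eq_norm_sq, norm_smul, norm_smul, ha.norm_eq _ hp.2.1, hb.norm_eq _ hp.2.2,
        mul_one, mul_one, h.norm_sq_add _ hp.1]
    rwa [pow_eq_one_iff_of_nonneg (norm_nonneg _) two_ne_zero] at this
  injective := fun p hp => by
    refine (injective_iff_map_eq_zero _).2 fun v hv => ?_
    have h0 := inner_fderiv_warp h ha hb hp v v
    simp only [hv, inner_zero_left, real_inner_self_eq_norm_sq] at h0
    have k₀ : 0 < ‖Γ₀ p.1‖ ^ 2 := by
      have := h.fst_ne_zero _ hp.1
      positivity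
    have k₁ : 0 < ‖Γ₁ p.1‖ ^ 2 := by
      have := h.snd_ne_zero _ hp.1
      positivity
    have m₀ : 0 ≤ ‖Γ₀ p.1‖ ^ 2 * ‖fderiv ℝ a p.2.1 v.2.1‖ ^ 2 := by positivity
    have m₁ : 0 ≤ ‖Γ₁ p.1‖ ^ 2 * ‖fderiv ℝ b p.2.2 v.2.2‖ ^ 2 := by positivity
    have l₀ := sq_nonneg ‖fderiv ℝ Γ₀ p.1 v.1‖
    have l₁ := sq_nonneg ‖fderiv ℝ Γ₁ p.1 v.1‖
    have z₀ : ‖fderiv ℝ Γ₀ p.1 v.1‖ ^ 2 = 0 := by linarith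
    have z₁ : ‖Γ₀ p.1‖ ^ 2 * ‖fderiv ℝ a p.2.1 v.2.1‖ ^ 2 = 0 := by linarith
    have z₂ : ‖Γ₁ p.1‖ ^ 2 * ‖fderiv ℝ b p.2.2 v.2.2‖ ^ 2 = 0 := by linarith
    rw [pow_eq_zero_iff two_ne_zero, norm_eq_zero] at z₀
    rw [mul_eq_zero_iff_left k₀.ne', pow_eq_zero_iff two_ne_zero, norm_eq_zero] at z₁
    rw [mul_eq_zero_iff_left k₁.ne', pow_eq_zero_iff two_ne_zero, norm_eq_zero] at z₂
    exact Prod.ext (h.eq_zero _ hp.1 _ z₀) (Prod.ext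
      (ha.injective _ hp.2.1 (z₁.trans (map_zero _).symm))
      (hb.injective _ hp.2.2 (z₂.trans (map_zero _).symm)))
  inner_I := fun p hp v => by
    rw [fderiv_warp h ha hb hp, I_smul_warp, inner_pairL,
      inner_smul_add_smul_self (ha.norm_eq _ hp.2.1) (ha.complex_inner_fderiv hp.2.1 _)
        (inner_zero_right _),
      inner_smul_add_smul_self (hb.norm_eq _ hp.2.2) (hb.complex_inner_fderiv hp.2.2 _)
        (inner_zero_right _), inner_zero_right, inner_zero_right, mul_zero, mul_zero, zero_add,
      zero_add]
    exact h.legendrian _ hp.1 _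
  finrank_add_one := by
    rw [Module.finrank_prod, Module.finrank_prod, Fintype.card_sum, ← ha.finrank_add_one,
      ← hb.finrank_add_one, h.finrank_eq_one]
    ring

/-- The frame of the join given by frames of its factors. -/
def warpFrame (p : E₀ × E₁ × E₂) (Γ₀ Γ₁ : E₀ → ℂ) (e₀ : E₀) {κ₁ κ₂ : Type*} (e₁ : κ₁ → E₁)
    (e₂ : κ₂ → E₂) : Unit ⊕ κ₁ ⊕ κ₂ → E₀ × E₁ × E₂
  | Sum.inl _ => (e₀, 0, 0)
  | Sum.inr (Sum.inl k) => (0, ‖Γ₀ p.1‖⁻¹ • e₁ k, 0)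
  | Sum.inr (Sum.inr k) => (0, 0, ‖Γ₁ p.1‖⁻¹ • e₂ k)

theorem IsWarpCurve.exists_unit (h : IsWarpCurve n₁ n₂ Γ₀ Γ₁ U₀) {x : E₀} (hx : x ∈ U₀) :
    ∃ e, ‖fderiv ℝ Γ₀ x e‖ ^ 2 + ‖fderiv ℝ Γ₁ x e‖ ^ 2 = 1 := by
  have : Nontrivial E₀ := Module.nontrivial_of_finrank_pos (R := ℝ) (by
    rw [h.finrank_eq_one]; exact one_pos)
  obtain ⟨v, hv⟩ := exists_ne (0 : E₀)
  have hpos : 0 < ‖fderiv ℝ Γ₀ x v‖ ^ 2 + ‖fderiv ℝ Γ₁ x v‖ ^ 2 := by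
    have := mt (h.eq_zero x hx v) hv
    positivity
  refine ⟨(√(‖fderiv ℝ Γ₀ x v‖ ^ 2 + ‖fderiv ℝ Γ₁ x v‖ ^ 2))⁻¹ • v, ?_⟩
  rw [map_smul, map_smul, norm_smul, norm_smul, mul_pow, mul_pow, ← mul_add, norm_inv,
    Real.norm_of_nonneg (Real.sqrt_nonneg _), inv_pow, Real.sq_sqrt hpos.le,
    inv_mul_cancel₀ hpos.ne']

theorem orthonormal_warpFrame (h : IsWarpCurve n₁ n₂ Γ₀ Γ₁ U₀) (ha : IsLegendrianOn a U₁)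
    (hb : IsLegendrianOn b U₂) (hp : p ∈ U₀ ×ˢ U₁ ×ˢ U₂) {e₀ : E₀}
    (he₀ : ‖fderiv ℝ Γ₀ p.1 e₀‖ ^ 2 + ‖fderiv ℝ Γ₁ p.1 e₀‖ ^ 2 = 1) {κ₁ κ₂ : Type*}
    {e₁ : κ₁ → E₁} {e₂ : κ₂ → E₂} (he₁ : Orthonormal ℝ fun k => fderiv ℝ a p.2.1 (e₁ k))
    (he₂ : Orthonormal ℝ fun k => fderiv ℝ b p.2.2 (e₂ k)) :
    Orthonormal ℝ fun k => fderiv ℝ (warp Γ₀ Γ₁ a b) p (warpFrame p Γ₀ Γ₁ e₀ e₁ e₂ k) := by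
  classical
  have k₀ : ‖Γ₀ p.1‖ ≠ 0 := norm_ne_zero_iff.2 (h.fst_ne_zero _ hp.1)
  have k₁ : ‖Γ₁ p.1‖ ≠ 0 := norm_ne_zero_iff.2 (h.snd_ne_zero _ hp.1)
  rw [orthonormal_iff_ite] at he₁ he₂ ⊢
  rintro (i | i | i) (j | j | j) <;> rw [inner_fderiv_warp h ha hb hp] <;>
    simp only [warpFrame, map_zero, map_smul, inner_zero_left, inner_zero_right, mul_zero, add_zero,
      zero_add, real_inner_smul_left, real_inner_smul_right, real_inner_self_eq_norm_sq, he₀,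
      he₁, he₂, reduceCtorEq, if_false, if_true, Sum.inr.injEq, Sum.inl.injEq]
  · split_ifs
    · field_simp
    · simp
  · split_ifs
    · field_simp
    · simp

variable [FiniteDimensional ℝ E₁] [FiniteDimensional ℝ E₂]

theorem card_warpFrame (h : IsWarpCurve n₁ n₂ Γ₀ Γ₁ U₀) [FiniteDimensional ℝ E₀] :
    Fintype.card (Unit ⊕ Fin (Module.finrank ℝ E₁) ⊕ Fin (Module.finrank ℝ E₂)) =
      Module.finrank ℝ (E₀ × E₁ × E₂) := by
  rw [Module.finrank_prod, Module.finrank_prod, h.finrank_eq_one]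
  simp

variable [FiniteDimensional ℝ E₀]

/-- Each frame vector has a single nonzero slot, so mixed derivatives do not contribute. Normalizing
the factor frames by |Γ_j|⁻¹ produces the weights |Γ_j|⁻². -/
theorem traceHessian_warp (h : IsWarpCurve n₁ n₂ Γ₀ Γ₁ U₀) (ha : IsLegendrianOn a U₁)
    (hb : IsLegendrianOn b U₂) (hp : p ∈ U₀ ×ˢ U₁ ×ˢ U₂) {e₀ : E₀}
    (he₀ : ‖fderiv ℝ Γ₀ p.1 e₀‖ ^ 2 + ‖fderiv ℝ Γ₁ p.1 e₀‖ ^ 2 = 1) :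
    traceHessian (warp Γ₀ Γ₁ a b) p =
      pairL (((‖Γ₀ p.1‖ ^ 2)⁻¹ • Γ₀ p.1) • traceHessian a p.2.1 +
          fderiv ℝ (fderiv ℝ Γ₀) p.1 e₀ e₀ • a p.2.1,
        ((‖Γ₁ p.1‖ ^ 2)⁻¹ • Γ₁ p.1) • traceHessian b p.2.2 +
          fderiv ℝ (fderiv ℝ Γ₁) p.1 e₀ e₀ • b p.2.2) := by
  obtain ⟨e₁, he₁⟩ := exists_orthonormal_frame (ha.injective _ hp.2.1)
  obtain ⟨e₂, he₂⟩ := exists_orthonormal_frame (hb.injective _ hp.2.2)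
  rw [traceHessian_eq_sum (orthonormal_warpFrame h ha hb hp he₀ he₁ he₂) (card_warpFrame h),
    traceHessian_eq_sum he₁ (Fintype.card_fin _), traceHessian_eq_sum he₂ (Fintype.card_fin _)]
  have hD := fderiv_fderiv_warp (h.contDiffAt_fst _ hp.1) (h.contDiffAt_snd _ hp.1)
    (ha.contDiffAt hp.2.1) (hb.contDiffAt hp.2.2)
  have t₀ : ∀ k, fderiv ℝ (fderiv ℝ (warp Γ₀ Γ₁ a b)) p (warpFrame p Γ₀ Γ₁ e₀ e₁ e₂ (Sum.inl k))
      (warpFrame p Γ₀ Γ₁ e₀ e₁ e₂ (Sum.inl k)) =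
      pairL (fderiv ℝ (fderiv ℝ Γ₀) p.1 e₀ e₀ • a p.2.1,
        fderiv ℝ (fderiv ℝ Γ₁) p.1 e₀ e₀ • b p.2.2) := fun k => by
    rw [hD]
    simp only [warpFrame, map_zero, smul_zero, zero_add]
  have t₁ : ∀ k, fderiv ℝ (fderiv ℝ (warp Γ₀ Γ₁ a b)) p
      (warpFrame p Γ₀ Γ₁ e₀ e₁ e₂ (Sum.inr (Sum.inl k)))
      (warpFrame p Γ₀ Γ₁ e₀ e₁ e₂ (Sum.inr (Sum.inl k))) =
      pairL (((‖Γ₀ p.1‖ ^ 2)⁻¹ • Γ₀ p.1) • fderiv ℝ (fderiv ℝ a) p.2.1 (e₁ k) (e₁ k), 0) :=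
    fun k => by
    rw [hD]
    simp only [warpFrame, map_zero, smul_zero, add_zero, zero_smul, map_smul, smul_apply]
    rw [smul_smul, ← mul_inv, ← sq, smul_assoc, smul_comm]
  have t₂ : ∀ k, fderiv ℝ (fderiv ℝ (warp Γ₀ Γ₁ a b)) p
      (warpFrame p Γ₀ Γ₁ e₀ e₁ e₂ (Sum.inr (Sum.inr k)))
      (warpFrame p Γ₀ Γ₁ e₀ e₁ e₂ (Sum.inr (Sum.inr k))) =
      pairL (0, ((‖Γ₁ p.1‖ ^ 2)⁻¹ • Γ₁ p.1) • fderiv ℝ (fderiv ℝ b) p.2.2 (e₂ k) (e₂ k)) :=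
    fun k => by
    rw [hD]
    simp only [warpFrame, map_zero, smul_zero, add_zero, zero_smul, map_smul, smul_apply]
    rw [smul_smul, ← mul_inv, ← sq, smul_assoc, smul_comm]
  simp only [Fintype.sum_sum_type, t₀, t₁, t₂, ← map_sum, Finset.univ_unique, Finset.sum_singleton]
  rw [← map_add, ← map_add]
  congr 1
  refine Prod.ext ?_ ?_
  · simp [Prod.fst_sum, Finset.smul_sum, add_comm]
  · simp [Prod.snd_sum, Finset.smul_sum, add_comm]

/-- The mean curvature vector of the join. -/
theorem meanCurvature_warp
    (h : IsWarpCurve (Module.finrank ℝ E₁) (Module.finrank ℝ E₂) Γ₀ Γ₁ U₀)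
    (ha : IsLegendrianOn a U₁) (hb : IsLegendrianOn b U₂) (hp : p ∈ U₀ ×ˢ U₁ ×ˢ U₂) :
    meanCurvature sphTangent (warp Γ₀ Γ₁ a b) p =
      (Module.finrank ℝ (E₀ × E₁ × E₂) : ℝ)⁻¹ •
        pairL (((Module.finrank ℝ E₁ / ‖Γ₀ p.1‖ ^ 2) • Γ₀ p.1) • meanCurvature sphTangent a p.2.1,
          ((Module.finrank ℝ E₂ / ‖Γ₁ p.1‖ ^ 2) • Γ₁ p.1) • meanCurvature sphTangent b p.2.2) := by
  have hw := h.isLegendrianOn_warp ha hb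
  obtain ⟨e₀, he₀⟩ := h.exists_unit hp.1
  have k₀ : ‖Γ₀ p.1‖ ≠ 0 := norm_ne_zero_iff.2 (h.fst_ne_zero _ hp.1)
  have k₁ : ‖Γ₁ p.1‖ ≠ 0 := norm_ne_zero_iff.2 (h.snd_ne_zero _ hp.1)
  have za := ha.norm_eq _ hp.2.1
  have zb := hb.norm_eq _ hp.2.2
  have ca : (inner ℂ (a p.2.1) (meanCurvature sphTangent a p.2.1) : ℂ) = (0 : ℝ) := by
    rw [ha.complex_inner_meanCurvature hp.2.1, Complex.ofReal_zero]
  have cb : (inner ℂ (b p.2.2) (meanCurvature sphTangent b p.2.2) : ℂ) = (0 : ℝ) := by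
    rw [hb.complex_inner_meanCurvature hp.2.2, Complex.ofReal_zero]
  -- pairing of the right-hand side with vectors of the form of `dφ v` and `i dφ v`
  have key : ∀ (y : EuclideanSpace ℂ ι₁) (y' : EuclideanSpace ℂ ι₂) (d d' : ℂ),
      (inner ℂ (a p.2.1) y : ℂ) = 0 → (inner ℂ (b p.2.2) y' : ℂ) = 0 →
      inner ℝ (pairL (((Module.finrank ℝ E₁ / ‖Γ₀ p.1‖ ^ 2) • Γ₀ p.1) •
          meanCurvature sphTangent a p.2.1, ((Module.finrank ℝ E₂ / ‖Γ₁ p.1‖ ^ 2) • Γ₁ p.1) •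
          meanCurvature sphTangent b p.2.2))
        (pairL (Γ₀ p.1 • y + d • a p.2.1, Γ₁ p.1 • y' + d' • b p.2.2)) =
      Module.finrank ℝ E₁ * inner ℝ (meanCurvature sphTangent a p.2.1) y +
        Module.finrank ℝ E₂ * inner ℝ (meanCurvature sphTangent b p.2.2) y' := by
    intro y y' d d' hy hy'
    have t₁ := inner_smul_add_smul za ca hy (Module.finrank ℝ E₁ / ‖Γ₀ p.1‖ ^ 2) (Γ₀ p.1) 0 d
    have t₂ := inner_smul_add_smul zb cb hy' (Module.finrank ℝ E₂ / ‖Γ₁ p.1‖ ^ 2) (Γ₁ p.1) 0 d'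
    rw [zero_smul, add_zero] at t₁ t₂
    rw [inner_pairL, t₁, t₂, inner_zero_left, inner_zero_left]
    field_simp
    ring
  refine meanCurvature_eq (mem_sphTangent.2 ?_) (fun v => ?_) fun m hm₁ hm₂ => ?_
  · have := key 0 0 (Γ₀ p.1) (Γ₁ p.1) (inner_zero_right _) (inner_zero_right _)
    simp only [smul_zero, zero_add, inner_zero_right, mul_zero, add_zero] at this
    rw [real_inner_smul_right, real_inner_comm, warp, this, mul_zero]
  · rw [fderiv_warp h ha hb hp, real_inner_smul_right, real_inner_comm,
      key _ _ _ _ (ha.complex_inner_fderiv hp.2.1 _) (hb.complex_inner_fderiv hp.2.2 _),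
      real_inner_comm, inner_fderiv_meanCurvature, real_inner_comm, inner_fderiv_meanCurvature]
    ring
  -- Normal vectors are combinations of iφ and i dφ v. The first pairs to zero on both sides; for
  -- the second, the factor parts match and the curve parts cancel by `critical`.
  · obtain ⟨c, v, rfl⟩ := hw.exists_eq_of_normal hp (mem_sphTangent.1 hm₁) hm₂
    rw [inner_add_right, inner_add_right, real_inner_smul_right, real_inner_smul_right,
      hw.inner_traceHessian_I hp, real_inner_smul_left, real_inner_smul_left, I_smul_warp,
      key _ _ _ _ (inner_zero_right _) (inner_zero_right _), I_smul_fderiv_warp h ha hb hp,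
      key _ _ _ _ (ha.complex_inner_I_fderiv hp.2.1 _) (hb.complex_inner_I_fderiv hp.2.2 _),
      traceHessian_warp h ha hb hp he₀, inner_pairL,
      inner_smul_add_smul za (ha.complex_inner_traceHessian hp.2.1)
        (ha.complex_inner_I_fderiv hp.2.1 _),
      inner_smul_add_smul zb (hb.complex_inner_traceHessian hp.2.2)
        (hb.complex_inner_I_fderiv hp.2.2 _), ha.finrank_mul_inner_meanCurvature hp.2.1,
      hb.finrank_mul_inner_meanCurvature hp.2.2, inner_zero_right, inner_zero_right]
    have hcrit := h.critical _ hp.1 e₀ he₀ v.1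
    rw [inv_mul_cancel₀ (pow_ne_zero 2 k₀), inv_mul_cancel₀ (pow_ne_zero 2 k₁)]
    simp only [div_eq_mul_inv] at hcrit
    linear_combination (-(Module.finrank ℝ (E₀ × E₁ × E₂) : ℝ)⁻¹) * hcrit

theorem meanCurvature_warp_eq_zero_iff
    (h : IsWarpCurve (Module.finrank ℝ E₁) (Module.finrank ℝ E₂) Γ₀ Γ₁ U₀)
    (ha : IsLegendrianOn a U₁) (hb : IsLegendrianOn b U₂) (hp : p ∈ U₀ ×ˢ U₁ ×ˢ U₂) :
    meanCurvature sphTangent (warp Γ₀ Γ₁ a b) p = 0 ↔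
      meanCurvature sphTangent a p.2.1 = 0 ∧ meanCurvature sphTangent b p.2.2 = 0 := by
  have k₀ : ‖Γ₀ p.1‖ ≠ 0 := norm_ne_zero_iff.2 (h.fst_ne_zero _ hp.1)
  have k₁ : ‖Γ₁ p.1‖ ≠ 0 := norm_ne_zero_iff.2 (h.snd_ne_zero _ hp.1)
  rw [meanCurvature_warp h ha hb hp]
  constructor
  · intro h0
    have hN : (Module.finrank ℝ (E₀ × E₁ × E₂) : ℝ)⁻¹ ≠ 0 := by
      rw [Module.finrank_prod, h.finrank_eq_one]
      positivity
    rw [smul_eq_zero_iff_right hN] at h0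
    have h1 := inner_pairL (ι₁ := ι₁) (ι₂ := ι₂) (_, _) (_, _) |>.symm.trans
      (inner_self_eq_zero.2 h0)
    simp only [real_inner_self_eq_norm_sq] at h1
    rw [add_eq_zero_iff_of_nonneg (sq_nonneg _) (sq_nonneg _), pow_eq_zero_iff two_ne_zero,
      pow_eq_zero_iff two_ne_zero, norm_eq_zero, norm_eq_zero, smul_eq_zero, smul_eq_zero,
      smul_eq_zero, smul_eq_zero] at h1
    constructor
    -- A point factor has coefficient 0 and gives no information, but its mean curvature is 0 by the
    -- convention 0⁻¹ = 0.
    · by_cases hE : Module.finrank ℝ E₁ = 0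
      · exact meanCurvature_eq_zero_of_finrank _ _ _ hE
      · rcases h1.1 with (h2 | h2) | h2
        · rw [div_eq_zero_iff] at h2
          simp [hE, k₀] at h2
        · exact absurd h2 (h.fst_ne_zero _ hp.1)
        · exact h2
    · by_cases hE : Module.finrank ℝ E₂ = 0
      · exact meanCurvature_eq_zero_of_finrank _ _ _ hE
      · rcases h1.2 with (h2 | h2) | h2
        · rw [div_eq_zero_iff] at h2
          simp [hE, k₁] at h2
        · exact absurd h2 (h.snd_ne_zero _ hp.1)
        · exact h2
  · rintro ⟨h1, h2⟩
    rw [h1, h2, smul_zero, smul_zero, Prod.mk_zero_zero, map_zero, smul_zero]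

theorem inner_smul_smul_self {ι : Type*} [Fintype ι] (c : ℂ) (x y : EuclideanSpace ℂ ι) :
    inner ℝ (c • x) (c • y) = ‖c‖ ^ 2 * inner ℝ x y := by
  rw [inner_smul_smul, Complex.conj_mul', real_inner_eq_re, ← Complex.ofReal_pow,
    Complex.re_ofReal_mul]

/-- The divergence of `JH` for the join. -/
theorem divJH_warp
    (h : IsWarpCurve (Module.finrank ℝ E₁) (Module.finrank ℝ E₂) Γ₀ Γ₁ U₀)
    (ha : IsLegendrianOn a U₁) (hb : IsLegendrianOn b U₂) (hp : p ∈ U₀ ×ˢ U₁ ×ˢ U₂) :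
    divJH sphTangent sphJ (warp Γ₀ Γ₁ a b) p = (Module.finrank ℝ (E₀ × E₁ × E₂) : ℝ)⁻¹ *
      (Module.finrank ℝ E₁ / ‖Γ₀ p.1‖ ^ 2 * divJH sphTangent sphJ a p.2.1 +
        Module.finrank ℝ E₂ / ‖Γ₁ p.1‖ ^ 2 * divJH sphTangent sphJ b p.2.2) := by
  obtain ⟨e₀, he₀⟩ := h.exists_unit hp.1
  obtain ⟨e₁, he₁⟩ := exists_orthonormal_frame (ha.injective _ hp.2.1)
  obtain ⟨e₂, he₂⟩ := exists_orthonormal_frame (hb.injective _ hp.2.2)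
  have k₀ : ‖Γ₀ p.1‖ ≠ 0 := norm_ne_zero_iff.2 (h.fst_ne_zero _ hp.1)
  have k₁ : ‖Γ₁ p.1‖ ≠ 0 := norm_ne_zero_iff.2 (h.snd_ne_zero _ hp.1)
  let N : ℝ := (Module.finrank ℝ (E₀ × E₁ × E₂) : ℝ)⁻¹
  let C₀ : E₀ → ℂ := fun x => (N * (Module.finrank ℝ E₁ / ‖Γ₀ x‖ ^ 2)) • Γ₀ x
  let C₁ : E₀ → ℂ := fun x => (N * (Module.finrank ℝ E₂ / ‖Γ₁ x‖ ^ 2)) • Γ₁ x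
  let X : E₁ → EuclideanSpace ℂ ι₁ := fun y => Complex.I • meanCurvature sphTangent a y
  let Y : E₂ → EuclideanSpace ℂ ι₂ := fun y => Complex.I • meanCurvature sphTangent b y
  -- JH is again a join, of the fields iH₁ and iH₂ along a curve rescaled by real functions, so the
  -- derivative formula for joins applies.
  have hev : (fun q => sphJ (warp Γ₀ Γ₁ a b q) (meanCurvature sphTangent (warp Γ₀ Γ₁ a b) q))
      =ᶠ[nhds p] warp C₀ C₁ X Y := by
    refine Filter.eventually_of_mem ((h.isLegendrianOn_warp ha hb).isOpen.mem_nhds hp) fun q hq => ?_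
    simp only [sphJ]
    rw [meanCurvature_warp h ha hb hq, smul_comm, smul_pairL, ← map_smul]
    simp only [warp, C₀, C₁, X, Y, N, Prod.smul_mk, smul_assoc, mul_smul,
      smul_comm _ Complex.I (_ : EuclideanSpace ℂ _)]
  have d₀ : DifferentiableAt ℝ C₀ p.1 := by
    have hd := (h.contDiffAt_fst _ hp.1).differentiableAt (by simp)
    have hn : DifferentiableAt ℝ (fun x => ‖Γ₀ x‖ ^ 2) p.1 := hd.norm_sq ℝ
    have hq : DifferentiableAt ℝ (fun x => N * (Module.finrank ℝ E₁ / ‖Γ₀ x‖ ^ 2)) p.1 := by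
      refine DifferentiableAt.const_mul ?_ N
      simp only [div_eq_mul_inv]
      exact (hn.inv (pow_ne_zero 2 k₀)).const_mul _
    exact hq.smul hd
  have d₁ : DifferentiableAt ℝ C₁ p.1 := by
    have hd := (h.contDiffAt_snd _ hp.1).differentiableAt (by simp)
    have hn : DifferentiableAt ℝ (fun x => ‖Γ₁ x‖ ^ 2) p.1 := hd.norm_sq ℝ
    have hq : DifferentiableAt ℝ (fun x => N * (Module.finrank ℝ E₂ / ‖Γ₁ x‖ ^ 2)) p.1 := by
      refine DifferentiableAt.const_mul ?_ N
      simp only [div_eq_mul_inv]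
      exact (hn.inv (pow_ne_zero 2 k₁)).const_mul _
    exact hq.smul hd
  have dX : ∀ v, fderiv ℝ (warp C₀ C₁ X Y) p v =
      pairL (C₀ p.1 • fderiv ℝ X p.2.1 v.2.1 + fderiv ℝ C₀ p.1 v.1 • X p.2.1,
        C₁ p.1 • fderiv ℝ Y p.2.2 v.2.2 + fderiv ℝ C₁ p.1 v.1 • Y p.2.2) :=
    (differentiableAt_warp (p := p) d₀ d₁
      ((ha.differentiableAt_meanCurvature hp.2.1).fun_const_smul Complex.I)
      ((hb.differentiableAt_meanCurvature hp.2.2).fun_const_smul Complex.I)).2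
  have ca : (inner ℂ (X p.2.1) (a p.2.1) : ℂ) = 0 := by
    rw [← inner_conj_symm, inner_smul_right, ha.complex_inner_meanCurvature hp.2.1, mul_zero, map_zero]
  have cb : (inner ℂ (Y p.2.2) (b p.2.2) : ℂ) = 0 := by
    rw [← inner_conj_symm, inner_smul_right, hb.complex_inner_meanCurvature hp.2.2, mul_zero, map_zero]
  -- In the curve direction the derivative of JH is a complex combination of iH₁ and iH₂, while that
  -- of φ is one of a and b. These are Hermitian-orthogonal.
  have t₀ : ∀ k, inner ℝ (fderiv ℝ (warp C₀ C₁ X Y) p (warpFrame p Γ₀ Γ₁ e₀ e₁ e₂ (Sum.inl k)))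
      (fderiv ℝ (warp Γ₀ Γ₁ a b) p (warpFrame p Γ₀ Γ₁ e₀ e₁ e₂ (Sum.inl k))) = 0 := fun k => by
    rw [dX, fderiv_warp h ha hb hp, inner_pairL]
    simp only [warpFrame, map_zero, smul_zero, zero_add, inner_smul_smul, ca, cb, mul_zero,
      Complex.zero_re]
  -- The scaling |Γ₀|⁻² from the frame cancels |Γ₀|² from the metric.
  have t₁ : ∀ k, inner ℝ
      (fderiv ℝ (warp C₀ C₁ X Y) p (warpFrame p Γ₀ Γ₁ e₀ e₁ e₂ (Sum.inr (Sum.inl k))))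
      (fderiv ℝ (warp Γ₀ Γ₁ a b) p (warpFrame p Γ₀ Γ₁ e₀ e₁ e₂ (Sum.inr (Sum.inl k)))) =
      N * (Module.finrank ℝ E₁ / ‖Γ₀ p.1‖ ^ 2) *
        inner ℝ (fderiv ℝ X p.2.1 (e₁ k)) (fderiv ℝ a p.2.1 (e₁ k)) := fun k => by
    rw [dX, fderiv_warp h ha hb hp, inner_pairL]
    simp only [warpFrame, map_zero, map_smul, smul_zero, zero_smul, add_zero, inner_zero_left, C₀]
    rw [smul_assoc, real_inner_smul_left, inner_smul_smul_self, real_inner_smul_left,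
      real_inner_smul_right]
    field_simp
  have t₂ : ∀ k, inner ℝ
      (fderiv ℝ (warp C₀ C₁ X Y) p (warpFrame p Γ₀ Γ₁ e₀ e₁ e₂ (Sum.inr (Sum.inr k))))
      (fderiv ℝ (warp Γ₀ Γ₁ a b) p (warpFrame p Γ₀ Γ₁ e₀ e₁ e₂ (Sum.inr (Sum.inr k)))) =
      N * (Module.finrank ℝ E₂ / ‖Γ₁ p.1‖ ^ 2) *
        inner ℝ (fderiv ℝ Y p.2.2 (e₂ k)) (fderiv ℝ b p.2.2 (e₂ k)) := fun k => by
    rw [dX, fderiv_warp h ha hb hp, inner_pairL]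
    simp only [warpFrame, map_zero, map_smul, smul_zero, zero_smul, add_zero, inner_zero_left, C₁,
      zero_add]
    rw [smul_assoc, real_inner_smul_left, inner_smul_smul_self, real_inner_smul_left,
      real_inner_smul_right]
    field_simp
  rw [divJH, divergence_eq_sum (orthonormal_warpFrame h ha hb hp he₀ he₁ he₂) (card_warpFrame h),
    hev.fderiv_eq, divJH, divergence_eq_sum he₁ (Fintype.card_fin _), divJH,
    divergence_eq_sum he₂ (Fintype.card_fin _)]
  simp only [Fintype.sum_sum_type, t₀, t₁, t₂, Finset.sum_const_zero, zero_add, ← Finset.mul_sum]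
  rw [mul_add, ← mul_assoc, ← mul_assoc]
  rfl

end Warp

/-! ### From manifolds to charts -/

section LocalRep

variable {E H M F : Type*} [NormedAddCommGroup E] [NormedSpace ℝ E] [TopologicalSpace H]
  {I : ModelWithCorners ℝ E H} [TopologicalSpace M] [ChartedSpace H M]
  [NormedAddCommGroup F] [InnerProductSpace ℝ F] {f : M → F} {p : M}

theorem contDiffOn_localRep [IsManifold I ∞ M] (hf : ContMDiff I 𝓘(ℝ, F) ∞ f) :
    ContDiffOn ℝ ∞ (localRep I f p) (extChartAt I p).target :=
  (hf.comp_contMDiffOn (contMDiffOn_extChartAt_symm p)).contDiffOn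

variable [I.Boundaryless]

theorem differential_eq_fderiv (hf : MDifferentiableAt I 𝓘(ℝ, F) f p) :
    differential I f p = fderiv ℝ (localRep I f p) (extChartAt I p p) := by
  have h := hf.mfderiv
  rw [I.range_eq_univ, fderivWithin_univ] at h
  exact h

/-- L is the differential of the inverse chart. It carries injectivity and the Legendrian condition
to every point of the chart domain, not just its centre. -/
theorem fderiv_localRep [IsManifold I ∞ M] (hf : ContMDiff I 𝓘(ℝ, F) ∞ f) {y : E} (hy : y ∈ (extChartAt I p).target) :
    ∃ L : E →L[ℝ] TangentSpace I ((extChartAt I p).symm y), Function.Injective L ∧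
      ∀ v, fderiv ℝ (localRep I f p) y v = differential I f ((extChartAt I p).symm y) (L v) := by
  have : IsManifold I 1 M := IsManifold.of_le (n := ∞) (by simp)
  have hinv := isInvertible_mfderivWithin_extChartAt_symm hy
  rw [I.range_eq_univ, mfderivWithin_univ] at hinv
  refine ⟨mfderiv 𝓘(ℝ, E) I (extChartAt I p).symm y, hinv.injective, fun v => ?_⟩
  have h₁ : MDifferentiableAt 𝓘(ℝ, E) I (extChartAt I p).symm y :=
    ((contMDiffOn_extChartAt_symm (n := ∞) p).contMDiffAt
      ((isOpen_extChartAt_target p).mem_nhds hy)).mdifferentiableAt (by simp)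
  exact (congrArg (fun L : E →L[ℝ] F => L v) mfderiv_eq_fderiv.symm).trans
    (mfderiv_comp_apply y ((hf _).mdifferentiableAt (by simp)) h₁ v)

theorem IsLegendrian.isLegendrianOn {E H M : Type*} [NormedAddCommGroup E] [NormedSpace ℝ E]
    [FiniteDimensional ℝ E] [TopologicalSpace H] {I : ModelWithCorners ℝ E H} [I.Boundaryless]
    [TopologicalSpace M] [ChartedSpace H M] [IsManifold I ∞ M] {ι : Type*} [Fintype ι]
    {ψ : M → Sph ι} (h : IsLegendrian I ψ) (p : M) :
    IsLegendrianOn (localRep I (sphCoe ψ) p) (extChartAt I p).target where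
  isOpen := isOpen_extChartAt_target p
  contDiffOn := contDiffOn_localRep h.2.1.1
  norm_eq := fun x _ => by simp [localRep, sphCoe]
  injective := fun x hx => by
    obtain ⟨L, hL, hv⟩ := fderiv_localRep h.2.1.1 hx
    intro v w hvw
    rw [hv, hv] at hvw
    exact hL (h.2.1.2 _ hvw)
  inner_I := fun x hx v => by
    obtain ⟨L, hL, hv⟩ := fderiv_localRep h.2.1.1 hx
    rw [hv]
    exact h.2.2 _ _
  finrank_add_one := h.1

end LocalRep

/-! ### A local angle on the circle -/

section Circle

attribute [local instance] finrank_real_complex_fact'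

theorem isImmersion_coe_circle : IsImmersion (𝓡 1) (fun z : Circle => (z : ℂ)) :=
  ⟨contMDiff_coe_sphere, fun z => injective_mvfderiv_subtypeVal_sphere (E := ℂ) (n := 1) z⟩

end Circle

/-- The determination of the angle of a point of the circle which is smooth around `z₀`. -/
def angleNear (z₀ : Circle) (w : ℂ) : ℝ := Complex.arg z₀ + (Complex.log (w / z₀)).im

/-- This holds across the branch cut too; only smoothness of the angle is restricted to a
neighbourhood of z₀. -/
theorem exp_angleNear (z₀ z : Circle) : Circle.exp (angleNear z₀ z) = z := by
  have h : (Complex.log ((z : ℂ) / z₀)).im = Complex.arg ((z / z₀ : Circle) : ℂ) := by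
    rw [Complex.log_im, Circle.coe_div]
  rw [angleNear, h, Circle.exp_add, Circle.exp_arg, Circle.exp_arg, mul_div_cancel]

theorem contDiffAt_angleNear {z₀ : Circle} {w : ℂ} (hw : w / z₀ ∈ Complex.slitPlane) :
    ContDiffAt ℝ ∞ (angleNear z₀) w := by
  have h₁ : ContDiffAt ℝ ∞ (fun w : ℂ => w / z₀) w := contDiffAt_id.div_const _
  have h₂ := ((Complex.contDiffAt_log (n := ∞) hw).restrict_scalars ℝ).comp w h₁
  exact contDiffAt_const.add (Complex.imCLM.contDiff.contDiffAt.comp w h₂)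

/-- The angle is an immersed coordinate in the preferred chart: the inclusion in ℂ is exp(iτ), so dτ
v = 0 forces its differential to kill v, and the inclusion is an immersion. -/
theorem exists_angle_coordinate (z₀ : Circle) :
    ∃ U : Set (EuclideanSpace ℝ (Fin 1)), IsOpen U ∧ extChartAt (𝓡 1) z₀ z₀ ∈ U ∧
      ∀ x ∈ U, ContDiffAt ℝ ∞ (localRep (𝓡 1) (fun z : Circle => angleNear z₀ z) z₀) x ∧
        ∀ v, fderiv ℝ (localRep (𝓡 1) (fun z : Circle => angleNear z₀ z) z₀) x v = 0 → v = 0 := by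
  have : IsManifold (𝓡 1) ∞ Circle := IsManifold.of_le (n := ω) le_top
  set c := localRep (𝓡 1) (fun z : Circle => (z : ℂ)) z₀ with hc
  set τ := localRep (𝓡 1) (fun z : Circle => angleNear z₀ z) z₀ with hτdef
  have hcd : ContDiffOn ℝ ∞ c (extChartAt (𝓡 1) z₀).target :=
    contDiffOn_localRep isImmersion_coe_circle.1
  have hopen := isOpen_extChartAt_target (I := 𝓡 1) z₀
  have hU : IsOpen ((extChartAt (𝓡 1) z₀).target ∩ (fun x => c x / z₀) ⁻¹' Complex.slitPlane) :=
    (hcd.continuousOn.div_const _).isOpen_inter_preimage hopen Complex.isOpen_slitPlane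
  refine ⟨_, hU, ⟨mem_extChartAt_target z₀, ?_⟩, fun x hx => ?_⟩
  · simp [hc, localRep]
  have hcx : ContDiffAt ℝ ∞ c x := hcd.contDiffAt (hopen.mem_nhds hx.1)
  have hτ : ContDiffAt ℝ ∞ τ x := (contDiffAt_angleNear hx.2).comp x hcx
  refine ⟨hτ, fun v hv => ?_⟩
  have hexp : c = fun y => Complex.exp ((τ y : ℂ) * Complex.I) := by
    ext y
    rw [← Circle.coe_exp]
    exact congrArg (fun z : Circle => (z : ℂ)) (exp_angleNear z₀ ((extChartAt (𝓡 1) z₀).symm y)).symm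
  have hτ' := (hτ.differentiableAt (by simp)).hasFDerivAt
  have hd := ((Complex.ofRealCLM.hasFDerivAt.comp x hτ').mul_const Complex.I).cexp
  obtain ⟨L, hL, hLv⟩ := fderiv_localRep (I := 𝓡 1) isImmersion_coe_circle.1 hx.1
  refine hL (isImmersion_coe_circle.2 _ ?_)
  rw [← hLv, map_zero, map_zero]
  change fderiv ℝ c x v = 0
  rw [hexp]
  exact (congrArg (fun L : EuclideanSpace ℝ (Fin 1) →L[ℝ] ℂ => L v) hd.fderiv).trans (by simp [hv])

/-! ### Reparametrizations of γ_θ -/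

section Curve

variable {n₁ n₂ : ℕ} {g₀ g₁ : ℝ → ℂ} {E₀ : Type*} [NormedAddCommGroup E₀] [NormedSpace ℝ E₀]
  {τ : E₀ → ℝ} {x : E₀}

theorem fderiv_comp_real {g : ℝ → ℂ} (hg : DifferentiableAt ℝ g (τ x))
    (hτ : DifferentiableAt ℝ τ x) (v : E₀) :
    fderiv ℝ (fun y => g (τ y)) x v = fderiv ℝ τ x v • deriv g (τ x) := by
  have h := hg.hasDerivAt.hasFDerivAt.comp x hτ.hasFDerivAt
  have h' : fderiv ℝ (fun y => g (τ y)) x = _ := h.fderiv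
  rw [h']
  simp

theorem fderiv_fderiv_comp_real {g : ℝ → ℂ} (hg : ContDiff ℝ ∞ g) (hτ : ContDiffAt ℝ ∞ τ x)
    (v w : E₀) : fderiv ℝ (fderiv ℝ fun y => g (τ y)) x v w =
      fderiv ℝ (fderiv ℝ τ) x v w • deriv g (τ x) +
        (fderiv ℝ τ x v * fderiv ℝ τ x w) • deriv (deriv g) (τ x) := by
  have hd : DifferentiableAt ℝ (fderiv ℝ fun y => g (τ y)) x :=
    differentiableAt_fderiv_of_contDiffAt (hg.contDiffAt.comp x hτ)
  have hev : (fun y => fderiv ℝ (fun y => g (τ y)) y w) =ᶠ[nhds x]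
      fun y => fderiv ℝ τ y w • deriv g (τ y) := by
    filter_upwards [eventually_differentiableAt hτ] with y hy
    exact fderiv_comp_real (hg.differentiable (by simp) _) hy w
  have hτ' := differentiableAt_fderiv_of_contDiffAt hτ
  have hg' : Differentiable ℝ (deriv g) := (contDiff_infty_iff_deriv.1 hg).2.differentiable (by simp)
  have hτx : DifferentiableAt ℝ τ x := hτ.differentiableAt (by simp)
  have h₁ : DifferentiableAt ℝ (fun y => fderiv ℝ τ y w) x :=
    hτ'.clm_apply (differentiableAt_const w)
  have h₂ : DifferentiableAt ℝ (fun y => deriv g (τ y)) x := (hg' _).comp x hτx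
  rw [← fderiv_fderiv_apply hd, hev.fderiv_eq, fderiv_fun_smul h₁ h₂]
  simp only [add_apply, smul_apply, ContinuousLinearMap.smulRight_apply]
  rw [fderiv_comp_real (hg' _) hτx, fderiv_fderiv_apply hτ', smul_smul, add_comm, mul_comm]

theorem IsGammaFlow.isWarpCurve (h : IsGammaFlow n₁ n₂ g₀ g₁) {U : Set E₀} (hU : IsOpen U)
    (hτ : ∀ x ∈ U, ContDiffAt ℝ ∞ τ x) (hinj : ∀ x ∈ U, ∀ v, fderiv ℝ τ x v = 0 → v = 0)
    (hE₀ : Module.finrank ℝ E₀ = 1) :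
    IsWarpCurve n₁ n₂ (fun x => g₀ (τ x)) (fun x => g₁ (τ x)) U := by
  have hd₀ := h.contDiff.1
  have hd₁ := h.contDiff.2
  have f₀ : ∀ x ∈ U, ∀ v, fderiv ℝ (fun x => g₀ (τ x)) x v = fderiv ℝ τ x v • deriv g₀ (τ x) :=
    fun x hx => fderiv_comp_real (hd₀.differentiable (by simp) _)
      ((hτ x hx).differentiableAt (by simp))
  have f₁ : ∀ x ∈ U, ∀ v, fderiv ℝ (fun x => g₁ (τ x)) x v = fderiv ℝ τ x v • deriv g₁ (τ x) :=
    fun x hx => fderiv_comp_real (hd₁.differentiable (by simp) _)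
      ((hτ x hx).differentiableAt (by simp))
  refine ⟨hU, fun x hx => hd₀.contDiffAt.comp x (hτ x hx),
    fun x hx => hd₁.contDiffAt.comp x (hτ x hx), fun x _ => h.fst_ne_zero _,
    fun x _ => h.snd_ne_zero _, fun x _ => h.norm_sq_add _, fun x hx v => ?_,
    fun x hx v hv => ?_, fun x hx e he v => ?_, hE₀⟩
  · have key : ∀ z w : ℂ, inner ℝ w (Complex.I * z) = -inner ℝ z (Complex.I * w) := fun z w => by
      simp only [Complex.inner, Complex.mul_re, Complex.mul_im, Complex.conj_re, Complex.conj_im,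
        Complex.I_re, Complex.I_im]
      ring
    rw [f₀ x hx, f₁ x hx, real_inner_smul_left, real_inner_smul_left, key (g₀ _), key (g₁ _),
      (h.inner_I_mul_deriv _).1, (h.inner_I_mul_deriv _).2]
    ring
  · rw [f₀ x hx, smul_eq_zero] at hv
    exact hinj x hx v (hv.resolve_right (h.deriv_fst_ne_zero _))
  -- The second derivative of τ multiplies γ', which is orthogonal to iγ'. So the criticality
  -- condition does not depend on the parameter.
  · have hI : ∀ z : ℂ, inner ℝ z (Complex.I * z) = 0 := fun z => by
      simp only [Complex.inner, Complex.mul_re, Complex.mul_im, Complex.conj_re, Complex.conj_im,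
        Complex.I_re, Complex.I_im]
      ring
    rw [f₀ x hx, f₁ x hx, norm_smul, norm_smul, mul_pow, mul_pow, ← mul_add, Real.norm_eq_abs,
      sq_abs] at he
    rw [fderiv_fderiv_comp_real hd₀ (hτ x hx), fderiv_fderiv_comp_real hd₁ (hτ x hx), f₀ x hx,
      f₁ x hx]
    simp only [mul_smul_comm, real_inner_smul_right, inner_add_left, real_inner_smul_left, hI]
    have hcrit := h.inner_deriv_deriv (τ x)
    linear_combination (fderiv ℝ τ x e ^ 2 * fderiv ℝ τ x v) * hcrit + fderiv ℝ τ x v *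
      (n₁ / ‖g₀ (τ x)‖ ^ 2 * inner ℝ (g₀ (τ x)) (Complex.I * deriv g₀ (τ x)) +
        n₂ / ‖g₁ (τ x)‖ ^ 2 * inner ℝ (g₁ (τ x)) (Complex.I * deriv g₁ (τ x))) * he

end Curve

section Mean

variable {E ι : Type*} [NormedAddCommGroup E] [NormedSpace ℝ E] [FiniteDimensional ℝ E] [Fintype ι]
  {a : E → EuclideanSpace ℂ ι} {U : Set E} {x : E}

theorem IsLegendrianOn.meanCurvature_veronese_eq_zero_iff (h : IsLegendrianOn a U) (hx : x ∈ U) :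
    meanCurvature cpTangent (fun y => veronese (a y)) x = 0 ↔ meanCurvature sphTangent a x = 0 := by
  rw [h.meanCurvature_veronese hx]
  refine ⟨fun h0 => ?_, fun h0 => by rw [h0, map_zero]⟩
  have := inner_symProd_left (h.norm_eq x hx) (meanCurvature sphTangent a x)
    (h.complex_inner_meanCurvature hx)
  rwa [h0, inner_zero_left, eq_comm, inner_self_eq_zero] at this

end Mean

/-! ### Descent to the circle -/

section Periodic

variable {n₁ n₂ : ℕ} {N₁ N₂ : Type*}

/-- If γ₁/γ₂ agrees at s and t, the two lifts differ by the scalar γ₁(s)/γ₁(t), whatever the points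
p and q. -/
theorem hopf_phi_eq {γ : ℝ → Sph (Fin 2)} {s t : ℝ} (h₀ : comp γ 0 t ≠ 0)
    (h : comp γ 0 s * comp γ 1 t = comp γ 0 t * comp γ 1 s)
    (ψ₁ : N₁ → Sph (Fin (n₁ + 1))) (ψ₂ : N₂ → Sph (Fin (n₂ + 1))) (p : N₁) (q : N₂) :
    hopf (phi γ ψ₁ ψ₂ s p q) = hopf (phi γ ψ₁ ψ₂ t p q) := by
  refine (Projectivization.mk_eq_mk_iff' ..).2 ⟨comp γ 0 s / comp γ 0 t, ?_⟩
  rw [phi, phi, join_eq_pairL, join_eq_pairL, smul_pairL, Prod.smul_mk, smul_smul, smul_smul]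
  change pairL ((comp γ 0 s / comp γ 0 t * comp γ 0 t) • _,
    (comp γ 0 s / comp γ 0 t * comp γ 1 t) • _) = pairL (comp γ 0 s • _, comp γ 1 s • _)
  rw [div_mul_cancel₀ _ h₀, div_mul_eq_mul_div, h, mul_div_cancel_left₀ _ h₀]

theorem exists_descend {X Y Z : Type*} {A : ℝ} (hA : 0 < A) {F : ℝ → X → Y → Z}
    (hF : ∀ t p q, F (t + A) p q = F t p q) :
    ∃ Φ : Circle × X × Y → Z, ∀ t p q, Φ (Circle.exp (2 * Real.pi * t / A), p, q) = F t p q := by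
  -- The induced map evaluates F at the time given by the principal argument; any other time on the
  -- same point differs by an integer number of periods.
  refine ⟨fun m => F (A / (2 * Real.pi) * Complex.arg m.1) m.2.1 m.2.2, fun t p q => ?_⟩
  obtain ⟨k, hk⟩ := Circle.exp_eq_exp.1 (Circle.exp_arg (Circle.exp (2 * Real.pi * t / A)))
  have hper : Function.Periodic (fun t => F t p q) A := fun t => hF t p q
  have := hper.int_mul k t
  simp only at this ⊢
  rw [← this, hk]
  congr 1
  field_simp

variable {γ : ℝ → Sph (Fin 2)} {ψ₁ : N₁ → Sph (Fin (n₁ + 1))} {ψ₂ : N₂ → Sph (Fin (n₂ + 1))} {A : ℝ}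
  {Φ : Circle × N₁ × N₂ → CP (Fin (n₁ + 1) ⊕ Fin (n₂ + 1))}

theorem cpEmb_eq_veronese (hA : 0 < A)
    (hΦ : ∀ t p q, Φ (Circle.exp (2 * Real.pi * t / A), p, q) = hopf (phi γ ψ₁ ψ₂ t p q))
    (z₀ z : Circle) (p : N₁) (q : N₂) :
    cpEmb (Φ (z, p, q)) = veronese (pairL
      (comp γ 0 (A / (2 * Real.pi) * angleNear z₀ z) • sphCoe ψ₁ p,
        comp γ 1 (A / (2 * Real.pi) * angleNear z₀ z) • sphCoe ψ₂ q)) := by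
  have h := hΦ (A / (2 * Real.pi) * angleNear z₀ z) p q
  have h' : 2 * Real.pi * (A / (2 * Real.pi) * angleNear z₀ z) / A = angleNear z₀ z := by
    field_simp
  rw [h', exp_angleNear] at h
  rw [h, cpEmb_hopf, phi, join_eq_pairL]
  rfl

theorem contDiff_veronese_pairL {ι₁ ι₂ : Type*} [Fintype ι₁] [Fintype ι₂] :
    ContDiff ℝ ∞ fun w : (ℂ × ℂ) × (EuclideanSpace ℂ ι₁ × EuclideanSpace ℂ ι₂) =>
      veronese (pairL (w.1.1 • w.2.1, w.1.2 • w.2.2)) := by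
  have h₁ : ContDiff ℝ ∞ fun w : (ℂ × ℂ) × (EuclideanSpace ℂ ι₁ × EuclideanSpace ℂ ι₂) =>
      w.1.1 • w.2.1 := by fun_prop
  have h₂ : ContDiff ℝ ∞ fun w : (ℂ × ℂ) × (EuclideanSpace ℂ ι₁ × EuclideanSpace ℂ ι₂) =>
      w.1.2 • w.2.2 := by fun_prop
  have h := pairL.contDiff.comp (h₁.prodMk h₂)
  exact contDiff_veronese.comp h

end Periodic

/-! ### Local expressions of Φ and the conclusion -/

section Main

variable {n₁ n₂ : ℕ} {γ : ℝ → Sph (Fin 2)} {N₁ N₂ : Type*}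
  [TopologicalSpace N₁] [ChartedSpace (EuclideanSpace ℝ (Fin n₁)) N₁]
  [TopologicalSpace N₂] [ChartedSpace (EuclideanSpace ℝ (Fin n₂)) N₂]
  {ψ₁ : N₁ → Sph (Fin (n₁ + 1))} {ψ₂ : N₂ → Sph (Fin (n₂ + 1))} {A : ℝ}
  {Φ : Circle × N₁ × N₂ → CP (Fin (n₁ + 1) ⊕ Fin (n₂ + 1))}

theorem contMDiff_cpEmb (hγ : IsGammaFlow n₁ n₂ (comp γ 0) (comp γ 1)) (hA : 0 < A)
    (hΦ : ∀ t p q, Φ (Circle.exp (2 * Real.pi * t / A), p, q) = hopf (phi γ ψ₁ ψ₂ t p q))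
    (h₁ : IsImmersion (𝓡 n₁) (sphCoe ψ₁)) (h₂ : IsImmersion (𝓡 n₂) (sphCoe ψ₂)) :
    ContMDiff ((𝓡 1).prod ((𝓡 n₁).prod (𝓡 n₂)))
      𝓘(ℝ, MatSpace (Fin (n₁ + 1) ⊕ Fin (n₂ + 1))) ∞ (cpEmb ∘ Φ) := by
  rintro ⟨z₀, p₀, q₀⟩
  have hang : ContMDiffAt (𝓡 1) 𝓘(ℝ, ℝ) ∞ (fun z : Circle => angleNear z₀ z) z₀ :=
    (contDiffAt_angleNear (by simp)).contMDiffAt.comp z₀ (isImmersion_coe_circle.1 z₀)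
  have hc : ∀ {g : ℝ → ℂ}, ContDiff ℝ ∞ g → ContMDiffAt (𝓡 1) 𝓘(ℝ, ℂ) ∞
      (fun z : Circle => g (A / (2 * Real.pi) * angleNear z₀ z)) z₀ := fun {g} hg =>
    (hg.comp (contDiff_const.mul contDiff_id)).contMDiff.contMDiffAt.comp z₀ hang
  have hz := (hc hγ.contDiff.1).prodMk_space (hc hγ.contDiff.2)
  have hz' := hz.comp (z₀, p₀, q₀) (contMDiffAt_fst (J := (𝓡 n₁).prod (𝓡 n₂)))
  have hp := (h₁.1 p₀).comp (p₀, q₀) (contMDiffAt_fst (J := 𝓡 n₂))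
  have hq := (h₂.1 q₀).comp (p₀, q₀) (contMDiffAt_snd (I := 𝓡 n₁))
  have hpq := (hp.prodMk_space hq).comp (z₀, p₀, q₀) (contMDiffAt_snd (I := 𝓡 1))
  have := contDiff_veronese_pairL.contMDiff.contMDiffAt.comp (z₀, p₀, q₀) (hz'.prodMk_space hpq)
  refine this.congr_of_eventuallyEq (Filter.Eventually.of_forall fun m => ?_)
  exact cpEmb_eq_veronese hA hΦ z₀ m.1 m.2.1 m.2.2

/-- The local expression uses the angle near m.1. By `exp_angleNear` the identity of functions holds
everywhere, while the properties of the curve are claimed only on U. -/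
theorem exists_isWarpCurve (hγ : IsGammaFlow n₁ n₂ (comp γ 0) (comp γ 1)) (hA : 0 < A)
    (hΦ : ∀ t p q, Φ (Circle.exp (2 * Real.pi * t / A), p, q) = hopf (phi γ ψ₁ ψ₂ t p q))
    (m : Circle × N₁ × N₂) :
    ∃ (Γ₀ Γ₁ : EuclideanSpace ℝ (Fin 1) → ℂ) (U : Set (EuclideanSpace ℝ (Fin 1))),
      extChartAt (𝓡 1) m.1 m.1 ∈ U ∧
      IsWarpCurve (Module.finrank ℝ (EuclideanSpace ℝ (Fin n₁)))
        (Module.finrank ℝ (EuclideanSpace ℝ (Fin n₂))) Γ₀ Γ₁ U ∧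
      localRep ((𝓡 1).prod ((𝓡 n₁).prod (𝓡 n₂))) (cpEmb ∘ Φ) m =
        fun x => veronese (warp Γ₀ Γ₁ (localRep (𝓡 n₁) (sphCoe ψ₁) m.2.1)
          (localRep (𝓡 n₂) (sphCoe ψ₂) m.2.2) x) := by
  obtain ⟨z₀, p₀, q₀⟩ := m
  obtain ⟨U, hU, hzU, h⟩ := exists_angle_coordinate z₀
  set ϑ := localRep (𝓡 1) (fun z : Circle => angleNear z₀ z) z₀ with hϑ
  have hc : A / (2 * Real.pi) ≠ 0 := by positivity
  have hW := hγ.isWarpCurve (τ := fun x => A / (2 * Real.pi) * ϑ x) hU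
    (fun x hx => contDiffAt_const.mul (h x hx).1) (fun x hx v hv => (h x hx).2 v (by
      rw [fderiv_const_mul ((h x hx).1.differentiableAt (by simp)), smul_apply, smul_eq_mul,
        mul_eq_zero] at hv
      exact hv.resolve_left hc)) finrank_euclideanSpace_fin
  refine ⟨fun x => comp γ 0 (A / (2 * Real.pi) * ϑ x), fun x => comp γ 1 (A / (2 * Real.pi) * ϑ x),
    U, hzU, ?_, ?_⟩
  · rw [finrank_euclideanSpace_fin, finrank_euclideanSpace_fin]
    exact hW
  · funext x
    rw [localRep, extChartAt_prod, extChartAt_prod]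
    exact cpEmb_eq_veronese hA hΦ z₀ _ _ _

variable [IsManifold (𝓡 n₁) ∞ N₁] [IsManifold (𝓡 n₂) ∞ N₂]

/-- The local expressions of `Φ` are the projections of joins of Legendrian immersions. -/
theorem exists_warp (hγ : IsGammaFlow n₁ n₂ (comp γ 0) (comp γ 1)) (hA : 0 < A)
    (hΦ : ∀ t p q, Φ (Circle.exp (2 * Real.pi * t / A), p, q) = hopf (phi γ ψ₁ ψ₂ t p q))
    (h₁ : IsLegendrian (𝓡 n₁) ψ₁) (h₂ : IsLegendrian (𝓡 n₂) ψ₂) (m : Circle × N₁ × N₂) :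
    ∃ (u : EuclideanSpace ℝ (Fin 1) × EuclideanSpace ℝ (Fin n₁) × EuclideanSpace ℝ (Fin n₂) →
        EuclideanSpace ℂ (Fin (n₁ + 1) ⊕ Fin (n₂ + 1))) (U : Set _) (c₁ c₂ : ℝ),
      IsLegendrianOn u U ∧
      extChartAt ((𝓡 1).prod ((𝓡 n₁).prod (𝓡 n₂))) m m ∈ U ∧
      localRep ((𝓡 1).prod ((𝓡 n₁).prod (𝓡 n₂))) (cpEmb ∘ Φ) m = (fun x => veronese (u x)) ∧
      divJH sphTangent sphJ u (extChartAt ((𝓡 1).prod ((𝓡 n₁).prod (𝓡 n₂))) m m) =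
        c₁ * divJH sphTangent sphJ (localRep (𝓡 n₁) (sphCoe ψ₁) m.2.1)
          (extChartAt (𝓡 n₁) m.2.1 m.2.1) +
        c₂ * divJH sphTangent sphJ (localRep (𝓡 n₂) (sphCoe ψ₂) m.2.2)
          (extChartAt (𝓡 n₂) m.2.2 m.2.2) ∧
      (meanCurvature sphTangent u (extChartAt ((𝓡 1).prod ((𝓡 n₁).prod (𝓡 n₂))) m m) = 0 ↔
        meanCurvature sphTangent (localRep (𝓡 n₁) (sphCoe ψ₁) m.2.1)
          (extChartAt (𝓡 n₁) m.2.1 m.2.1) = 0 ∧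
        meanCurvature sphTangent (localRep (𝓡 n₂) (sphCoe ψ₂) m.2.2)
          (extChartAt (𝓡 n₂) m.2.2 m.2.2) = 0) := by
  obtain ⟨Γ₀, Γ₁, U, hU, hW, hrep⟩ := exists_isWarpCurve hγ hA hΦ m
  have ha := h₁.isLegendrianOn m.2.1
  have hb := h₂.isLegendrianOn m.2.2
  have hx : extChartAt ((𝓡 1).prod ((𝓡 n₁).prod (𝓡 n₂))) m m =
      (extChartAt (𝓡 1) m.1 m.1, extChartAt (𝓡 n₁) m.2.1 m.2.1, extChartAt (𝓡 n₂) m.2.2 m.2.2) := by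
    rw [extChartAt_prod, extChartAt_prod]
    rfl
  rw [hx]
  have hmem : (extChartAt (𝓡 1) m.1 m.1, extChartAt (𝓡 n₁) m.2.1 m.2.1,
      extChartAt (𝓡 n₂) m.2.2 m.2.2) ∈
      U ×ˢ (extChartAt (𝓡 n₁) m.2.1).target ×ˢ (extChartAt (𝓡 n₂) m.2.2).target :=
    ⟨hU, mem_extChartAt_target _, mem_extChartAt_target _⟩
  have hdiv := divJH_warp hW ha hb hmem
  rw [mul_add, ← mul_assoc, ← mul_assoc] at hdiv
  exact ⟨_, _, _, _, hW.isLegendrianOn_warp ha hb, hmem, hrep, hdiv,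
    meanCurvature_warp_eq_zero_iff hW ha hb hmem⟩

theorem isHMinimalLagrangian_of_descend [Nonempty N₁] [Nonempty N₂]
    (hγ : IsGammaFlow n₁ n₂ (comp γ 0) (comp γ 1)) (hA : 0 < A)
    (hΦ : ∀ t p q, Φ (Circle.exp (2 * Real.pi * t / A), p, q) = hopf (phi γ ψ₁ ψ₂ t p q))
    (h₁ : IsCMinimalLegendrian (𝓡 n₁) ψ₁) (h₂ : IsCMinimalLegendrian (𝓡 n₂) ψ₂) :
    IsHMinimalLagrangian ((𝓡 1).prod ((𝓡 n₁).prod (𝓡 n₂))) Φ ∧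
      (IsMinimalCP ((𝓡 1).prod ((𝓡 n₁).prod (𝓡 n₂))) Φ ↔
        IsMinimalSph (𝓡 n₁) ψ₁ ∧ IsMinimalSph (𝓡 n₂) ψ₂) := by
  have hsm := contMDiff_cpEmb hγ hA hΦ h₁.1.2.1 h₂.1.2.1
  have hloc := exists_warp hγ hA hΦ h₁.1 h₂.1
  have hdiff := fun m => differential_eq_fderiv ((hsm m).mdifferentiableAt (by simp))
  refine ⟨⟨⟨?_, ⟨hsm, fun m => ?_⟩, fun m v w => ?_⟩, fun m => ?_⟩, ?_⟩
  · simp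
    ring
  · obtain ⟨u, U, c₁, c₂, hu, hm, hrep, -⟩ := hloc m
    have h := hu.injective_fderiv_veronese hm
    rw [← hrep] at h
    exact (congrArg (fun L : EuclideanSpace ℝ (Fin 1) × EuclideanSpace ℝ (Fin n₁) ×
      EuclideanSpace ℝ (Fin n₂) →L[ℝ] MatSpace (Fin (n₁ + 1) ⊕ Fin (n₂ + 1)) =>
      Function.Injective L) (hdiff m)).mpr h
  · obtain ⟨u, U, c₁, c₂, hu, hm, hrep, -⟩ := hloc m
    have h := hu.inner_cpJ_fderiv_veronese hm v w
    have hval : cpEmb (Φ m) = veronese (u (extChartAt ((𝓡 1).prod ((𝓡 n₁).prod (𝓡 n₂))) m m)) := by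
      rw [← congrFun hrep (extChartAt ((𝓡 1).prod ((𝓡 n₁).prod (𝓡 n₂))) m m), localRep,
        Function.comp_apply, extChartAt_to_inv, Function.comp_apply]
    rw [← hrep, ← hval, ← hdiff m] at h
    exact h
  · obtain ⟨u, U, c₁, c₂, hu, hm, hrep, hdiv, -⟩ := hloc m
    rw [hrep, hu.divJH_veronese hm, hdiv, h₁.2, h₂.2, mul_zero, mul_zero, add_zero]
  · have hmin : ∀ m : Circle × N₁ × N₂, meanCurvature cpTangent
        (localRep ((𝓡 1).prod ((𝓡 n₁).prod (𝓡 n₂))) (cpEmb ∘ Φ) m)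
        (extChartAt ((𝓡 1).prod ((𝓡 n₁).prod (𝓡 n₂))) m m) = 0 ↔
        meanCurvature sphTangent (localRep (𝓡 n₁) (sphCoe ψ₁) m.2.1)
          (extChartAt (𝓡 n₁) m.2.1 m.2.1) = 0 ∧
        meanCurvature sphTangent (localRep (𝓡 n₂) (sphCoe ψ₂) m.2.2)
          (extChartAt (𝓡 n₂) m.2.2 m.2.2) = 0 := fun m => by
      obtain ⟨u, U, c₁, c₂, hu, hm, hrep, -, hH⟩ := hloc m
      rw [hrep, hu.meanCurvature_veronese_eq_zero_iff hm, hH]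
    -- The condition for Φ is pointwise on the product. A point in the other factor is needed to
    -- recover minimality of each ψ_i.
    obtain ⟨p₀⟩ := ‹Nonempty N₁›
    obtain ⟨q₀⟩ := ‹Nonempty N₂›
    exact ⟨fun h => ⟨fun p => ((hmin (1, p, q₀)).1 (h _)).1, fun q => ((hmin (1, p₀, q)).1 (h _)).2⟩,
      fun h m => (hmin m).2 ⟨h.1 _, h.2 _⟩⟩

end Main

end HMinimal

end

theorem corollary5 (n₁ n₂ : ℕ) :
    (∀ θ ∈ Set.Ioo (0 : ℝ) (Real.pi / 2),
      ∃! γ : ℝ → HMinimal.Sph (Fin 2), HMinimal.IsGammaCurve n₁ n₂ θ γ) ∧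
    ∀ θ ∈ HMinimal.GammaSet n₁ n₂, ∀ γ : ℝ → HMinimal.Sph (Fin 2),
      HMinimal.IsGammaCurve n₁ n₂ θ γ →
      ∃ A₀ : ℝ, 0 < A₀ ∧
        ∀ (N₁ : Type*) [TopologicalSpace N₁] [ChartedSpace (EuclideanSpace ℝ (Fin n₁)) N₁]
          [IsManifold (𝓡 n₁) ∞ N₁] [Nonempty N₁]
          (N₂ : Type*) [TopologicalSpace N₂] [ChartedSpace (EuclideanSpace ℝ (Fin n₂)) N₂]
          [IsManifold (𝓡 n₂) ∞ N₂] [Nonempty N₂]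
          (ψ₁ : N₁ → HMinimal.Sph (Fin (n₁ + 1))) (ψ₂ : N₂ → HMinimal.Sph (Fin (n₂ + 1))),
          HMinimal.IsCMinimalLegendrian (𝓡 n₁) ψ₁ →
          HMinimal.IsCMinimalLegendrian (𝓡 n₂) ψ₂ →
          (∀ t p q, HMinimal.hopf (HMinimal.phi γ ψ₁ ψ₂ (t + A₀) p q) =
            HMinimal.hopf (HMinimal.phi γ ψ₁ ψ₂ t p q)) ∧
          ∀ A : ℝ, 0 < A →
            (∀ t p q, HMinimal.hopf (HMinimal.phi γ ψ₁ ψ₂ (t + A) p q) =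
              HMinimal.hopf (HMinimal.phi γ ψ₁ ψ₂ t p q)) →
            ∃ Φ : Circle × N₁ × N₂ → HMinimal.CP (Fin (n₁ + 1) ⊕ Fin (n₂ + 1)),
              (∀ t p q, Φ (Circle.exp (2 * Real.pi * t / A), p, q) =
                HMinimal.hopf (HMinimal.phi γ ψ₁ ψ₂ t p q)) ∧
              HMinimal.IsHMinimalLagrangian ((𝓡 1).prod ((𝓡 n₁).prod (𝓡 n₂))) Φ ∧
              (HMinimal.IsMinimalCP ((𝓡 1).prod ((𝓡 n₁).prod (𝓡 n₂))) Φ ↔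
                HMinimal.IsMinimalSph (𝓡 n₁) ψ₁ ∧ HMinimal.IsMinimalSph (𝓡 n₂) ψ₂) := by
  refine ⟨fun θ hθ => HMinimal.existsUnique_isGammaCurve n₁ n₂ hθ, fun θ hθ γ hγ => ?_⟩
  obtain ⟨hθ', γ', hγ', T, hT, hper, r, hr⟩ := hθ
  -- The curve witnessing θ ∈ Γ is the given one, by uniqueness. So A₀ depends on the curve alone
  -- and is fixed before N₁, N₂ and the immersions.
  obtain rfl := (HMinimal.existsUnique_isGammaCurve n₁ n₂ hθ').unique hγ' hγ
  have hflow := hγ.isGammaFlow hθ'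
  obtain ⟨A₀, hA₀, hA⟩ := hflow.exists_period (hγ.hamiltonian_eq hθ') hT (hper 0) (hper 1) hr
  refine ⟨A₀, hA₀, fun N₁ _ _ _ _ N₂ _ _ _ _ ψ₁ ψ₂ h₁ h₂ => ⟨fun t p q =>
    HMinimal.hopf_phi_eq (hflow.fst_ne_zero t) (hA t) ψ₁ ψ₂ p q, fun A hA hAper => ?_⟩⟩
  obtain ⟨Φ, hΦ⟩ := HMinimal.exists_descend (F := fun t p q => HMinimal.hopf (HMinimal.phi _ ψ₁ ψ₂ t p q)) hA hAper
  exact ⟨Φ, hΦ, HMinimal.isHMinimalLagrangian_of_descend hflow hA hΦ h₁ h₂⟩
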